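/- Notation. For $x\in\mathbb R^n$ let $x^*_1\ge x^*_2\ge\dots\ge x^*_n$ be the non-increasing rearrangement of $|x_1|,\dots,|x_n|$; non-integer indices of $x^*$ are rounded down; $\|\cdot\|$ is the Euclidean norm. For an $n\times n$ matrix $A$ and $I,J\subset[n]$ let $A_{I,J}$ be the submatrix with rows $I$ and columns $J$; a vector supported in $J$ is identified with an element of $\mathbb R^J$. Steep vectors. Let $\beta\ge 1$ be an integer, $\gamma,C\ge 1$, $\rho:=pn/\log^3(pn)$, $M:=\lceil 1/(\gamma p)\rceil$, and let $n$ be sufficiently large. (a) If $\frac{\log n}{n}\le p\le (1+\frac1{2\beta})\frac{\log n}{n}$, put $N:=\lceil\exp(pn/\log^2(pn))\rceil$, let $t_0,t_1\geq 1$ be the integers with $3^{t_0-1}<N\le 3^{t_0}$ and $N\rho^{t_1-1}<M\le N\rho^{t_1}$, and let $s:=t_0+t_1$. Put $n_0:=1$, $n_j:=3^j$ for $1\le j<t_0$, $n_{t_0}:=N$, $n_j:=N\rho^{j-t_0}$ for $t_0<j<s$, and $n_s:=M$. (b) If $(1+\frac1{2\beta})\frac{\log n}{n}<p\le\frac1{2\gamma}$,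 let $s\ge1$ be the integer with $2\rho^{s-2}<M\le 2\rho^{s-1}$ and put $n_0:=1$, $n_1:=2$, $n_j:=2\rho^{j-1}$ for $2\le j<s$, and $n_s:=M$. In both cases let $\mathcal T_{1}=\mathcal T_1(\gamma,C)$ be the union over $1\le j\le s$ of $$\mathcal T_{1j}:=\Big\{x\in\mathbb R^n:\ x\notin\bigcup_{i<j}\mathcal T_{1i},\ \ x^*_{n_{j-1}}>C\,pn\,x^*_{n_j}\Big\}.$$ Theorem. For every integer $\beta\ge1$ there exist $c_\beta\in(0,\frac12)$, $C>1$ and $\gamma>1$ with $c_\beta\le\frac1{2\gamma}$, and real sequences $\varepsilon_n\to0$, $\delta_n\to0$, such that for all sufficiently large $n$ and all $p$ with $\frac{\log n}{n}\le p\le c_\beta$ the following holds. Let $A$ be an $n\times n$ random matrix with i.i.d. Bernoulli($p$) entries. Let $\Omega_{RC}$ be the event that $A$ has fewer than $\beta$ zero columns and fewer than $\beta$ zero rows. Let $\Omega(\mathcal T_1)$ be the event that there exist $I,J\subset[n]$ with $|I|=|J|=n-\beta+1$ such that $$\|A_{I,J}x\|\ge n^{-1+\varepsilon_n}\|x\|\quad\text{for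 all }x\in\mathcal T_1\text{ supported in }J,$$ $$\|A_{I,J}^{\top}x\|\ge n^{-1+\varepsilon_n}\|x\|\quad\text{for all }x\in\mathcal T_1\text{ supported in }I.$$ Then $$\big|\mathbb P\{\Omega(\mathcal T_1)^c\}-\mathbb P\{\Omega_{RC}^c\}\big|\le\delta_n\,\mathbb P\{\Omega_{RC}^c\},$$ that is, $\mathbb P\{\Omega(\mathcal T_1)^c\}=(1+o(1))\,\mathbb P\{\Omega_{RC}^c\}$ as $n\to\infty$, uniformly in $p$. -/

import Mathlib

open Real Filter Topology MeasureTheory ProbabilityTheory Matrix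

noncomputable section

namespace SteepVectors

/-- The non-increasing rearrangement `x*` of `x ∈ ℝⁿ`: `rearr x k = x*_k = |x_{σ(k)}|` for
`1 ≤ k ≤ n` (indices start at 1), where `σ` is a permutation which sorts the absolute values of the
coordinates in non-increasing order. Outside `1 ≤ k ≤ n` the value is `0`. -/
def rearr {n : ℕ} (x : EuclideanSpace ℝ (Fin n)) (k : ℕ) : ℝ :=
  if h : 1 ≤ k ∧ k ≤ n then |x (Tuple.sort (fun i => -|x i|) ⟨k - 1, by omega⟩)| else 0

/-- `pn / log³(pn)`. -/
def ratio (n : ℕ) (p : ℝ) : ℝ := p * n / (log (p * n)) ^ 3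

/-- `⌈1 / (γ p)⌉`. -/
def topLevel (γ p : ℝ) : ℕ := ⌈1 / (γ * p)⌉₊

/-! ### Levels for `log n / n ≤ p ≤ (1 + 1/(2β)) log n / n` -/

/-- `⌈exp (pn / log²(pn))⌉`. -/
def expLevel (n : ℕ) (p : ℝ) : ℕ := ⌈exp (p * n / (log (p * n)) ^ 2)⌉₊

/-- `t₀`, with `3 ^ (t₀ - 1) < expLevel ≤ 3 ^ t₀`. -/
def t₀ (n : ℕ) (p : ℝ) : ℕ := sInf {t : ℕ | expLevel n p ≤ 3 ^ t}

/-- `t₁`, with `expLevel * ratio ^ (t₁ - 1) < topLevel ≤ expLevel * ratio ^ t₁`. -/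
def t₁ (γ : ℝ) (n : ℕ) (p : ℝ) : ℕ :=
  sInf {t : ℕ | (topLevel γ p : ℝ) ≤ expLevel n p * ratio n p ^ t}

/-- The number of levels `s = t₀ + t₁`. -/
def sSmall (γ : ℝ) (n : ℕ) (p : ℝ) : ℕ := t₀ n p + t₁ γ n p

/-- The levels `n_0, …, n_s`. Non-integer values are rounded down, so that they can serve as
indices of the rearrangement. -/
def levelSmall (γ : ℝ) (n : ℕ) (p : ℝ) (j : ℕ) : ℕ :=
  if j = 0 then 1
  else if j < t₀ n p then 3 ^ j
  else if j = t₀ n p then expLevel n p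
  else if j < sSmall γ n p then ⌊expLevel n p * ratio n p ^ (j - t₀ n p)⌋₊
  else topLevel γ p

/-! ### Levels for `(1 + 1/(2β)) log n / n < p ≤ 1 / (2γ)` -/

/-- The number of levels `s`, with `2 * ratio ^ (s - 2) < topLevel ≤ 2 * ratio ^ (s - 1)`. -/
def sLarge (γ : ℝ) (n : ℕ) (p : ℝ) : ℕ :=
  sInf {t : ℕ | (topLevel γ p : ℝ) ≤ 2 * ratio n p ^ t} + 1

/-- The levels `n_0, …, n_s`, non-integer values being rounded down. -/
def levelLarge (γ : ℝ) (n : ℕ) (p : ℝ) (j : ℕ) : ℕ :=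
  if j = 0 then 1
  else if j = 1 then 2
  else if j < sLarge γ n p then ⌊2 * ratio n p ^ (j - 1)⌋₊
  else topLevel γ p

/-! ### Steep vectors -/

/-- The number of levels for the given `β`, depending on the regime of `p`. -/
def numLevels (β : ℕ) (γ : ℝ) (n : ℕ) (p : ℝ) : ℕ :=
  if p ≤ (1 + 1 / (2 * (β : ℝ))) * (log n / n) then sSmall γ n p else sLarge γ n p

/-- The levels for the given `β`, depending on the regime of `p`. -/
def level (β : ℕ) (γ : ℝ) (n : ℕ) (p : ℝ) (j : ℕ) : ℕ :=
  if p ≤ (1 + 1 / (2 * (β : ℝ))) * (log n / n) then levelSmall γ n p j else levelLarge γ n p j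

/-- The steep vectors `𝒯₁ = 𝒯₁(γ, C)`: the union over `1 ≤ j ≤ s` of
`𝒯₁ⱼ = {x ∉ 𝒯₁₁ ∪ … ∪ 𝒯₁₍ⱼ₋₁₎ : x*_{n_{j-1}} > C pn x*_{n_j}}`. Taking away the earlier pieces
from `𝒯₁ⱼ` does not change the union, so it is left out. -/
def T1 (β : ℕ) (γ C : ℝ) (n : ℕ) (p : ℝ) : Set (EuclideanSpace ℝ (Fin n)) :=
  {x | ∃ j : ℕ, 1 ≤ j ∧ j ≤ numLevels β γ n p ∧
    C * (p * n) * rearr x (level β γ n p j) < rearr x (level β γ n p (j - 1))}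

/-! ### Random matrices and events -/

/-- `A` is a random `n × n` matrix with i.i.d. Bernoulli(`p`) entries. -/
structure IsBernoulliMatrix {Ω : Type*} [MeasurableSpace Ω] (μ : Measure Ω) {n : ℕ} (p : ℝ)
    (A : Ω → Matrix (Fin n) (Fin n) ℝ) : Prop where
  measurable_entry : ∀ i j, Measurable (fun ω => A ω i j)
  indep : iIndepFun (fun (ij : Fin n × Fin n) (ω : Ω) => A ω ij.1 ij.2) μ
  prob_one : ∀ i j, μ {ω | A ω i j = 1} = ENNReal.ofReal p
  prob_zero : ∀ i j, μ {ω | A ω i j = 0} = ENNReal.ofReal (1 - p)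

/-- The set `ℒ_A(k)` of the columns of `A` with at most `k` non-zero entries. -/
def lightCols {n : ℕ} (A : Matrix (Fin n) (Fin n) ℝ) (k : ℕ) : Set (Fin n) :=
  {j | Set.ncard {i | A i j ≠ 0} ≤ k}

/-- `A ∈ Ω_RC`: fewer than `β` zero columns and fewer than `β` zero rows. -/
def InOmegaRC {n : ℕ} (β : ℕ) (A : Matrix (Fin n) (Fin n) ℝ) : Prop :=
  (lightCols A 0).ncard < β ∧ (lightCols Aᵀ 0).ncard < β

/-- The submatrix `A_{I,J}` with rows `I` and columns `J`. -/
def sub {n : ℕ} (A : Matrix (Fin n) (Fin n) ℝ) (I J : Finset (Fin n)) : Matrix I J ℝ :=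
  A.submatrix (fun i => (i : Fin n)) (fun j => (j : Fin n))

/-- The Euclidean norm of `M y`. -/
def normMulVec {ι κ : Type*} [Fintype ι] [Fintype κ] (M : Matrix ι κ ℝ) (y : κ → ℝ) : ℝ :=
  ‖(WithLp.toLp 2 (M *ᵥ y) : EuclideanSpace ℝ ι)‖

/-- The event `Ω(𝒯₁)` (for `T = 𝒯₁` and a lower bound `θ`): there are `I, J` of size `n - β + 1`
such that `‖A_{I,J} x‖ ≥ θ ‖x‖` for all `x ∈ T` supported in `J` and `‖A_{I,J}ᵀ x‖ ≥ θ ‖x‖` for all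
`x ∈ T` supported in `I`. -/
def InOmegaT {n : ℕ} (β : ℕ) (T : Set (EuclideanSpace ℝ (Fin n))) (θ : ℝ)
    (A : Matrix (Fin n) (Fin n) ℝ) : Prop :=
  ∃ I J : Finset (Fin n), I.card + β = n + 1 ∧ J.card + β = n + 1 ∧
    (∀ x ∈ T, (∀ j, j ∉ J → x j = 0) →
      θ * ‖x‖ ≤ normMulVec (sub A I J) (fun j => x j)) ∧
    (∀ x ∈ T, (∀ i, i ∉ I → x i = 0) →
      θ * ‖x‖ ≤ normMulVec (sub A I J)ᵀ (fun i => x i))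

end SteepVectors

end

/-!
Write `y = pn ≥ log n`. All estimates are uniform in `p` once `y` is large.

If `A` has `β` zero columns, then every admissible `J` contains one of them, and the corresponding
unit vector is steep and is annihilated (`inOmegaRC_of_inOmegaT`). So `Ω_RCᶜ ⊆ Ω(𝒯₁)ᶜ`, and it has
to be shown that `Ω(𝒯₁)ᶜ ∩ Ω_RC` has probability `o(ℙ(Ω_RCᶜ))`, where
`ℙ(Ω_RCᶜ) ≥ c (n exp (-y (1 + 2p))) ^ β` (`le_gP_not_inOmegaRC`).

*From rows to norms.* Let `x` be steep and let `j` be the first level at which it drops, with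
`a = x*_{n_{j-1}}` and `b = x*_{n_j} < a / (Cy)`. As row sums are `O(y)`, the coordinates beyond
`n_j` contribute little to each entry of `Ax`. So one looks for a row which has exactly one one
among the `n_j` largest coordinates, at a coordinate of size comparable with `a`. Since `x` does not
drop before `j` and the levels grow at most like `(Cy) ^ i`, `‖x‖ ≤ n ^ (1 + o(1)) a`
(`norm_sq_le_of_levels`, `theta_condition`). The sequence `ε` of the theorem is negative.

*Overlaps.* For column sets `J₁ ⊆ J₂` of sizes `m ≤ m' ≤ 2ρm`, let the overlap be the number of ones
in `J₁` that lie in a row with at least two ones in `J₂`. Given more ones in `J₁` than the overlap,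
there is a row as above (`exists_unique_row`). The overlap is a sum of independent contributions of
the rows, and a Chernoff bound with parameter `(m' p) ^ (-1/2)` and a union bound show that it is at
most `y m (8 / log³ y + K / log (1 / (m' p)))` for all `J₁`, `J₂`, up to an event of probability
`exp (-(K/2 - 6) y)` (`gP_not_overlapsBounded_le`). As `m' p ≤ 2 / γ`, this is a small multiple of
`y m`, if `γ` is large. Hence it remains to see that `J₁` has many ones. Call a column light if it
has at most `τ y` ones.

*Denser regime.* Up to relative probability `o(1)`, there are at most `β` light rows and columns in
total (`gP_many_light_le_mul`). They can be removed, except for at most one, which is nonzero. Thus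
at least half of any two or more columns are heavy, and a single nonzero column is good by itself,
because `n_1 = 2` (`exists_row_large`).

*Sparse regime.* Here `ℙ(Ω_RCᶜ)` is at least about `n ^ (-1/2)`. There may be many light columns,
but they do not meet, and every column meets the others among them in at most one row
(`LightSparse`). For levels growing by a factor `3`, either a large light coordinate is visible in a
row of its column, or heavy columns with comparable coordinates cancel it there. One heavy column
can do so only once, so there are many of them, and one of them owns a row
(`exists_row_of_lightSparse`). From the level `exp (y / log² y)` on, any `m` columns have enough
ones by a direct union bound (`gP_few_hits_le`): the gain `log m` in the entropy `m log (n / m)`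
compensates for the loss in the tail estimate.

The probabilities are computed as finite sums over `0/1` patterns
(`IsBernoulliMatrix.measureReal_eq`).
-/


noncomputable section

namespace SteepVectors

/-! ### The finite model of a Bernoulli matrix -/

/-- The `0/1` patterns of an `n × n` matrix. -/
abbrev Grid (n : ℕ) := Fin n → Fin n → Bool

/-- The Bernoulli(`p`) weight of a single entry. -/
def bw (p : ℝ) (b : Bool) : ℝ := if b then p else 1 - p

/-- The probability of the pattern `B` under independent Bernoulli(`p`) entries. -/
def gw {n : ℕ} (p : ℝ) (B : Grid n) : ℝ := ∏ i, ∏ j, bw p (B i j)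

/-- The expectation of a function of the pattern. -/
def gE {n : ℕ} (p : ℝ) (f : Grid n → ℝ) : ℝ := ∑ B, gw p B * f B

/-- The probability of a set of patterns. -/
def gP {n : ℕ} (p : ℝ) (S : Set (Grid n)) : ℝ := gE p (S.indicator 1)

/-- The expectation of a function of a single row. -/
def rE {n : ℕ} (p : ℝ) (g : (Fin n → Bool) → ℝ) : ℝ := ∑ r, (∏ j, bw p (r j)) * g r

/-- The `0/1` matrix with pattern `B`. -/
def toM {n : ℕ} (B : Grid n) : Matrix (Fin n) (Fin n) ℝ := fun i j => if B i j then 1 else 0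

/-- The transposed pattern. -/
def tr {n : ℕ} (B : Grid n) : Grid n := fun i j => B j i

section Model

variable {n : ℕ} {p : ℝ}

@[simp] lemma bw_true : bw p true = p := by simp [bw]
@[simp] lemma bw_false : bw p false = 1 - p := by simp [bw]

@[simp] lemma tr_tr (B : Grid n) : tr (tr B) = B := rfl

lemma toM_tr (B : Grid n) : toM (tr B) = (toM B)ᵀ := rfl

lemma bw_nonneg (h0 : 0 ≤ p) (h1 : p ≤ 1) (b : Bool) : 0 ≤ bw p b := by
  cases b <;> simp [h0, h1]

lemma gw_nonneg (h0 : 0 ≤ p) (h1 : p ≤ 1) (B : Grid n) : 0 ≤ gw p B :=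
  Finset.prod_nonneg fun _ _ => Finset.prod_nonneg fun _ _ => bw_nonneg h0 h1 _

lemma gw_tr (B : Grid n) : gw p (tr B) = gw p B := by
  unfold gw tr
  rw [Finset.prod_comm]

lemma gE_prod_rows (g : Fin n → (Fin n → Bool) → ℝ) :
    gE p (fun B => ∏ i, g i (B i)) = ∏ i, rE p (g i) := by
  unfold gE gw rE
  rw [Fintype.prod_sum]
  refine Finset.sum_congr rfl fun B _ => ?_
  rw [← Finset.prod_mul_distrib]

lemma rE_prod (g : Fin n → Bool → ℝ) :
    rE p (fun r => ∏ j, g j (r j)) = ∏ j, ((1 - p) * g j false + p * g j true) := by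
  unfold rE
  have : ∀ j, (1 - p) * g j false + p * g j true = ∑ b, bw p b * g j b := by
    intro j
    simp [add_comm]
  simp_rw [this]
  rw [Fintype.prod_sum]
  refine Finset.sum_congr rfl fun B _ => ?_
  rw [← Finset.prod_mul_distrib]

lemma rE_add (f g : (Fin n → Bool) → ℝ) : rE p (fun r => f r + g r) = rE p f + rE p g := by
  simp [rE, mul_add, Finset.sum_add_distrib]

lemma rE_sum {ι : Type*} (s : Finset ι) (f : ι → (Fin n → Bool) → ℝ) :
    rE p (fun r => ∑ i ∈ s, f i r) = ∑ i ∈ s, rE p (f i) := by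
  unfold rE
  rw [Finset.sum_comm]
  simp [Finset.mul_sum]

lemma rE_mono (h0 : 0 ≤ p) (h1 : p ≤ 1) {f g : (Fin n → Bool) → ℝ} (h : ∀ r, f r ≤ g r) :
    rE p f ≤ rE p g :=
  Finset.sum_le_sum fun r _ => mul_le_mul_of_nonneg_left (h r)
    (Finset.prod_nonneg fun _ _ => bw_nonneg h0 h1 _)

lemma rE_nonneg (h0 : 0 ≤ p) (h1 : p ≤ 1) {f : (Fin n → Bool) → ℝ} (h : ∀ r, 0 ≤ f r) :
    0 ≤ rE p f :=
  Finset.sum_nonneg fun r _ => mul_nonneg (Finset.prod_nonneg fun _ _ => bw_nonneg h0 h1 _) (h r)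

lemma rE_one : rE p (fun _ : Fin n → Bool => 1) = 1 := by
  have := rE_prod (n := n) (p := p) (fun _ _ => 1)
  simpa using this

lemma gE_mono (h0 : 0 ≤ p) (h1 : p ≤ 1) {f g : Grid n → ℝ} (h : ∀ B, f B ≤ g B) :
    gE p f ≤ gE p g :=
  Finset.sum_le_sum fun B _ => mul_le_mul_of_nonneg_left (h B) (gw_nonneg h0 h1 B)

lemma gE_sum {ι : Type*} (s : Finset ι) (f : ι → Grid n → ℝ) :
    gE p (fun B => ∑ i ∈ s, f i B) = ∑ i ∈ s, gE p (f i) := by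
  unfold gE
  rw [Finset.sum_comm]
  simp [Finset.mul_sum]

lemma gE_const_mul (c : ℝ) (f : Grid n → ℝ) : gE p (fun B => c * f B) = c * gE p f := by
  simp only [gE, Finset.mul_sum]
  exact Finset.sum_congr rfl fun _ _ => by ring

lemma gE_prod_entries (g : Fin n → Fin n → Bool → ℝ) :
    gE p (fun B => ∏ i, ∏ j, g i j (B i j)) =
      ∏ i, ∏ j, ((1 - p) * g i j false + p * g i j true) := by
  rw [gE_prod_rows (fun i r => ∏ j, g i j (r j))]
  exact Finset.prod_congr rfl fun i _ => rE_prod _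

lemma gP_mono (h0 : 0 ≤ p) (h1 : p ≤ 1) {S T : Set (Grid n)} (h : S ⊆ T) : gP p S ≤ gP p T :=
  gE_mono h0 h1 fun B => Set.indicator_le_indicator_of_subset h (fun _ => zero_le_one) B

/-- Markov's inequality. -/
lemma gP_le_gE (h0 : 0 ≤ p) (h1 : p ≤ 1) {S : Set (Grid n)} {f : Grid n → ℝ}
    (hf : ∀ B, 0 ≤ f B) (h : ∀ B ∈ S, 1 ≤ f B) : gP p S ≤ gE p f := by
  refine gE_mono h0 h1 fun B => ?_
  by_cases hB : B ∈ S
  · simpa [hB] using h B hB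
  · simpa [hB] using hf B

lemma gP_exists_le (h0 : 0 ≤ p) (h1 : p ≤ 1) {ι : Type*} (s : Finset ι) (S : ι → Set (Grid n)) :
    gP p {B | ∃ i ∈ s, B ∈ S i} ≤ ∑ i ∈ s, gP p (S i) := by
  classical
  unfold gP
  rw [← gE_sum]
  refine gE_mono h0 h1 fun B => ?_
  have hn : ∀ i ∈ s, 0 ≤ (S i).indicator (1 : Grid n → ℝ) B := fun i _ =>
    Set.indicator_nonneg (fun _ _ => zero_le_one) _
  by_cases hB : ∃ i ∈ s, B ∈ S i
  · obtain ⟨i, hi, hBi⟩ := hB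
    have := Finset.single_le_sum hn hi
    have h2 : (S i).indicator (1 : Grid n → ℝ) B = 1 := by simp [hBi]
    refine le_trans ?_ this
    rw [h2]
    exact Set.indicator_le_self' (fun _ _ => zero_le_one) B
  · have : ({B | ∃ i ∈ s, B ∈ S i} : Set (Grid n)).indicator (1 : Grid n → ℝ) B = 0 :=
      Set.indicator_of_notMem (by exact hB) _
    rw [this]
    exact Finset.sum_nonneg hn

/-- Union bound with a uniform bound on the pieces. -/
lemma gP_exists_le_card_mul (h0 : 0 ≤ p) (h1 : p ≤ 1) {ι : Type*} (s : Finset ι)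
    (S : ι → Set (Grid n)) {q : ℝ} (hq : ∀ i ∈ s, gP p (S i) ≤ q) :
    gP p {B | ∃ i ∈ s, B ∈ S i} ≤ s.card * q := by
  refine (gP_exists_le h0 h1 s S).trans ((Finset.sum_le_sum hq).trans ?_)
  simp

lemma gP_union_le (h0 : 0 ≤ p) (h1 : p ≤ 1) (S T : Set (Grid n)) :
    gP p (S ∪ T) ≤ gP p S + gP p T := by
  have := gP_exists_le h0 h1 Finset.univ (fun b : Bool => if b then S else T)
  refine le_trans (gP_mono h0 h1 ?_) (this.trans ?_)
  · rintro B (h | h)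
    · exact ⟨true, by simp, by simpa using h⟩
    · exact ⟨false, by simp, by simpa using h⟩
  · simp

lemma gP_tr (S : Set (Grid n)) : gP p {B | tr B ∈ S} = gP p S := by
  unfold gP gE
  let e : Grid n ≃ Grid n := ⟨tr, tr, tr_tr, tr_tr⟩
  rw [← Equiv.sum_comp e]
  refine Finset.sum_congr rfl fun B _ => ?_
  change gw p (tr B) * _ = gw p B * _
  rw [gw_tr]
  rfl

/-- The number of ones of `B` among the entries `E`. -/
def ones (B : Grid n) (E : Finset (Fin n × Fin n)) : ℕ := (E.filter fun e => B e.1 e.2 = true).card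

lemma gE_prescribed_mul_pow (F E : Finset (Fin n × Fin n)) (hFE : Disjoint F E) (s : ℝ) :
    gE p (fun B : Grid n => (if ∀ e ∈ F, B e.1 e.2 = true then 1 else 0) * s ^ ones B E) =
      p ^ F.card * (1 - p + p * s) ^ E.card := by
  classical
  let g : Fin n → Fin n → Bool → ℝ := fun i j b =>
    (if (i, j) ∈ F then (if b then 1 else 0) else 1) * (if (i, j) ∈ E then (if b then s else 1) else 1)
  have h1 : ∀ B : Grid n, (if ∀ e ∈ F, B e.1 e.2 = true then (1 : ℝ) else 0) * s ^ ones B E =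
      ∏ i, ∏ j, g i j (B i j) := by
    intro B
    rw [← Finset.prod_product' Finset.univ Finset.univ (fun i j => g i j (B i j)),
      Finset.univ_product_univ]
    simp only [g, Prod.mk.eta, Finset.prod_mul_distrib]
    congr 1
    · rw [← Finset.prod_filter]
      simp only [Finset.filter_mem_eq_inter, Finset.univ_inter]
      rw [Finset.prod_ite_zero]
      simp
    · rw [← Finset.prod_filter]
      simp only [Finset.filter_mem_eq_inter, Finset.univ_inter]
      rw [← Finset.prod_filter]
      simp [ones]
  simp_rw [h1]
  rw [gE_prod_entries, ← Finset.prod_product' Finset.univ Finset.univ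
    (fun i j => (1 - p) * g i j false + p * g i j true), Finset.univ_product_univ]
  have h2 : ∀ e : Fin n × Fin n, (1 - p) * g e.1 e.2 false + p * g e.1 e.2 true =
      (if e ∈ F then p else 1) * (if e ∈ E then 1 - p + p * s else 1) := by
    intro e
    by_cases hF : e ∈ F
    · have hE : e ∉ E := Finset.disjoint_left.1 hFE hF
      simp [g, hF, hE]
    · by_cases hE : e ∈ E <;> simp [g, hF, hE]
  rw [Finset.prod_congr rfl (fun e _ => h2 e), Finset.prod_mul_distrib, ← Finset.prod_filter,
    ← Finset.prod_filter]
  simp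

/-- Chernoff bound for the lower tail, together with prescribed ones. -/
lemma gP_prescribed_and_ones_le (h0 : 0 ≤ p) (h1 : p ≤ 1) (F E : Finset (Fin n × Fin n))
    (hFE : Disjoint F E) {s T : ℝ} (hs : 0 < s) (hs1 : s ≤ 1) :
    gP p {B | (∀ e ∈ F, B e.1 e.2 = true) ∧ (ones B E : ℝ) ≤ T} ≤
      p ^ F.card * exp (T * log (1 / s) - p * (1 - s) * E.card) := by
  classical
  have hlog : 0 ≤ log (1 / s) := log_nonneg (by rw [le_div_iff₀ hs]; linarith)
  have hstep := gP_le_gE (n := n) h0 h1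
    (S := {B | (∀ e ∈ F, B e.1 e.2 = true) ∧ (ones B E : ℝ) ≤ T})
    (f := fun B => exp (T * log (1 / s)) *
      ((if ∀ e ∈ F, B e.1 e.2 = true then 1 else 0) * s ^ ones B E))
    (fun B => by positivity) (by
      rintro B ⟨hF, hT⟩
      rw [if_pos hF, one_mul]
      have : s ^ ones B E = exp (-(ones B E * log (1 / s))) := by
        rw [one_div, log_inv, mul_neg, neg_neg, mul_comm, exp_mul, exp_log hs, rpow_natCast]
      rw [this, ← exp_add]
      apply one_le_exp
      nlinarith)
  refine hstep.trans ?_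
  rw [gE_const_mul, gE_prescribed_mul_pow F E hFE]
  have h3 : (1 - p + p * s) ^ E.card ≤ exp (-(p * (1 - s) * E.card)) := by
    have : 1 - p + p * s ≤ exp (-(p * (1 - s))) := by
      have := add_one_le_exp (-(p * (1 - s)))
      linarith
    calc _ ≤ (exp (-(p * (1 - s)))) ^ E.card := by
          apply pow_le_pow_left₀ _ this
          nlinarith
      _ = _ := by rw [← exp_nat_mul]; ring_nf
  calc _ = p ^ F.card * (exp (T * log (1 / s)) * (1 - p + p * s) ^ E.card) := by ring
    _ ≤ p ^ F.card * (exp (T * log (1 / s)) * exp (-(p * (1 - s) * E.card))) := by gcongr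
    _ = _ := by rw [← exp_add]; ring_nf

lemma gP_ones_le (h0 : 0 ≤ p) (h1 : p ≤ 1) (E : Finset (Fin n × Fin n)) {s T : ℝ} (hs : 0 < s)
    (hs1 : s ≤ 1) :
    gP p {B | (ones B E : ℝ) ≤ T} ≤ exp (T * log (1 / s) - p * (1 - s) * E.card) := by
  simpa using gP_prescribed_and_ones_le h0 h1 ∅ E (by simp) (T := T) hs hs1

/-- Chernoff bound for the upper tail. -/
lemma gP_le_ones (h0 : 0 ≤ p) (h1 : p ≤ 1) (E : Finset (Fin n × Fin n)) {T : ℝ} :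
    gP p {B | T ≤ (ones B E : ℝ)} ≤ exp (2 * (p * E.card) - T) := by
  have hstep := gP_le_gE (n := n) h0 h1
    (S := {B | T ≤ (ones B E : ℝ)})
    (f := fun B => exp (-T) *
      ((if ∀ e ∈ (∅ : Finset (Fin n × Fin n)), B e.1 e.2 = true then 1 else 0) * exp 1 ^ ones B E))
    (fun B => by simp; positivity) (by
      intro B hT
      change T ≤ (ones B E : ℝ) at hT
      simp only [Finset.notMem_empty, false_imp_iff, implies_true, if_true, one_mul]
      rw [← exp_nat_mul, ← exp_add]
      apply one_le_exp
      linarith)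
  refine hstep.trans ?_
  rw [gE_const_mul, gE_prescribed_mul_pow ∅ E (by simp)]
  have h3 : (1 - p + p * exp 1) ^ E.card ≤ exp (2 * (p * E.card)) := by
    have : 1 - p + p * exp 1 ≤ exp (2 * p) := by
      have := add_one_le_exp (2 * p)
      have := exp_one_lt_d9
      nlinarith
    calc _ ≤ (exp (2 * p)) ^ E.card := by
          apply pow_le_pow_left₀ _ this
          have := exp_pos 1
          nlinarith
      _ = _ := by rw [← exp_nat_mul]; ring_nf
  calc _ ≤ exp (-T) * (p ^ 0 * exp (2 * (p * E.card))) := by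
        simp only [Finset.card_empty]; gcongr
    _ = _ := by rw [pow_zero, one_mul, ← exp_add]; ring_nf

end Model

/-- The number of ones of the row `r` in the columns `J`. -/
def cnt {n : ℕ} (r : Fin n → Bool) (J : Finset (Fin n)) : ℕ := (J.filter fun k => r k = true).card

/-- The number of ones of `B` in the columns `J₁` that lie in a row with at least two ones in the
columns `J₂`. -/
def overlap {n : ℕ} (B : Grid n) (J₁ J₂ : Finset (Fin n)) : ℕ :=
  ∑ i, if 2 ≤ cnt (B i) J₂ then cnt (B i) J₁ else 0

section Overlap

variable {n : ℕ} {p : ℝ}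

lemma pow_cnt (s : ℝ) (r : Fin n → Bool) (J : Finset (Fin n)) :
    s ^ cnt r J = ∏ j, if j ∈ J then (if r j = true then s else 1) else 1 := by
  classical
  rw [← Finset.prod_filter]
  simp only [Finset.filter_mem_eq_inter, Finset.univ_inter]
  rw [← Finset.prod_filter]
  simp [cnt]

/-- The two prescribed ones cost `p ^ 2`, and the exponential weight contributes at most a factor
`s` at each of them. -/
lemma rE_pair_mul_pow_le (h0 : 0 ≤ p) (h1 : p ≤ 1) {s : ℝ} (hs : 1 ≤ s) (J : Finset (Fin n))
    {k l : Fin n} (hkl : k ≠ l) :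
    rE p (fun r => (if r k = true ∧ r l = true then 1 else 0) * s ^ cnt r J) ≤
      (p * s) ^ 2 * exp (J.card * (p * s)) := by
  classical
  let g : Fin n → Bool → ℝ := fun j b =>
    (if j ∈ ({k, l} : Finset (Fin n)) then (if b = true then 1 else 0) else 1) *
      (if j ∈ J then (if b = true then s else 1) else 1)
  have hg : ∀ r : Fin n → Bool, (if r k = true ∧ r l = true then (1 : ℝ) else 0) * s ^ cnt r J =
      ∏ j, g j (r j) := by
    intro r
    simp only [g, Finset.prod_mul_distrib, pow_cnt]
    congr 1
    rw [← Finset.prod_filter]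
    simp only [Finset.filter_mem_eq_inter, Finset.univ_inter]
    rw [Finset.prod_ite_zero]
    simp
  simp_rw [hg]
  rw [rE_prod]
  have hps : 0 ≤ p * s := by positivity
  have hb : ∀ j ∈ Finset.univ, (1 - p) * g j false + p * g j true ≤
      (if j ∈ ({k, l} : Finset (Fin n)) then p * s else 1) *
        (if j ∈ J then exp (p * s) else 1) := by
    intro j _
    have he : 1 ≤ exp (p * s) := one_le_exp hps
    have he2 := add_one_le_exp (p * s)
    by_cases hj : j ∈ ({k, l} : Finset (Fin n)) <;> by_cases hJ : j ∈ J <;>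
      simp only [g, hj, hJ, if_true, if_false, Bool.false_eq_true] <;> nlinarith
  refine (Finset.prod_le_prod (fun j _ => ?_) hb).trans (le_of_eq ?_)
  · have : ∀ b, 0 ≤ g j b := by
      intro b
      simp only [g]
      split_ifs <;> simp <;> linarith
    have h3 := this false
    have h4 := this true
    have : 0 ≤ 1 - p := by linarith
    positivity
  · rw [Finset.prod_mul_distrib, ← Finset.prod_filter, ← Finset.prod_filter]
    simp only [Finset.filter_mem_eq_inter, Finset.univ_inter, Finset.prod_const]
    rw [Finset.card_pair hkl, exp_nat_mul]

/-- Chernoff bound for the overlap. It is a sum of independent contributions of the rows, and a row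
contributes only if it has ones at two different places `k ∈ J₁`, `l ∈ J₂`. -/
lemma gP_le_overlap (h0 : 0 ≤ p) (h1 : p ≤ 1) {s R : ℝ} (hs : 1 ≤ s) (J₁ J₂ : Finset (Fin n)) :
    gP p {B | R ≤ (overlap B J₁ J₂ : ℝ)} ≤
      exp (-(R * log s) + n * (J₁.card * J₂.card * ((p * s) ^ 2 * exp (J₁.card * (p * s))))) := by
  classical
  set X := (J₁.card * J₂.card * ((p * s) ^ 2 * exp (J₁.card * (p * s))) : ℝ) with hX
  have hs0 : 0 < s := by linarith
  have hlog : 0 ≤ log s := log_nonneg hs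
  -- the exponential of the contribution of a row is bounded by a sum over pairs of ones
  have hpoint : ∀ r : Fin n → Bool, s ^ (if 2 ≤ cnt r J₂ then cnt r J₁ else 0) ≤
      1 + ∑ k ∈ J₁, ∑ l ∈ J₂, if k ≠ l then
        (if r k = true ∧ r l = true then (1 : ℝ) else 0) * s ^ cnt r J₁ else 0 := by
    intro r
    have hnn : ∀ k ∈ J₁, ∀ l ∈ J₂, (0 : ℝ) ≤ if k ≠ l then
        (if r k = true ∧ r l = true then (1 : ℝ) else 0) * s ^ cnt r J₁ else 0 := by
      intro k _ l _
      split_ifs <;> positivity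
    have hnn2 := Finset.sum_nonneg fun k hk => Finset.sum_nonneg (hnn k hk)
    split_ifs with h2
    · by_cases hc : cnt r J₁ = 0
      · rw [hc]
        simpa [hc] using hnn2
      · obtain ⟨k, hk⟩ := Finset.card_pos.1 (Nat.pos_of_ne_zero hc)
        obtain ⟨l, hl, hlk⟩ := Finset.exists_mem_ne (lt_of_lt_of_le one_lt_two h2) k
        rw [Finset.mem_filter] at hk hl
        have h3 := Finset.single_le_sum (hnn k hk.1) hl.1
        have h4 := Finset.single_le_sum (fun k hk => Finset.sum_nonneg (hnn k hk)) hk.1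
        have h5 : (if k ≠ l then
          (if r k = true ∧ r l = true then (1 : ℝ) else 0) * s ^ cnt r J₁ else 0) =
            s ^ cnt r J₁ := by
          simp [hk.2, hl.2, hlk.symm]
        rw [h5] at h3
        linarith
    · simpa using hnn2
  have hrow : rE p (fun r : Fin n → Bool => s ^ (if 2 ≤ cnt r J₂ then cnt r J₁ else 0)) ≤ exp X := by
    refine (rE_mono h0 h1 hpoint).trans ?_
    rw [rE_add, rE_one, rE_sum]
    have hb : ∀ k ∈ J₁, rE p (fun r : Fin n → Bool => ∑ l ∈ J₂, if k ≠ l then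
        (if r k = true ∧ r l = true then (1 : ℝ) else 0) * s ^ cnt r J₁ else 0) ≤
        J₂.card * ((p * s) ^ 2 * exp (J₁.card * (p * s))) := by
      intro k _
      rw [rE_sum, ← nsmul_eq_mul]
      refine Finset.sum_le_card_nsmul _ _ _ fun l _ => ?_
      by_cases hkl : k = l
      · simp [hkl, rE]
        positivity
      · simpa [hkl] using rE_pair_mul_pow_le h0 h1 hs J₁ hkl
    have := Finset.sum_le_card_nsmul _ _ _ hb
    rw [nsmul_eq_mul] at this
    have hX2 := add_one_le_exp X
    have : X = J₁.card * (J₂.card * ((p * s) ^ 2 * exp (J₁.card * (p * s)))) := by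
      rw [hX]; ring
    linarith
  have hstep := gP_le_gE (n := n) h0 h1 (S := {B | R ≤ (overlap B J₁ J₂ : ℝ)})
    (f := fun B => exp (-(R * log s)) * s ^ overlap B J₁ J₂)
    (fun B => by positivity) (by
      intro B hB
      change R ≤ (overlap B J₁ J₂ : ℝ) at hB
      have : s ^ overlap B J₁ J₂ = exp (overlap B J₁ J₂ * log s) := by
        rw [mul_comm, exp_mul, exp_log hs0, rpow_natCast]
      rw [this, ← exp_add]
      apply one_le_exp
      nlinarith)
  refine hstep.trans ?_
  rw [gE_const_mul, exp_add]
  gcongr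
  have : ∀ B : Grid n, s ^ overlap B J₁ J₂ =
      ∏ i, (fun r : Fin n → Bool => s ^ (if 2 ≤ cnt r J₂ then cnt r J₁ else 0)) (B i) := by
    intro B
    simp only [overlap, Finset.prod_pow_eq_pow_sum]
  simp_rw [this]
  rw [gE_prod_rows (fun _ r => s ^ (if 2 ≤ cnt r J₂ then cnt r J₁ else 0)), exp_nat_mul]
  simp only [Finset.prod_const, Finset.card_univ, Fintype.card_fin]
  exact pow_le_pow_left₀ (rE_nonneg h0 h1 fun r => by positivity) hrow n

end Overlap

section ZeroRows

variable {n : ℕ} {p : ℝ}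

/-- The set of rows of `B` without ones. -/
def zeroRows (B : Grid n) : Finset (Fin n) := Finset.univ.filter fun i => ∀ j, B i j = false

/-- A lower bound for the probability of many zero rows: sum the probabilities of the disjoint
events that exactly the rows in `S` vanish, `|S| = β`. -/
lemma le_gP_zeroRows (h0 : 0 ≤ p) (h1 : p ≤ 1) (β : ℕ) :
    (n.choose β : ℝ) * (((1 - p) ^ n) ^ β * (1 - (1 - p) ^ n) ^ (n - β)) ≤
      gP p {B : Grid n | β ≤ (zeroRows B).card} := by
  classical
  set Q := (1 - p) ^ n with hQ
  let z : (Fin n → Bool) → ℝ := fun r => if ∀ j, r j = false then 1 else 0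
  let z' : (Fin n → Bool) → ℝ := fun r => if ∀ j, r j = false then 0 else 1
  have hz : rE p z = Q := by
    have hz2 : z = fun r => ∏ j, (fun b : Bool => if b = false then (1 : ℝ) else 0) (r j) := by
      funext r
      simp only [z]
      rw [Finset.prod_ite_zero]
      simp
    rw [hz2, rE_prod (fun _ (b : Bool) => if b = false then (1 : ℝ) else 0)]
    simp [hQ]
  have hz' : rE p z' = 1 - Q := by
    have h := rE_add (p := p) z z'
    have h2 : (fun r => z r + z' r) = fun _ : Fin n → Bool => (1 : ℝ) := by
      funext r
      simp only [z, z']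
      split_ifs <;> simp
    rw [h2, rE_one, hz] at h
    linarith
  have hone : ∀ S ∈ Finset.powersetCard β (Finset.univ : Finset (Fin n)),
      gE p (fun B : Grid n => ∏ i, (if i ∈ S then z else z') (B i)) =
        Q ^ β * (1 - Q) ^ (n - β) := by
    intro S hS
    rw [Finset.mem_powersetCard] at hS
    rw [gE_prod_rows (fun i => if i ∈ S then z else z')]
    have : ∀ i, rE p (if i ∈ S then z else z') = if i ∈ S then Q else 1 - Q := by
      intro i
      split_ifs
      · exact hz
      · exact hz'
    simp_rw [this]
    rw [Finset.prod_ite]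
    simp only [Finset.prod_const]
    have e1 : (Finset.univ.filter fun i => i ∈ S) = S := by ext; simp
    have e2 : (Finset.univ.filter fun i => i ∉ S) = Sᶜ := by ext; simp
    rw [e1, e2, Finset.card_compl, hS.2, Fintype.card_fin]
  have hsum := Finset.sum_congr rfl hone
  rw [Finset.sum_const, Finset.card_powersetCard, Finset.card_univ, Fintype.card_fin,
    nsmul_eq_mul, ← gE_sum] at hsum
  rw [← hsum]
  refine gE_mono h0 h1 fun B => ?_
  have hprod : ∀ S : Finset (Fin n), ∏ i, (if i ∈ S then z else z') (B i) =
      if S = zeroRows B then 1 else 0 := by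
    intro S
    have : ∀ i, (if i ∈ S then z else z') (B i) = if (i ∈ S ↔ i ∈ zeroRows B) then 1 else 0 := by
      intro i
      by_cases hi : i ∈ S <;> by_cases hB : ∀ j, B i j = false <;>
        simp [hi, zeroRows, z, z', hB]
    simp_rw [this]
    rw [Finset.prod_ite_zero]
    simp [Finset.ext_iff]
  simp_rw [hprod]
  rw [Finset.sum_ite_eq']
  by_cases hB : β ≤ (zeroRows B).card
  · rw [Set.indicator_of_mem (by exact hB)]
    split_ifs <;> simp
  · rw [if_neg]
    · exact Set.indicator_nonneg (fun _ _ => zero_le_one) _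
    · intro h
      rw [Finset.mem_powersetCard] at h
      exact hB h.2.ge

end ZeroRows

section Transfer

variable {n : ℕ} {p : ℝ} {Ω : Type*} [MeasurableSpace Ω] {μ : Measure Ω} [IsProbabilityMeasure μ]
  {A : Ω → Matrix (Fin n) (Fin n) ℝ}

/-- Probabilities of events about a Bernoulli matrix are finite sums over patterns. -/
lemma IsBernoulliMatrix.measureReal_eq (hA : IsBernoulliMatrix μ p A) (h0 : 0 ≤ p) (h1 : p ≤ 1)
    (P : Matrix (Fin n) (Fin n) ℝ → Prop) :
    μ.real {ω | P (A ω)} = gP p {B | P (toM B)} := by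
  classical
  have hatom_meas : ∀ B : Grid n, MeasurableSet {ω | A ω = toM B} := by
    intro B
    have : {ω | A ω = toM B} = ⋂ i, ⋂ j, (fun ω => A ω i j) ⁻¹' {toM B i j} := by
      ext ω
      simp only [Set.mem_ofPred_eq, Set.mem_iInter, Set.mem_preimage, Set.mem_singleton_iff]
      exact ⟨fun h i j => by rw [h], fun h => by ext i j; exact h i j⟩
    rw [this]
    exact MeasurableSet.iInter fun i => MeasurableSet.iInter fun j =>
      hA.measurable_entry i j (measurableSet_singleton _)
  have hatom : ∀ B : Grid n, μ.real {ω | A ω = toM B} = gw p B := by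
    intro B
    have h := hA.indep.measure_inter_preimage_eq_mul Finset.univ
      (sets := fun ij => {toM B ij.1 ij.2}) (fun ij _ => measurableSet_singleton _)
    have h2 : {ω | A ω = toM B} =
        ⋂ ij ∈ (Finset.univ : Finset (Fin n × Fin n)),
          (fun ω => A ω ij.1 ij.2) ⁻¹' {toM B ij.1 ij.2} := by
      ext ω
      simp only [Set.mem_ofPred_eq, Set.mem_iInter, Set.mem_preimage, Set.mem_singleton_iff,
        Finset.mem_univ, true_imp_iff]
      exact ⟨fun h i => by rw [h], fun h => by ext i j; exact h (i, j)⟩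
    rw [measureReal_def, h2, h, ENNReal.toReal_prod, gw,
      ← Finset.prod_product' Finset.univ Finset.univ (fun i j => bw p (B i j)),
      Finset.univ_product_univ]
    refine Finset.prod_congr rfl fun ij _ => ?_
    cases hB : B ij.1 ij.2
    · have : (fun ω => A ω ij.1 ij.2) ⁻¹' {toM B ij.1 ij.2} = {ω | A ω ij.1 ij.2 = 0} := by
        ext ω; simp [toM, hB]
      rw [this, hA.prob_zero, ENNReal.toReal_ofReal (by linarith)]
      simp
    · have : (fun ω => A ω ij.1 ij.2) ⁻¹' {toM B ij.1 ij.2} = {ω | A ω ij.1 ij.2 = 1} := by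
        ext ω; simp [toM, hB]
      rw [this, hA.prob_one, ENNReal.toReal_ofReal h0]
      simp
  have hae : ∀ᵐ ω ∂μ, ∃ B : Grid n, A ω = toM B := by
    have hij : ∀ i j, ∀ᵐ ω ∂μ, A ω i j = 0 ∨ A ω i j = 1 := by
      intro i j
      have hm0 : MeasurableSet {ω | A ω i j = 0} :=
        hA.measurable_entry i j (measurableSet_singleton 0)
      have hm1 : MeasurableSet {ω | A ω i j = 1} :=
        hA.measurable_entry i j (measurableSet_singleton 1)
      have hu : μ ({ω | A ω i j = 0} ∪ {ω | A ω i j = 1}) = 1 := by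
        rw [measure_union _ hm1, hA.prob_zero, hA.prob_one,
          ← ENNReal.ofReal_add (by linarith) h0]
        · simp
        · rw [Set.disjoint_left]
          intro ω h h'
          simp only [Set.mem_ofPred_eq] at h h'
          rw [h] at h'
          norm_num at h'
      have := (prob_compl_eq_zero_iff (hm0.union hm1)).2 hu
      rw [ae_iff]
      convert this using 2
      ext ω
      simp
    have hij' : ∀ᵐ ω ∂μ, ∀ i j, A ω i j = 0 ∨ A ω i j = 1 :=
      ae_all_iff.2 fun i => ae_all_iff.2 fun j => hij i j
    filter_upwards [hij'] with ω h
    refine ⟨fun i j => decide (A ω i j = 1), ?_⟩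
    ext i j
    rcases h i j with h | h <;> simp [toM, h]
  have hinj : Function.Injective (toM : Grid n → _) := by
    intro B B' h
    funext i j
    have := congrFun (congrFun h i) j
    cases hB : B i j <;> cases hB' : B' i j <;> simp [toM, hB, hB'] at this ⊢
  have hset : {ω | P (A ω)} =ᵐ[μ]
      ⋃ B ∈ Finset.univ.filter (fun B : Grid n => P (toM B)), {ω | A ω = toM B} := by
    refine Filter.eventuallyEq_set.2 ?_
    filter_upwards [hae] with ω hω
    obtain ⟨B, hB⟩ := hω
    simp only [Set.mem_iUnion, Finset.mem_filter, Finset.mem_univ, true_and, Set.mem_ofPred_eq,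
      exists_prop]
    constructor
    · intro h
      exact ⟨B, by rwa [← hB], hB⟩
    · rintro ⟨B', h, h'⟩
      rwa [h']
  rw [measureReal_congr hset, measureReal_biUnion_finset]
  · rw [Finset.sum_congr rfl fun B _ => hatom B]
    unfold gP gE
    rw [Finset.sum_filter]
    refine Finset.sum_congr rfl fun B _ => ?_
    simp [Set.indicator_apply]
  · intro B _ B' _ hne
    rw [Function.onFun, Set.disjoint_left]
    intro ω h h'
    simp only [Set.mem_ofPred_eq] at h h'
    exact hne (hinj (h.symm.trans h'))
  · exact fun B _ => hatom_meas B

end Transfer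

/-! ### The non-increasing rearrangement -/

/-- The `m` coordinates of `x` which come first in the sorting used by `rearr`. -/
def topCoords {n : ℕ} (x : EuclideanSpace ℝ (Fin n)) (m : ℕ) : Finset (Fin n) :=
  (Finset.univ.filter fun k : Fin n => (k : ℕ) < m).map
    (Tuple.sort (fun i => -|x i|)).toEmbedding

section Rearr

variable {n : ℕ} (x : EuclideanSpace ℝ (Fin n))

lemma card_topCoords {m : ℕ} (hm : m ≤ n) : (topCoords x m).card = m := by
  rw [topCoords, Finset.card_map, Fin.card_filter_val_lt]
  exact min_eq_right hm

lemma topCoords_mono {m m' : ℕ} (h : m ≤ m') : topCoords x m ⊆ topCoords x m' := by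
  refine Finset.map_subset_map.2 fun k hk => ?_
  simp only [Finset.mem_filter, Finset.mem_univ, true_and] at hk ⊢
  omega

lemma rearr_nonneg (k : ℕ) : 0 ≤ rearr x k := by
  unfold rearr
  split_ifs
  · exact abs_nonneg _
  · exact le_rfl

lemma abs_sort_antitone {k l : Fin n} (h : k ≤ l) :
    |x (Tuple.sort (fun i => -|x i|) l)| ≤ |x (Tuple.sort (fun i => -|x i|) k)| := by
  have := Tuple.monotone_sort (fun i => -|x i|) h
  simp only [Function.comp] at this
  linarith

lemma rearr_le_abs {m : ℕ} {k : Fin n} (hk : k ∈ topCoords x m) : rearr x m ≤ |x k| := by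
  unfold topCoords at hk
  simp only [Finset.mem_map, Finset.mem_filter, Finset.mem_univ, true_and] at hk
  obtain ⟨l, hl, rfl⟩ := hk
  unfold rearr
  split_ifs with h
  · exact abs_sort_antitone x (Fin.le_def.2 (by simp; omega))
  · exact abs_nonneg _

lemma abs_le_rearr {m : ℕ} (h1 : 1 ≤ m) (hm : m ≤ n) {k : Fin n} (hk : k ∉ topCoords x m) :
    |x k| ≤ rearr x m := by
  obtain ⟨l, rfl⟩ := (Tuple.sort (fun i => -|x i|)).surjective k
  have hl : ¬ (l : ℕ) < m := by
    intro h
    exact hk (Finset.mem_map.2 ⟨l, by simpa using h, rfl⟩)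
  unfold rearr
  rw [dif_pos ⟨h1, hm⟩]
  exact abs_sort_antitone x (Fin.le_def.2 (by simp; omega))

lemma abs_le_rearr_succ {m : ℕ} (hm : m + 1 ≤ n) {k : Fin n} (hk : k ∉ topCoords x m) :
    |x k| ≤ rearr x (m + 1) := by
  obtain ⟨l, rfl⟩ := (Tuple.sort (fun i => -|x i|)).surjective k
  have hl : ¬ (l : ℕ) < m := by
    intro h
    exact hk (Finset.mem_map.2 ⟨l, by simpa using h, rfl⟩)
  unfold rearr
  rw [dif_pos ⟨by omega, hm⟩]
  exact abs_sort_antitone x (Fin.le_def.2 (by simp; omega))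

lemma abs_le_rearr_one (k : Fin n) : |x k| ≤ rearr x 1 := by
  obtain ⟨l, rfl⟩ := (Tuple.sort (fun i => -|x i|)).surjective k
  have hn : 1 ≤ n := by have := l.2; omega
  unfold rearr
  rw [dif_pos ⟨le_rfl, hn⟩]
  exact abs_sort_antitone x (Fin.le_def.2 (by simp))

lemma rearr_single_one (k : Fin n) : rearr (EuclideanSpace.single k (1 : ℝ)) 1 = 1 := by
  have hn : 1 ≤ n := by have := k.2; omega
  apply le_antisymm
  · unfold rearr
    rw [dif_pos ⟨le_rfl, hn⟩]
    simp only [PiLp.single_apply]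
    split_ifs <;> simp
  · simpa using abs_le_rearr_one (EuclideanSpace.single k (1 : ℝ)) k

lemma rearr_single_of_two_le (k : Fin n) {m : ℕ} (hm : 2 ≤ m) :
    rearr (EuclideanSpace.single k (1 : ℝ)) m = 0 := by
  by_cases hmn : m ≤ n
  · obtain ⟨l, hl, hlk⟩ := Finset.exists_mem_ne
      (by rw [card_topCoords (EuclideanSpace.single k (1 : ℝ)) hmn]; omega :
        1 < (topCoords (EuclideanSpace.single k (1 : ℝ)) m).card) k
    have := rearr_le_abs _ hl
    rw [PiLp.single_apply, if_neg hlk, abs_zero] at this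
    exact le_antisymm this (rearr_nonneg _ _)
  · unfold rearr
    rw [dif_neg (by omega)]

/-- If the rearrangement of `x` drops by at most a factor `D` between consecutive levels before the
`j`-th one, and the levels grow at most like `D ^ i`, then the Euclidean norm of `x` is controlled
by its rearrangement at the level `j - 1`. -/
lemma norm_sq_le_of_levels {ℓ : ℕ → ℕ} {D : ℝ} (hD : 1 ≤ D) {j : ℕ} (hj : 1 ≤ j)
    (hℓ0 : ℓ 0 = 1) (hℓ1 : ∀ i ≤ j, 1 ≤ ℓ i ∧ ℓ i ≤ n)
    (hℓD : ∀ i, 1 ≤ i → i ≤ j → (ℓ i : ℝ) ≤ 3 * D ^ (i - 1))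
    (hx : ∀ i, 1 ≤ i → i < j → rearr x (ℓ (i - 1)) ≤ D * rearr x (ℓ i))
    (hxj : rearr x (ℓ j) ≤ rearr x (ℓ (j - 1))) :
    ‖x‖ ^ 2 ≤ (3 * j * D ^ (2 * (j - 1)) + n) * rearr x (ℓ (j - 1)) ^ 2 := by
  classical
  set a := rearr x (ℓ (j - 1)) with ha
  have ha0 : 0 ≤ a := rearr_nonneg _ _
  have hD0 : 0 ≤ D := by linarith
  have hgrow : ∀ d i, i + d + 1 = j → rearr x (ℓ i) ≤ D ^ d * a := by
    intro d
    induction d with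
    | zero =>
      intro i hi
      rw [ha, show j - 1 = i by omega]
      simp
    | succ d ih =>
      intro i hi
      have h1 := ih (i + 1) (by omega)
      have h2 := hx (i + 1) (by omega) (by omega)
      rw [Nat.add_sub_cancel] at h2
      calc _ ≤ D * rearr x (ℓ (i + 1)) := h2
        _ ≤ D * (D ^ d * a) := by gcongr
        _ = _ := by ring
  -- assign `k` to the first level whose top coordinates contain it
  have hpt : ∀ k, x k ^ 2 ≤
      (∑ i ∈ Finset.Icc 1 j, if k ∈ topCoords x (ℓ i) then (D ^ (j - i) * a) ^ 2 else 0) + a ^ 2 := by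
    intro k
    have hnn : ∀ i ∈ Finset.Icc 1 j,
        0 ≤ if k ∈ topCoords x (ℓ i) then (D ^ (j - i) * a) ^ 2 else 0 := by
      intro i _
      split_ifs <;> positivity
    by_cases hk : ∃ i, 1 ≤ i ∧ i ≤ j ∧ k ∈ topCoords x (ℓ i)
    · have hs := Nat.find_spec hk
      have hm := fun i => Nat.find_min hk (m := i)
      set i := Nat.find hk
      have h1 := Finset.single_le_sum hnn (Finset.mem_Icc.2 ⟨hs.1, hs.2.1⟩)
      rw [if_pos hs.2.2] at h1
      have h2 : |x k| ≤ rearr x (ℓ (i - 1)) := by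
        rcases Nat.lt_or_ge 1 i with hi | hi
        · refine abs_le_rearr x (hℓ1 _ (by omega)).1 (hℓ1 _ (by omega)).2 fun hmem => ?_
          exact hm (i - 1) (by omega) ⟨by omega, by omega, hmem⟩
        · rw [show i - 1 = 0 by omega, hℓ0]
          exact abs_le_rearr_one x k
      have h3 := hgrow (j - i) (i - 1) (by omega)
      have h4 : x k ^ 2 ≤ (D ^ (j - i) * a) ^ 2 := by
        rw [← sq_abs (x k)]
        exact pow_le_pow_left₀ (abs_nonneg _) (h2.trans h3) 2
      nlinarith [sq_nonneg a]
    · have h2 : |x k| ≤ a := by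
        refine (abs_le_rearr x (hℓ1 j le_rfl).1 (hℓ1 j le_rfl).2 fun hmem => ?_).trans hxj
        exact hk ⟨j, hj, le_rfl, hmem⟩
      have h4 : x k ^ 2 ≤ a ^ 2 := by
        rw [← sq_abs (x k)]
        exact pow_le_pow_left₀ (abs_nonneg _) h2 2
      have := Finset.sum_nonneg hnn
      linarith
  rw [EuclideanSpace.real_norm_sq_eq]
  refine (Finset.sum_le_sum fun k _ => hpt k).trans ?_
  rw [Finset.sum_add_distrib, Finset.sum_comm, add_mul]
  refine add_le_add ?_ (by simp)
  have hterm : ∀ i ∈ Finset.Icc 1 j,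
      (∑ k, if k ∈ topCoords x (ℓ i) then (D ^ (j - i) * a) ^ 2 else 0) ≤
        3 * D ^ (2 * (j - 1)) * a ^ 2 := by
    intro i hi
    rw [Finset.mem_Icc] at hi
    rw [← Finset.sum_filter]
    simp only [Finset.filter_mem_eq_inter, Finset.univ_inter, Finset.sum_const, nsmul_eq_mul]
    rw [card_topCoords x (hℓ1 i hi.2).2, mul_pow, ← pow_mul]
    have h1 := hℓD i hi.1 hi.2
    have h2 : D ^ (i - 1) * D ^ ((j - i) * 2) ≤ D ^ (2 * (j - 1)) := by
      rw [← pow_add]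
      exact pow_le_pow_right₀ hD (by omega)
    calc _ ≤ 3 * D ^ (i - 1) * (D ^ ((j - i) * 2) * a ^ 2) := by gcongr
      _ = 3 * (D ^ (i - 1) * D ^ ((j - i) * 2)) * a ^ 2 := by ring
      _ ≤ _ := by gcongr
  refine (Finset.sum_le_card_nsmul _ _ _ hterm).trans (le_of_eq ?_)
  rw [Nat.card_Icc, nsmul_eq_mul]
  simp
  ring

end Rearr

/-! ### Rows on which a vector is large -/

/-- The rows in which the column `k` of `B` has a one. -/
def colSupp {n : ℕ} (B : Grid n) (k : Fin n) : Finset (Fin n) :=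
  Finset.univ.filter fun i => B i k = true

/-- The column `k` is light if it has at most `T` ones. -/
def IsLight {n : ℕ} (B : Grid n) (T : ℝ) (k : Fin n) : Prop := ((colSupp B k).card : ℝ) ≤ T

/-- The light columns are spread out: no two of them meet, and every column meets the light columns
other than itself in at most one row. -/
structure LightSparse {n : ℕ} (B : Grid n) (T : ℝ) : Prop where
  disj : ∀ i k l, k ≠ l → IsLight B T k → IsLight B T l → B i k = true → B i l = false
  meet : ∀ i₁ i₂ k l₁ l₂, l₁ ≠ k → l₂ ≠ k → IsLight B T l₁ → IsLight B T l₂ →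
    B i₁ k = true → B i₁ l₁ = true → B i₂ k = true → B i₂ l₂ = true → i₁ = i₂

section Rows

variable {n : ℕ} {B : Grid n}

lemma sum_card_colSupp (B : Grid n) (J : Finset (Fin n)) :
    ∑ k ∈ J, (colSupp B k).card = ∑ i, cnt (B i) J := by
  simp only [colSupp, cnt, Finset.card_filter]
  rw [Finset.sum_comm]

/-- If the columns `J₁` have many ones and few of them lie in rows shared with `J₂`, then some row
in `I` has exactly one one in `J₂`, and this one is in `J₁`. -/
lemma exists_unique_row {I J₁ J₂ : Finset (Fin n)} {β : ℕ} (hI : Iᶜ.card ≤ β) (hJ : J₁ ⊆ J₂)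
    {R : ℝ} (hov : (overlap B J₁ J₂ : ℝ) < R)
    (hhits : R + β * J₁.card ≤ ∑ k ∈ J₁, ((colSupp B k).card : ℝ)) :
    ∃ i ∈ I, ∃ k ∈ J₁, B i k = true ∧ ∀ l ∈ J₂, l ≠ k → B i l = false := by
  classical
  by_contra! hcon
  have h2 : ∀ i ∈ I, cnt (B i) J₁ ≤ if 2 ≤ cnt (B i) J₂ then cnt (B i) J₁ else 0 := by
    intro i hi
    split_ifs with h
    · exact le_rfl
    · by_contra hpos
      obtain ⟨k, hk⟩ := Finset.card_pos.1 (not_le.1 hpos)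
      rw [Finset.mem_filter] at hk
      obtain ⟨l, hl, hlk, hBl⟩ := hcon i hi k hk.1 hk.2
      apply h
      have : ({k, l} : Finset (Fin n)) ⊆ J₂.filter fun j => B i j = true := by
        intro j hj
        simp only [Finset.mem_insert, Finset.mem_singleton] at hj
        rcases hj with rfl | rfl
        · exact Finset.mem_filter.2 ⟨hJ hk.1, hk.2⟩
        · exact Finset.mem_filter.2 ⟨hl, by simpa using hBl⟩
      have := Finset.card_le_card this
      rwa [Finset.card_pair hlk.symm] at this
  have h3 : ∑ k ∈ J₁, (colSupp B k).card ≤ overlap B J₁ J₂ + β * J₁.card := by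
    rw [sum_card_colSupp, ← Finset.sum_add_sum_compl I]
    apply add_le_add
    · refine (Finset.sum_le_sum h2).trans ?_
      exact Finset.sum_le_univ_sum_of_nonneg fun _ => Nat.zero_le _
    · refine (Finset.sum_le_card_nsmul _ _ J₁.card fun i _ => Finset.card_filter_le _ _).trans ?_
      rw [smul_eq_mul]
      exact Nat.mul_le_mul_right _ hI
  have h4 : (∑ k ∈ J₁, ((colSupp B k).card : ℝ)) ≤ overlap B J₁ J₂ + β * J₁.card := by
    exact_mod_cast h3
  linarith

variable {x : Fin n → ℝ} {b D : ℝ}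

lemma toM_nonneg (B : Grid n) (i j : Fin n) : 0 ≤ toM B i j := by
  unfold toM; split_ifs <;> simp

lemma sum_toM (B : Grid n) (i : Fin n) (J : Finset (Fin n)) :
    ∑ l ∈ J, toM B i l = cnt (B i) J := by
  simp [toM, cnt]

/-- The coordinates outside `J` contribute little to the `i`-th entry of the product. -/
lemma abs_sum_le_of_small {J : Finset (Fin n)} (hb : ∀ l ∉ J, |x l| ≤ b) (hb0 : 0 ≤ b) {i : Fin n}
    (hrow : (cnt (B i) Finset.univ : ℝ) ≤ D) :
    |∑ l ∈ J, toM B i l * x l| ≤ |∑ l, toM B i l * x l| + D * b := by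
  classical
  have h1 := Finset.sum_add_sum_compl J fun l => toM B i l * x l
  have h2 : |∑ l ∈ Jᶜ, toM B i l * x l| ≤ D * b := by
    refine (Finset.abs_sum_le_sum_abs _ _).trans ?_
    calc ∑ l ∈ Jᶜ, |toM B i l * x l| ≤ ∑ l ∈ Jᶜ, toM B i l * b := by
          refine Finset.sum_le_sum fun l hl => ?_
          rw [abs_mul, abs_of_nonneg (toM_nonneg B i l)]
          exact mul_le_mul_of_nonneg_left (hb l (Finset.mem_compl.1 hl)) (toM_nonneg B i l)
      _ ≤ ∑ l, toM B i l * b := Finset.sum_le_univ_sum_of_nonneg fun l =>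
          mul_nonneg (toM_nonneg B i l) hb0
      _ = (∑ l, toM B i l) * b := by rw [Finset.sum_mul]
      _ ≤ D * b := by rw [sum_toM]; gcongr
  have h3 : ∑ l ∈ J, toM B i l * x l = ∑ l, toM B i l * x l - ∑ l ∈ Jᶜ, toM B i l * x l := by
    linarith
  rw [h3]
  exact (abs_sub _ _).trans (by linarith)

lemma le_abs_of_unique_row {J : Finset (Fin n)} (hb : ∀ l ∉ J, |x l| ≤ b) (hb0 : 0 ≤ b)
    {i k : Fin n} (hrow : (cnt (B i) Finset.univ : ℝ) ≤ D) (hk : k ∈ J) (hik : B i k = true)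
    (huniq : ∀ l ∈ J, l ≠ k → B i l = false) :
    |x k| - D * b ≤ |∑ l, toM B i l * x l| := by
  have h1 := abs_sum_le_of_small hb hb0 hrow
  have h2 : ∑ l ∈ J, toM B i l * x l = x k := by
    rw [Finset.sum_eq_single_of_mem k hk]
    · simp [toM, hik]
    · intro l hl hlk
      simp [toM, huniq l hl hlk]
  rw [h2] at h1
  linarith

/-- Among few columns, some of which may be light: either the large coordinates in light columns
are visible in the rows of these columns, or they are cancelled there by heavy columns with
comparable coordinates. Since a heavy column meets at most one of these rows, there are many such
heavy columns, and one of them owns a row. -/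
lemma exists_row_of_lightSparse {T : ℝ} (hB : LightSparse B T) {I J J₁ J₂ : Finset (Fin n)}
    (hnz : ∀ k ∈ J, IsLight B T k → ∃ i ∈ I, B i k = true)
    (hJJ : J₁ ⊆ J₂) (hcard : J₂.card ≤ 3 * J₁.card) {a : ℝ} (ha : 0 < a)
    (hx₁ : ∀ k ∈ J₁, a ≤ |x k|) (hb : ∀ k ∉ J₂, |x k| ≤ b) (hb0 : 0 ≤ b)
    (hxJ : ∀ k ∉ J, x k = 0) (hrow : ∀ i, (cnt (B i) Finset.univ : ℝ) ≤ D) (hDb : D * b ≤ a / 32)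
    (hheavy : ∀ H ⊆ J₂, (∀ k ∈ H, ¬ IsLight B T k) → J₁.card ≤ 4 * H.card →
      ∃ i ∈ I, ∃ k ∈ H, B i k = true ∧ ∀ l ∈ J₂, l ≠ k → B i l = false) :
    ∃ i ∈ I, a / 32 ≤ |∑ l, toM B i l * x l| := by
  classical
  by_contra! hcon
  set L := J₁.filter fun k => IsLight B T k with hL
  set H := J₂.filter fun k => ¬ IsLight B T k with hH
  set H' := H.filter fun k => a / 16 ≤ |x k| with hH'
  have hH'card : 4 * H'.card < J₁.card := by
    by_contra! hle
    obtain ⟨i, hi, k, hk, hik, huniq⟩ := hheavy H'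
      ((Finset.filter_subset _ _).trans (Finset.filter_subset _ _))
      (fun k hk => (Finset.mem_filter.1 (Finset.mem_filter.1 hk).1).2) hle
    have hk2 := Finset.mem_filter.1 hk
    have h1 := le_abs_of_unique_row hb hb0 (hrow i) (Finset.mem_filter.1 hk2.1).1 hik huniq
    have h2 := hcon i hi
    have h3 := hk2.2
    linarith
  have hr : ∀ k ∈ L, ∃ i ∈ I, B i k = true := by
    intro k hk
    rw [hL, Finset.mem_filter] at hk
    refine hnz k ?_ hk.2
    by_contra hkJ
    have := hx₁ k hk.1
    rw [hxJ k hkJ, abs_zero] at this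
    linarith
  choose! r hrI hrB using hr
  -- truncated absolute values, so that each heavy column counts for at most `a`
  set w : Fin n → ℝ := fun l => min |x l| a with hw
  have hw0 : ∀ l, 0 ≤ w l := fun l => le_min (abs_nonneg _) ha.le
  have hrowsum : ∀ k ∈ L, 15 / 16 * a ≤ ∑ l ∈ H, toM B (r k) l * w l := by
    intro k hk
    have hk2 := hk
    rw [hL, Finset.mem_filter] at hk2
    have h1 := abs_sum_le_of_small hb hb0 (hrow (r k))
    have h2 := hcon (r k) (hrI k hk)
    have hkJ₂ := hJJ hk2.1
    have hterm : ∀ l ∈ H, 0 ≤ toM B (r k) l * w l := fun l _ =>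
      mul_nonneg (toM_nonneg _ _ _) (hw0 l)
    by_cases hbig : ∃ l ∈ H, B (r k) l = true ∧ a ≤ |x l|
    · obtain ⟨l, hl, hBl, hal⟩ := hbig
      have h3 := Finset.single_le_sum hterm hl
      have h4 : toM B (r k) l * w l = a := by simp [toM, hBl, hw, hal]
      rw [h4] at h3
      linarith
    · push Not at hbig
      have h3 : ∑ l ∈ J₂, toM B (r k) l * x l = x k + ∑ l ∈ H, toM B (r k) l * x l := by
        rw [← Finset.add_sum_erase _ _ hkJ₂]
        congr 1
        · simp [toM, hrB k hk]
        · symm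
          apply Finset.sum_subset
          · intro l hl
            rw [hH, Finset.mem_filter] at hl
            rw [Finset.mem_erase]
            refine ⟨?_, hl.1⟩
            rintro rfl
            exact hl.2 hk2.2
          · intro l hl hlH
            rw [Finset.mem_erase] at hl
            have hlight : IsLight B T l := by
              by_contra hnl
              exact hlH (Finset.mem_filter.2 ⟨hl.2, hnl⟩)
            have := hB.disj (r k) k l hl.1.symm hk2.2 hlight (hrB k hk)
            simp [toM, this]
      have h4 : |∑ l ∈ H, toM B (r k) l * x l| ≤ ∑ l ∈ H, toM B (r k) l * w l := by
        refine (Finset.abs_sum_le_sum_abs _ _).trans (Finset.sum_le_sum fun l hl => ?_)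
        rw [abs_mul, abs_of_nonneg (toM_nonneg _ _ _)]
        cases hBl : B (r k) l
        · simp [toM, hBl]
        · have := hbig l hl hBl
          rw [hw]
          simp only
          rw [min_eq_left this.le]
      have h5 : |x k| ≤ |∑ l ∈ J₂, toM B (r k) l * x l| + |∑ l ∈ H, toM B (r k) l * x l| := by
        rw [h3]
        have := abs_sub (x k + ∑ l ∈ H, toM B (r k) l * x l) (∑ l ∈ H, toM B (r k) l * x l)
        rwa [add_sub_cancel_right] at this
      have h6 := hx₁ k hk2.1
      linarith
  have hsum1 : L.card * (15 / 16 * a) ≤ ∑ k ∈ L, ∑ l ∈ H, toM B (r k) l * w l := by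
    rw [← nsmul_eq_mul]
    exact Finset.card_nsmul_le_sum _ _ _ hrowsum
  -- each heavy column meets at most one of the rows `r k`
  have hsum2 : ∑ k ∈ L, ∑ l ∈ H, toM B (r k) l * w l ≤ ∑ l ∈ H, w l := by
    rw [Finset.sum_comm]
    refine Finset.sum_le_sum fun l hl => ?_
    rw [← Finset.sum_mul]
    have hl2 := (Finset.mem_filter.1 hl).2
    have hle : (∑ k ∈ L, toM B (r k) l : ℝ) ≤ 1 := by
      have : ∑ k ∈ L, toM B (r k) l = ((L.filter fun k => B (r k) l = true).card : ℝ) := by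
        simp [toM]
      rw [this]
      have h1 : (L.filter fun k => B (r k) l = true).card ≤ 1 := by
        refine Finset.card_le_one.2 fun k₁ h₁ k₂ h₂ => ?_
        rw [Finset.mem_filter] at h₁ h₂
        have hk₁ := (Finset.mem_filter.1 h₁.1).2
        have hk₂ := (Finset.mem_filter.1 h₂.1).2
        have hr12 := hB.meet (r k₁) (r k₂) l k₁ k₂ (by rintro rfl; exact hl2 hk₁)
          (by rintro rfl; exact hl2 hk₂) hk₁ hk₂ h₁.2 (hrB _ h₁.1) h₂.2 (hrB _ h₂.1)
        by_contra hne
        have := hB.disj (r k₁) k₁ k₂ hne hk₁ hk₂ (hrB _ h₁.1)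
        rw [hr12, hrB _ h₂.1] at this
        simp at this
      exact_mod_cast h1
    nlinarith [hw0 l]
  have hsum3 : ∑ l ∈ H, w l ≤ a * H'.card + a / 16 * J₂.card := by
    have : ∀ l ∈ H, w l ≤ (if a / 16 ≤ |x l| then a else 0) + a / 16 := by
      intro l _
      split_ifs with h
      · have := min_le_right |x l| a
        simp only [hw]
        linarith
      · have := min_le_left |x l| a
        simp only [hw]
        linarith
    refine (Finset.sum_le_sum this).trans ?_
    rw [Finset.sum_add_distrib, ← Finset.sum_filter, ← hH']
    simp only [Finset.sum_const, nsmul_eq_mul]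
    have h1 : (H.card : ℝ) ≤ J₂.card := by exact_mod_cast Finset.card_filter_le _ _
    nlinarith
  have hsplit : J₁.card ≤ L.card + H'.card := by
    have : J₁ ⊆ L ∪ H' := by
      intro k hk
      rw [Finset.mem_union]
      by_cases hl : IsLight B T k
      · exact Or.inl (Finset.mem_filter.2 ⟨hk, hl⟩)
      · refine Or.inr (Finset.mem_filter.2 ⟨Finset.mem_filter.2 ⟨hJJ hk, hl⟩, ?_⟩)
        have := hx₁ k hk
        linarith
    exact (Finset.card_le_card this).trans (Finset.card_union_le _ _)
  have h1 : (J₁.card : ℝ) ≤ L.card + H'.card := by exact_mod_cast hsplit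
  have h2 : (J₂.card : ℝ) ≤ 3 * J₁.card := by exact_mod_cast hcard
  have h3 : 4 * (H'.card : ℝ) < J₁.card := by exact_mod_cast hH'card
  have h4 : (L.card : ℝ) * (15 / 16) ≤ H'.card + 1 / 16 * J₂.card := by
    have : a * (L.card * (15 / 16)) ≤ a * (H'.card + 1 / 16 * J₂.card) := by linarith
    exact le_of_mul_le_mul_left this ha
  linarith [(Nat.cast_nonneg H'.card : (0 : ℝ) ≤ H'.card)]

end Rows

/-! ### The levels -/

/-- The properties of the levels `ℓ 0, …, ℓ s` which are common to both regimes of `p`. -/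
structure IsLevelSeq (ℓ : ℕ → ℕ) (s M : ℕ) (D : ℝ) : Prop where
  zero : ℓ 0 = 1
  pos : 1 ≤ s
  two_le : 2 ≤ ℓ 1
  bounds : ∀ j ≤ s, 1 ≤ ℓ j ∧ ℓ j ≤ M
  mono : ∀ j, 1 ≤ j → j ≤ s → ℓ (j - 1) ≤ ℓ j
  grow : ∀ j, 1 ≤ j → j ≤ s → (ℓ j : ℝ) ≤ 3 * D ^ (j - 1)

lemma half_le_floor {x : ℝ} (hx : 1 ≤ x) : x ≤ 2 * (⌊x⌋₊ : ℝ) := by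
  have h1 := Nat.lt_floor_add_one x
  have h2 : 1 ≤ ⌊x⌋₊ := Nat.le_floor (by simpa using hx)
  have h3 : (1 : ℝ) ≤ ⌊x⌋₊ := by exact_mod_cast h2
  linarith

section TopLevel

variable {γ p : ℝ}

lemma two_le_topLevel (h0 : 0 < γ * p) (h1 : γ * p ≤ 1 / 2) : 2 ≤ topLevel γ p := by
  have : (2 : ℝ) ≤ 1 / (γ * p) := by rw [le_div_iff₀ h0]; linarith
  have h := this.trans (Nat.le_ceil (1 / (γ * p)))
  exact_mod_cast h

lemma topLevel_le (h0 : 0 < γ * p) (h1 : γ * p ≤ 1 / 2) : (topLevel γ p : ℝ) ≤ 2 / (γ * p) := by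
  have h2 : (2 : ℝ) ≤ 1 / (γ * p) := by rw [le_div_iff₀ h0]; linarith
  have := Nat.ceil_lt_add_one (by linarith : 0 ≤ 1 / (γ * p))
  have h3 : 2 / (γ * p) = 1 / (γ * p) + 1 / (γ * p) := by ring
  unfold topLevel
  linarith

end TopLevel

section Large

variable {γ p D : ℝ} {n : ℕ}

lemma topLevel_le_sLarge (hρ : 2 ≤ ratio n p) :
    (topLevel γ p : ℝ) ≤ 2 * ratio n p ^ (sLarge γ n p - 1) := by
  have hne : {t : ℕ | (topLevel γ p : ℝ) ≤ 2 * ratio n p ^ t}.Nonempty := by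
    obtain ⟨t, ht⟩ := pow_unbounded_of_one_lt (topLevel γ p : ℝ) (by linarith : 1 < ratio n p)
    refine ⟨t, ?_⟩
    change (topLevel γ p : ℝ) ≤ 2 * ratio n p ^ t
    have : 0 ≤ ratio n p ^ t := by positivity
    linarith
  exact Nat.sInf_mem hne

lemma lt_topLevel_of_lt_sLarge {j : ℕ} (hj : j + 1 < sLarge γ n p) :
    2 * ratio n p ^ j < topLevel γ p := by
  have h : j < sInf {t : ℕ | (topLevel γ p : ℝ) ≤ 2 * ratio n p ^ t} := by
    unfold sLarge at hj; omega
  have := Nat.notMem_of_lt_sInf h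
  exact not_le.1 this

lemma levelLarge_floor {j : ℕ} (hj : 1 ≤ j) (hjs : j < sLarge γ n p ∨ j = 1) :
    levelLarge γ n p j = ⌊2 * ratio n p ^ (j - 1)⌋₊ := by
  unfold levelLarge
  rw [if_neg (by omega)]
  split_ifs with h1 h2
  · subst h1; simp
  · rfl
  · omega

lemma levelLarge_last {j : ℕ} (hj : 2 ≤ j) (hjs : j = sLarge γ n p) :
    levelLarge γ n p j = topLevel γ p := by
  unfold levelLarge
  rw [if_neg (by omega), if_neg (by omega), if_neg (by omega)]

lemma levelLarge_le (hρ : 2 ≤ ratio n p) {j : ℕ} (hj : 1 ≤ j) (hjs : j ≤ sLarge γ n p) :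
    (levelLarge γ n p j : ℝ) ≤ 2 * ratio n p ^ (j - 1) := by
  by_cases h : j < sLarge γ n p ∨ j = 1
  · rw [levelLarge_floor hj h]
    exact Nat.floor_le (by positivity)
  · push Not at h
    have hs : j = sLarge γ n p := by omega
    rw [levelLarge_last (by omega) hs, hs]
    exact topLevel_le_sLarge hρ

lemma le_two_mul_levelLarge (hρ : 2 ≤ ratio n p) {j : ℕ} (hj : 1 ≤ j)
    (hjs : j < sLarge γ n p ∨ j = 1) :
    2 * ratio n p ^ (j - 1) ≤ 2 * (levelLarge γ n p j : ℝ) := by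
  rw [levelLarge_floor hj hjs]
  apply half_le_floor
  have := one_le_pow₀ (n := j - 1) (by linarith : 1 ≤ ratio n p)
  linarith

lemma levelLarge_step (hρ : 2 ≤ ratio n p) {j : ℕ} (hj : 2 ≤ j) (hjs : j ≤ sLarge γ n p) :
    2 ≤ levelLarge γ n p (j - 1) ∧
      (levelLarge γ n p j : ℝ) ≤ 2 * ratio n p * levelLarge γ n p (j - 1) := by
  have h1 := levelLarge_le hρ (by omega) hjs
  have h2 := le_two_mul_levelLarge hρ (by omega : 1 ≤ j - 1)
    (Or.inl (by omega) : j - 1 < sLarge γ n p ∨ _)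
  constructor
  · rw [levelLarge_floor (by omega) (Or.inl (by omega))]
    apply Nat.le_floor
    have := one_le_pow₀ (n := j - 1 - 1) (by linarith : 1 ≤ ratio n p)
    push_cast
    linarith
  · have h3 : ratio n p ^ (j - 1) = ratio n p * ratio n p ^ (j - 1 - 1) := by
      rw [← pow_succ']; congr 1; omega
    rw [h3] at h1
    nlinarith

lemma isLevelSeq_large (h0 : 0 < γ * p) (h1 : γ * p ≤ 1 / 2) (hρ : 2 ≤ ratio n p)
    (hρD : ratio n p ≤ D) :
    IsLevelSeq (levelLarge γ n p) (sLarge γ n p) (topLevel γ p) D where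
  zero := by simp [levelLarge]
  pos := by simp [sLarge]
  two_le := by simp [levelLarge]
  bounds j hj := by
    rcases Nat.eq_zero_or_pos j with rfl | hj0
    · have := two_le_topLevel h0 h1
      simp [levelLarge]
      omega
    by_cases h : j < sLarge γ n p ∨ j = 1
    · constructor
      · rw [levelLarge_floor hj0 h]
        apply Nat.le_floor
        have := one_le_pow₀ (n := j - 1) (by linarith : 1 ≤ ratio n p)
        push_cast
        linarith
      · rcases Nat.lt_or_ge j (sLarge γ n p) with h' | h'
        · have h2 := lt_topLevel_of_lt_sLarge (γ := γ) (n := n) (p := p) (j := j - 1) (by omega)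
          have h3 := levelLarge_le (γ := γ) hρ hj0 hj
          have : (levelLarge γ n p j : ℝ) ≤ topLevel γ p := by linarith
          exact_mod_cast this
        · have hj1 : j = 1 := by omega
          subst hj1
          have := two_le_topLevel h0 h1
          simpa [levelLarge] using this
    · push Not at h
      rw [levelLarge_last (by omega) (by omega)]
      have := two_le_topLevel h0 h1
      omega
  mono j hj hjs := by
    rcases Nat.lt_or_ge j 2 with h | h
    · have : j = 1 := by omega
      subst this
      simp [levelLarge]
    · rw [levelLarge_floor (by omega : 1 ≤ j - 1) (Or.inl (by omega))]
      rcases Nat.lt_or_ge j (sLarge γ n p) with h' | h'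
      · rw [levelLarge_floor (by omega) (Or.inl h')]
        apply Nat.floor_mono
        have := pow_le_pow_right₀ (by linarith : 1 ≤ ratio n p) (by omega : j - 1 - 1 ≤ j - 1)
        linarith
      · rw [levelLarge_last h (by omega)]
        have := lt_topLevel_of_lt_sLarge (γ := γ) (n := n) (p := p) (j := j - 1 - 1) (by omega)
        exact Nat.floor_le_of_le this.le
  grow j hj hjs := by
    have h2 := levelLarge_le hρ hj hjs
    have h3 := pow_le_pow_left₀ (by linarith) hρD (j - 1)
    have : 0 ≤ ratio n p ^ (j - 1) := by positivity
    linarith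

end Large

section Small

variable {γ p D : ℝ} {n : ℕ}

lemma expLevel_le_t₀ : expLevel n p ≤ 3 ^ t₀ n p := by
  have hne : {t : ℕ | expLevel n p ≤ 3 ^ t}.Nonempty := by
    obtain ⟨t, ht⟩ := pow_unbounded_of_one_lt (expLevel n p) (by norm_num : 1 < 3)
    exact ⟨t, ht.le⟩
  exact Nat.sInf_mem hne

lemma lt_expLevel_of_lt_t₀ {j : ℕ} (hj : j < t₀ n p) : 3 ^ j < expLevel n p :=
  not_le.1 (Nat.notMem_of_lt_sInf (s := {t : ℕ | expLevel n p ≤ 3 ^ t}) hj)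

lemma topLevel_le_t₁ (hρ : 2 ≤ ratio n p) (hN : 1 ≤ expLevel n p) :
    (topLevel γ p : ℝ) ≤ expLevel n p * ratio n p ^ t₁ γ n p := by
  have hne : {t : ℕ | (topLevel γ p : ℝ) ≤ expLevel n p * ratio n p ^ t}.Nonempty := by
    obtain ⟨t, ht⟩ := pow_unbounded_of_one_lt (topLevel γ p : ℝ) (by linarith : 1 < ratio n p)
    refine ⟨t, ?_⟩
    change (topLevel γ p : ℝ) ≤ expLevel n p * ratio n p ^ t
    have h1 : 0 ≤ ratio n p ^ t := by positivity
    have h2 : (1 : ℝ) ≤ expLevel n p := by exact_mod_cast hN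
    nlinarith
  exact Nat.sInf_mem hne

lemma lt_topLevel_of_lt_t₁ {j : ℕ} (hj : j < t₁ γ n p) :
    expLevel n p * ratio n p ^ j < topLevel γ p :=
  not_le.1 (Nat.notMem_of_lt_sInf hj)

lemma one_le_t₀ (hN : 2 ≤ expLevel n p) : 1 ≤ t₀ n p := by
  by_contra h
  have := expLevel_le_t₀ (n := n) (p := p)
  rw [show t₀ n p = 0 by omega] at this
  omega

lemma one_le_t₁ (hρ : 2 ≤ ratio n p) (hN : 2 ≤ expLevel n p)
    (hNM : expLevel n p < topLevel γ p) : 1 ≤ t₁ γ n p := by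
  by_contra h
  have := topLevel_le_t₁ (γ := γ) hρ (by omega)
  rw [show t₁ γ n p = 0 by omega, pow_zero, mul_one] at this
  have : topLevel γ p ≤ expLevel n p := by exact_mod_cast this
  omega

lemma levelSmall_pow {j : ℕ} (hj : j < t₀ n p) : levelSmall γ n p j = 3 ^ j := by
  unfold levelSmall
  split_ifs with h
  · simp [h]
  · rfl

lemma levelSmall_floor (hN : 2 ≤ expLevel n p) {j : ℕ} (hj : t₀ n p ≤ j)
    (hjs : j < sSmall γ n p) :
    levelSmall γ n p j = ⌊expLevel n p * ratio n p ^ (j - t₀ n p)⌋₊ := by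
  have := one_le_t₀ hN
  unfold levelSmall
  rw [if_neg (by omega), if_neg (by omega)]
  split_ifs with h
  · simp [h]
  · rfl

lemma levelSmall_last (hN : 2 ≤ expLevel n p) (h1 : 1 ≤ t₁ γ n p) :
    levelSmall γ n p (sSmall γ n p) = topLevel γ p := by
  have := one_le_t₀ hN
  have hs : sSmall γ n p = t₀ n p + t₁ γ n p := rfl
  unfold levelSmall
  rw [if_neg (by omega), if_neg (by omega), if_neg (by omega), if_neg (by omega)]

lemma levelSmall_le (hρ : 2 ≤ ratio n p) (hN : 2 ≤ expLevel n p) (h1 : 1 ≤ t₁ γ n p) {j : ℕ}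
    (hj : t₀ n p ≤ j) (hjs : j ≤ sSmall γ n p) :
    (levelSmall γ n p j : ℝ) ≤ expLevel n p * ratio n p ^ (j - t₀ n p) := by
  rcases Nat.lt_or_ge j (sSmall γ n p) with h | h
  · rw [levelSmall_floor hN hj h]
    exact Nat.floor_le (by positivity)
  · have hs : j = sSmall γ n p := by omega
    rw [hs, levelSmall_last hN h1, sSmall, Nat.add_sub_cancel_left]
    exact topLevel_le_t₁ hρ (by omega)

lemma le_expLevel_mul (hρ : 2 ≤ ratio n p) (j : ℕ) :
    (expLevel n p : ℝ) ≤ expLevel n p * ratio n p ^ j :=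
  le_mul_of_one_le_right (by positivity) (one_le_pow₀ (by linarith))

lemma levelSmall_step (hρ : 2 ≤ ratio n p) (hN : 2 ≤ expLevel n p)
    (hNM : expLevel n p < topLevel γ p) {j : ℕ} (hj : 1 ≤ j) (hjs : j ≤ sSmall γ n p) :
    levelSmall γ n p j ≤ 3 * levelSmall γ n p (j - 1) ∨
      (expLevel n p ≤ levelSmall γ n p (j - 1) ∧
        (levelSmall γ n p j : ℝ) ≤ 2 * ratio n p * levelSmall γ n p (j - 1)) := by
  have h1 := one_le_t₁ hρ hN hNM
  rcases Nat.lt_trichotomy j (t₀ n p) with h | h | h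
  · left
    rw [levelSmall_pow h, levelSmall_pow (by omega), ← pow_succ']
    exact le_of_eq (by congr 1; omega)
  · left
    rw [levelSmall_pow (by omega : j - 1 < t₀ n p), ← pow_succ', Nat.sub_add_cancel hj,
      levelSmall_floor hN h.ge (by unfold sSmall; omega)]
    rw [h]
    simpa using expLevel_le_t₀
  · right
    have h2 := levelSmall_le hρ hN h1 h.le hjs
    have h3 : levelSmall γ n p (j - 1) = ⌊expLevel n p * ratio n p ^ (j - 1 - t₀ n p)⌋₊ :=
      levelSmall_floor hN (by omega) (by omega)
    have h4 := le_expLevel_mul hρ (j - 1 - t₀ n p)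
    have h5 : (2 : ℝ) ≤ expLevel n p := by exact_mod_cast hN
    constructor
    · rw [h3]
      exact Nat.le_floor h4
    · have h6 := half_le_floor (by linarith : 1 ≤ expLevel n p * ratio n p ^ (j - 1 - t₀ n p))
      rw [← h3] at h6
      have h7 : ratio n p ^ (j - t₀ n p) = ratio n p * ratio n p ^ (j - 1 - t₀ n p) := by
        rw [← pow_succ']; congr 1; omega
      rw [h7] at h2
      nlinarith

lemma isLevelSeq_small (hρ : 2 ≤ ratio n p) (hN : 2 ≤ expLevel n p)
    (hNM : expLevel n p < topLevel γ p) (hρD : ratio n p ≤ D) (hD : 3 ≤ D) :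
    IsLevelSeq (levelSmall γ n p) (sSmall γ n p) (topLevel γ p) D := by
  have h1 := one_le_t₁ hρ hN hNM
  have h0 := one_le_t₀ hN
  have hs : sSmall γ n p = t₀ n p + t₁ γ n p := rfl
  have hlast := levelSmall_last hN h1
  have hlow : ∀ j, t₀ n p ≤ j → j < sSmall γ n p → expLevel n p ≤ levelSmall γ n p j := by
    intro j hj hjs
    rw [levelSmall_floor hN hj hjs]
    exact Nat.le_floor (le_expLevel_mul hρ _)
  have hup : ∀ j, t₀ n p ≤ j → j < sSmall γ n p → levelSmall γ n p j ≤ topLevel γ p := by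
    intro j hj hjs
    rw [levelSmall_floor hN hj hjs]
    exact Nat.floor_le_of_le (lt_topLevel_of_lt_t₁ (by omega)).le
  refine ⟨?_, by omega, ?_, ?_, ?_, ?_⟩
  · simp [levelSmall]
  · rcases Nat.lt_or_ge 1 (t₀ n p) with h | h
    · rw [levelSmall_pow h]; norm_num
    · exact hN.trans (hlow 1 h (by omega))
  · intro j hj
    rcases Nat.lt_or_ge j (t₀ n p) with h | h
    · rw [levelSmall_pow h]
      have := lt_expLevel_of_lt_t₀ h
      exact ⟨Nat.one_le_pow _ _ (by norm_num), by omega⟩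
    rcases Nat.lt_or_ge j (sSmall γ n p) with h' | h'
    · have := hlow j h h'
      exact ⟨by omega, hup j h h'⟩
    · rw [show j = sSmall γ n p by omega, hlast]
      omega
  · intro j hj hjs
    rcases Nat.lt_or_ge (j - 1) (t₀ n p) with h | h
    · rw [levelSmall_pow h]
      rcases Nat.lt_or_ge j (t₀ n p) with h' | h'
      · rw [levelSmall_pow h']
        exact Nat.pow_le_pow_right (by norm_num) (by omega)
      · exact (lt_expLevel_of_lt_t₀ h).le.trans (hlow j h' (by omega))
    · rcases Nat.lt_or_ge j (sSmall γ n p) with h' | h'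
      · rw [levelSmall_floor hN h (by omega), levelSmall_floor hN (by omega) h']
        apply Nat.floor_mono
        exact mul_le_mul_of_nonneg_left (pow_le_pow_right₀ (by linarith) (by omega))
          (by positivity)
      · rw [show j = sSmall γ n p by omega, hlast]
        exact hup _ (by omega) (by omega)
  · intro j hj hjs
    have hpow : ∀ k, (3 : ℝ) ^ k ≤ D ^ k := fun k => pow_le_pow_left₀ (by norm_num) hD k
    rcases Nat.lt_or_ge j (t₀ n p) with h | h
    · rw [levelSmall_pow h]
      have : ((3 ^ j : ℕ) : ℝ) = 3 * 3 ^ (j - 1) := by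
        rw [← pow_succ', Nat.sub_add_cancel hj]; push_cast; rfl
      rw [this]
      linarith [hpow (j - 1)]
    · have h2 := levelSmall_le hρ hN h1 h hjs
      have h3 : (expLevel n p : ℝ) ≤ 3 * 3 ^ (t₀ n p - 1) := by
        have := expLevel_le_t₀ (n := n) (p := p)
        rw [← pow_succ', Nat.sub_add_cancel h0]
        exact_mod_cast this
      have h4 := pow_le_pow_left₀ (by linarith) hρD (j - t₀ n p)
      have h5 : D ^ (j - 1) = D ^ (t₀ n p - 1) * D ^ (j - t₀ n p) := by
        rw [← pow_add]; congr 1; omega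
      calc (levelSmall γ n p j : ℝ) ≤ expLevel n p * ratio n p ^ (j - t₀ n p) := h2
        _ ≤ (3 * D ^ (t₀ n p - 1)) * D ^ (j - t₀ n p) := by
            apply mul_le_mul (h3.trans _) h4 (by positivity) (by positivity)
            linarith [hpow (t₀ n p - 1)]
        _ = _ := by rw [h5]; ring

end Small

/-! ### Steep vectors, given the structure of the matrix -/

/-- The density of shared ones which is tolerated for sets of `m` columns. -/
def overlapRate (n : ℕ) (p K : ℝ) (m : ℕ) : ℝ :=
  8 / log (p * n) ^ 3 + K / log (1 / (m * p))

/-- All rows of `B` have `O(pn)` ones. -/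
def RowsBounded {n : ℕ} (p C : ℝ) (B : Grid n) : Prop :=
  ∀ i, (cnt (B i) Finset.univ : ℝ) ≤ C * (p * n)

/-- No set `J₂` of columns, which is not too large compared with its subset `J₁`, shares many rows
with `J₁`. -/
def OverlapsBounded {n : ℕ} (p K : ℝ) (M : ℕ) (B : Grid n) : Prop :=
  ∀ J₁ J₂ : Finset (Fin n), J₁ ⊆ J₂ → 1 ≤ J₁.card → J₂.card ≤ M →
    (J₂.card : ℝ) ≤ 2 * ratio n p * J₁.card →
    (overlap B J₁ J₂ : ℝ) < p * n * J₁.card * overlapRate n p K J₂.card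

section Columns

variable {n : ℕ} {p γ τ K C : ℝ} {B : Grid n} {I J : Finset (Fin n)} {β : ℕ}

lemma mem_of_supported {x : EuclideanSpace ℝ (Fin n)} (hxJ : ∀ k, k ∉ J → x k = 0) {a : ℝ}
    (ha : 0 < a) {k : Fin n} (hk : a ≤ |x k|) : k ∈ J := by
  by_contra h
  rw [hxJ k h, abs_zero] at hk
  linarith

/-- A row on which a steep vector is large, for the levels of the denser regime. -/
lemma exists_row_large (hy : 0 < p * n) (hC : 0 < C) (hI : Iᶜ.card ≤ β)
    (hlev : IsLevelSeq (levelLarge γ n p) (sLarge γ n p) (topLevel γ p) (32 * C * (p * n)))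
    (hρ : 2 ≤ ratio n p) (hM : topLevel γ p ≤ n)
    (hrows : RowsBounded p C B) (hov : OverlapsBounded p K (topLevel γ p) B)
    (hnz : ∀ k ∈ J, ∃ i ∈ I, B i k = true)
    (hlight : ∀ k ∈ J, ∀ l ∈ J, IsLight B (τ * (p * n)) k → IsLight B (τ * (p * n)) l → k = l)
    (hrate : ∀ m : ℕ, 1 ≤ m → m ≤ topLevel γ p → overlapRate n p K m ≤ τ / 8)
    (hτ : 0 < τ) (hβ : (β : ℝ) ≤ τ * (p * n) / 8)
    {x : EuclideanSpace ℝ (Fin n)} (hxJ : ∀ k, k ∉ J → x k = 0)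
    {j : ℕ} (hj : 1 ≤ j) (hjs : j ≤ sLarge γ n p)
    (hx : 32 * C * (p * n) * rearr x (levelLarge γ n p j) < rearr x (levelLarge γ n p (j - 1))) :
    ∃ i ∈ I, rearr x (levelLarge γ n p (j - 1)) / 32 ≤ |∑ l, toM B i l * x l| := by
  classical
  set a := rearr x (levelLarge γ n p (j - 1)) with ha
  set b := rearr x (levelLarge γ n p j) with hb
  have hb0 : 0 ≤ b := rearr_nonneg _ _
  have ha0 : 0 < a := lt_of_le_of_lt (by positivity) hx
  have hDb : C * (p * n) * b ≤ a / 32 := by linarith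
  have hbd := hlev.bounds j hjs
  rcases Nat.lt_or_ge j 2 with hj2 | hj2
  -- all coordinates but the largest one are at most `x*_2`, so any one in its column will do
  · have hj1 : j = 1 := by omega
    subst hj1
    obtain ⟨k, hk⟩ := Finset.card_eq_one.1 (card_topCoords x (show 1 ≤ n by omega))
    have hka : a ≤ |x k| := by
      have := rearr_le_abs x (m := 1) (k := k) (by rw [hk]; simp)
      rwa [ha, Nat.sub_self, hlev.zero]
    obtain ⟨i, hi, hik⟩ := hnz k (mem_of_supported hxJ ha0 hka)
    refine ⟨i, hi, ?_⟩
    have hℓ : levelLarge γ n p 1 = 2 := by simp [levelLarge]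
    have := le_abs_of_unique_row (x := x) (b := b) (J := {k}) (fun l hl => by
      rw [hb, hℓ]
      exact abs_le_rearr_succ x (by omega) (by rwa [hk])) hb0 (hrows i)
      (Finset.mem_singleton_self k) hik (by
        intro l hl hlk
        exact absurd (Finset.mem_singleton.1 hl) hlk)
    linarith
  · have hst := levelLarge_step hρ hj2 hjs
    have hmono := hlev.mono j hj hjs
    set m := levelLarge γ n p (j - 1) with hm
    set m' := levelLarge γ n p j with hm'
    have hc1 : (topCoords x m).card = m := card_topCoords x (by omega)
    have hc2 : (topCoords x m').card = m' := card_topCoords x (by omega)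
    have hsub := topCoords_mono x hmono
    have hr := hrate m' hbd.1 hbd.2
    have hov' := hov _ _ hsub (by omega) (by omega) (by rw [hc1, hc2]; exact hst.2)
    rw [hc1, hc2] at hov'
    have hJ : topCoords x m ⊆ J := fun k hk =>
      mem_of_supported hxJ ha0 (rearr_le_abs x hk)
    have hm2 : (2 : ℝ) ≤ m := by exact_mod_cast hst.1
    -- at most one of the columns is light, so at least half of them are heavy
    have hhits : (m : ℝ) / 2 * (τ * (p * n)) ≤
        ∑ k ∈ topCoords x m, ((colSupp B k).card : ℝ) := by
      set H := (topCoords x m).filter fun k => ¬ IsLight B (τ * (p * n)) k with hH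
      set L := (topCoords x m).filter fun k => IsLight B (τ * (p * n)) k with hL
      have hL1 : L.card ≤ 1 := by
        refine Finset.card_le_one.2 fun k hk l hl => ?_
        rw [hL, Finset.mem_filter] at hk hl
        exact hlight k (hJ hk.1) l (hJ hl.1) hk.2 hl.2
      have hcard : L.card + H.card = m := by
        rw [← hc1]; exact Finset.card_filter_add_card_filter_not _
      have h1 : (m : ℝ) / 2 ≤ H.card := by
        have : (m : ℝ) ≤ H.card + 1 := by exact_mod_cast (by omega : m ≤ H.card + 1)
        linarith
      have h2 : (H.card : ℝ) * (τ * (p * n)) ≤ ∑ k ∈ H, ((colSupp B k).card : ℝ) := by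
        rw [← nsmul_eq_mul]
        refine Finset.card_nsmul_le_sum _ _ _ fun k hk => ?_
        exact (not_le.1 (Finset.mem_filter.1 hk).2).le
      have h3 : ∑ k ∈ H, ((colSupp B k).card : ℝ) ≤
          ∑ k ∈ topCoords x m, ((colSupp B k).card : ℝ) :=
        Finset.sum_le_sum_of_subset_of_nonneg (Finset.filter_subset _ _)
          fun _ _ _ => Nat.cast_nonneg _
      calc _ ≤ (H.card : ℝ) * (τ * (p * n)) := by gcongr
        _ ≤ _ := h2.trans h3
    obtain ⟨i, hi, k, hk, hik, huniq⟩ := exists_unique_row hI hsub hov' (by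
      refine le_trans ?_ hhits
      rw [hc1]
      have h1 : p * n * m * overlapRate n p K m' ≤ p * n * m * (τ / 8) := by gcongr
      have h2 : (β : ℝ) * m ≤ τ * (p * n) / 8 * m := by gcongr
      have h3 : 0 ≤ τ * (p * n) * m := by positivity
      linarith)
    refine ⟨i, hi, ?_⟩
    have := le_abs_of_unique_row (x := x) (b := b)
      (fun l hl => abs_le_rearr x hbd.1 (by omega) hl) hb0 (hrows i) (hsub hk) hik huniq
    have := rearr_le_abs x hk
    linarith

/-- A row on which a steep vector is large, for the levels of the sparse regime. -/
lemma exists_row_small (hy : 0 < p * n) (hC : 0 < C) (hI : Iᶜ.card ≤ β)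
    (hρ : 6 ≤ ratio n p) (hN : 2 ≤ expLevel n p) (hNM : expLevel n p < topLevel γ p)
    (hlev : IsLevelSeq (levelSmall γ n p) (sSmall γ n p) (topLevel γ p) (32 * C * (p * n)))
    (hM : topLevel γ p ≤ n)
    (hrows : RowsBounded p C B) (hov : OverlapsBounded p K (topLevel γ p) B)
    (hsparse : LightSparse B (τ * (p * n)))
    (hhits : ∀ J₁ J₂ : Finset (Fin n), expLevel n p ≤ J₁.card → 1 ≤ J₂.card →
      J₂.card ≤ topLevel γ p → (J₂.card : ℝ) ≤ 2 * ratio n p * J₁.card →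
      p * n * J₁.card * overlapRate n p K J₂.card + β * J₁.card ≤
        ∑ k ∈ J₁, ((colSupp B k).card : ℝ))
    (hnz : ∀ k ∈ J, ∃ i ∈ I, B i k = true)
    (hrate : ∀ m : ℕ, 1 ≤ m → m ≤ topLevel γ p → overlapRate n p K m ≤ τ / 8)
    (hτ : 0 < τ) (hβ : (β : ℝ) ≤ τ * (p * n) / 8)
    {x : EuclideanSpace ℝ (Fin n)} (hxJ : ∀ k, k ∉ J → x k = 0)
    {j : ℕ} (hj : 1 ≤ j) (hjs : j ≤ sSmall γ n p)
    (hx : 32 * C * (p * n) * rearr x (levelSmall γ n p j) < rearr x (levelSmall γ n p (j - 1))) :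
    ∃ i ∈ I, rearr x (levelSmall γ n p (j - 1)) / 32 ≤ |∑ l, toM B i l * x l| := by
  classical
  set a := rearr x (levelSmall γ n p (j - 1)) with ha
  set b := rearr x (levelSmall γ n p j) with hb
  have hb0 : 0 ≤ b := rearr_nonneg _ _
  have ha0 : 0 < a := lt_of_le_of_lt (by positivity) hx
  have hDb : C * (p * n) * b ≤ a / 32 := by linarith
  have hbd := hlev.bounds j hjs
  have hbd1 := hlev.bounds (j - 1) (by omega)
  have hst := levelSmall_step (γ := γ) (by linarith) hN hNM hj hjs
  have hmono := hlev.mono j hj hjs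
  set m := levelSmall γ n p (j - 1) with hm
  set m' := levelSmall γ n p j with hm'
  have hc1 : (topCoords x m).card = m := card_topCoords x (by omega)
  have hc2 : (topCoords x m').card = m' := card_topCoords x (by omega)
  have hsub := topCoords_mono x hmono
  have hr := hrate m' hbd.1 hbd.2
  have hsmall : ∀ l ∉ topCoords x m', |x l| ≤ b := fun l hl =>
    abs_le_rearr x hbd.1 (by omega) hl
  rcases hst with hst | hst
  -- the number of columns grows at most by a factor `3`
  · refine exists_row_of_lightSparse hsparse (J := J) (fun k hk _ => hnz k hk) hsub
      (by rw [hc1, hc2]; exact hst) ha0 (fun k hk => rearr_le_abs x hk) hsmall hb0 hxJ hrows hDb ?_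
    intro H hH hheavy hcard
    rw [hc1] at hcard
    have hH1 : 1 ≤ H.card := by omega
    have h12 : (m' : ℝ) ≤ 12 * H.card := by exact_mod_cast (by omega : m' ≤ 12 * H.card)
    have hov' := hov _ _ hH hH1 (by omega) (by
      rw [hc2]
      have : (0 : ℝ) ≤ H.card := Nat.cast_nonneg _
      nlinarith)
    rw [hc2] at hov'
    refine exists_unique_row hI hH hov' ?_
    have h2 : (H.card : ℝ) * (τ * (p * n)) ≤ ∑ k ∈ H, ((colSupp B k).card : ℝ) := by
      rw [← nsmul_eq_mul]
      exact Finset.card_nsmul_le_sum _ _ _ fun k hk => (not_le.1 (hheavy k hk)).le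
    have h3 : p * n * H.card * overlapRate n p K m' ≤ p * n * H.card * (τ / 8) := by gcongr
    have h4 : (β : ℝ) * H.card ≤ τ * (p * n) / 8 * H.card := by gcongr
    have h5 : 0 ≤ τ * (p * n) * H.card := by positivity
    linarith
  -- there are at least `expLevel` columns, which have many ones altogether
  · have hov' := hov _ _ hsub (by omega) (by omega) (by rw [hc1, hc2]; exact hst.2)
    have hh := hhits (topCoords x m) (topCoords x m') (by omega) (by omega) (by omega)
      (by rw [hc1, hc2]; exact hst.2)
    obtain ⟨i, hi, k, hk, hik, huniq⟩ := exists_unique_row hI hsub hov' hh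
    refine ⟨i, hi, ?_⟩
    have := le_abs_of_unique_row (x := x) hsmall hb0 (hrows i) (hsub hk) hik huniq
    have := rearr_le_abs x hk
    linarith

/-- A large entry of `A x` bounds the norm of `A_{I,J} x` from below. -/
lemma le_normMulVec_of_row {x : EuclideanSpace ℝ (Fin n)} (hxJ : ∀ k, k ∉ J → x k = 0) {a : ℝ}
    (h : ∃ i ∈ I, a ≤ |∑ l, toM B i l * x l|) :
    a ≤ normMulVec (sub (toM B) I J) (fun j => x j) := by
  obtain ⟨i, hi, ha⟩ := h
  refine ha.trans ?_
  unfold normMulVec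
  have h1 := PiLp.norm_apply_le (WithLp.toLp 2 (sub (toM B) I J *ᵥ fun j => x j) :
    EuclideanSpace ℝ I) ⟨i, hi⟩
  refine le_trans (le_of_eq ?_) h1
  rw [Real.norm_eq_abs]
  congr 1
  change _ = ∑ j : J, toM B i j * x j
  rw [Finset.sum_coe_sort J (fun j => toM B i j * x j)]
  symm
  apply Finset.sum_subset (Finset.subset_univ _)
  intro l _ hl
  rw [hxJ l hl, mul_zero]

/-- The passage from rows to the norm bound: apply the row statement at the first level at which
the vector drops. -/
lemma norm_bound_of_rows {ℓ : ℕ → ℕ} {s M : ℕ} {D θ : ℝ} (hD : 1 ≤ D) (hM : M ≤ n)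
    (hlev : IsLevelSeq ℓ s M D)
    (hθ : (32 * θ) ^ 2 * (3 * s * D ^ (2 * (s - 1)) + n) ≤ 1)
    {x : EuclideanSpace ℝ (Fin n)} (hxJ : ∀ k, k ∉ J → x k = 0)
    (hx : ∃ j, 1 ≤ j ∧ j ≤ s ∧ D * rearr x (ℓ j) < rearr x (ℓ (j - 1)))
    (hrow : ∀ j, 1 ≤ j → j ≤ s → D * rearr x (ℓ j) < rearr x (ℓ (j - 1)) →
      ∃ i ∈ I, rearr x (ℓ (j - 1)) / 32 ≤ |∑ l, toM B i l * x l|) :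
    θ * ‖x‖ ≤ normMulVec (sub (toM B) I J) (fun j => x j) := by
  classical
  have hs := Nat.find_spec hx
  have hmin := fun i => Nat.find_min hx (m := i)
  set j := Nat.find hx
  obtain ⟨hj, hjs, hxj⟩ := hs
  refine le_trans ?_ (le_normMulVec_of_row hxJ (hrow j hj hjs hxj))
  set a := rearr x (ℓ (j - 1)) with ha
  have ha0 : 0 ≤ a := rearr_nonneg _ _
  have hnorm := norm_sq_le_of_levels x hD hj hlev.zero
    (fun i hi => ⟨(hlev.bounds i (hi.trans hjs)).1, (hlev.bounds i (hi.trans hjs)).2.trans hM⟩)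
    (fun i hi hij => hlev.grow i hi (hij.trans hjs))
    (fun i hi hij => by
      by_contra hcon
      exact hmin i hij ⟨hi, by omega, not_le.1 hcon⟩)
    (by
      have := rearr_nonneg x (ℓ j)
      nlinarith)
  have hmono : (3 * j * D ^ (2 * (j - 1)) + n : ℝ) ≤ 3 * s * D ^ (2 * (s - 1)) + n := by
    gcongr
  have h1 : (32 * (θ * ‖x‖)) ^ 2 ≤ a ^ 2 := by
    calc (32 * (θ * ‖x‖)) ^ 2 = (32 * θ) ^ 2 * ‖x‖ ^ 2 := by ring
      _ ≤ (32 * θ) ^ 2 * ((3 * s * D ^ (2 * (s - 1)) + n) * a ^ 2) := by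
          apply mul_le_mul_of_nonneg_left _ (by positivity)
          exact hnorm.trans (mul_le_mul_of_nonneg_right hmono (by positivity))
      _ = (32 * θ) ^ 2 * (3 * s * D ^ (2 * (s - 1)) + n) * a ^ 2 := by ring
      _ ≤ 1 * a ^ 2 := by gcongr
      _ = a ^ 2 := one_mul _
  have := (abs_le.1 (abs_le_of_sq_le_sq h1 ha0)).2
  linarith

end Columns

/-! ### Removing rows and columns -/

section Removal

variable {n : ℕ} {B : Grid n} {β : ℕ} {T : ℝ}

lemma lightCols_toM (B : Grid n) :
    (lightCols (toM B) 0).ncard = (zeroRows (tr B)).card := by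
  have : lightCols (toM B) 0 = (zeroRows (tr B) : Set (Fin n)) := by
    ext j
    simp only [lightCols, Nat.le_zero, Set.mem_ofPred_eq, Finset.mem_coe, zeroRows,
      Finset.mem_filter, Finset.mem_univ, true_and]
    rw [Set.ncard_eq_zero]
    simp [toM, tr, Set.eq_empty_iff_forall_notMem]
  rw [this, Set.ncard_coe_finset]

lemma inOmegaRC_toM (B : Grid n) :
    InOmegaRC β (toM B) ↔ (zeroRows (tr B)).card < β ∧ (zeroRows B).card < β := by
  unfold InOmegaRC
  rw [lightCols_toM, ← toM_tr, lightCols_toM, tr_tr]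

lemma mem_zeroRows_tr {k : Fin n} : k ∈ zeroRows (tr B) ↔ ∀ i, B i k = false := by
  simp only [zeroRows, Finset.mem_filter, Finset.mem_univ, true_and]
  rfl

lemma exists_one_of_notMem_zeroRows {i : Fin n} (h : i ∉ zeroRows B) : ∃ k, B i k = true := by
  simpa [zeroRows] using h

/-- In the sparse regime, `β - 1` rows including all zero rows can be removed without touching the
light columns: a heavy column provides rows which do not meet them. -/
lemma exists_removed_rows (hB : LightSparse B T) (hk : ∃ k, ¬ IsLight B T k) (hT : (β : ℝ) ≤ T)
    (hz : (zeroRows B).card < β) :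
    ∃ R : Finset (Fin n), R.card + 1 = β ∧ zeroRows B ⊆ R ∧
      ∀ i ∈ R, ∀ k, IsLight B T k → B i k = false := by
  classical
  obtain ⟨k₀, hk₀⟩ := hk
  set V : Finset (Fin n) := Finset.univ.filter fun i => ∀ k, IsLight B T k → B i k = false with hV
  have hZV : zeroRows B ⊆ V := by
    intro i hi
    simp only [zeroRows, Finset.mem_filter, Finset.mem_univ, true_and] at hi
    simp [hV, hi]
  have hcard : β - 1 ≤ V.card := by
    have h1 : β < (colSupp B k₀).card := by
      have := not_le.1 hk₀
      exact_mod_cast hT.trans_lt this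
    have h2 : (colSupp B k₀ \ V).card ≤ 1 := by
      refine Finset.card_le_one.2 fun i₁ h₁ i₂ h₂ => ?_
      simp only [hV, colSupp, Finset.mem_sdiff, Finset.mem_filter, Finset.mem_univ, true_and,
        not_forall, Bool.not_eq_false] at h₁ h₂
      obtain ⟨hi₁, l₁, hl₁, hB₁⟩ := h₁
      obtain ⟨hi₂, l₂, hl₂, hB₂⟩ := h₂
      exact hB.meet i₁ i₂ k₀ l₁ l₂ (by rintro rfl; exact hk₀ hl₁) (by rintro rfl; exact hk₀ hl₂)
        hl₁ hl₂ hi₁ hB₁ hi₂ hB₂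
    have h3 := Finset.card_sdiff_add_card_inter (colSupp B k₀) V
    have h4 := Finset.card_le_card (Finset.inter_subset_right : colSupp B k₀ ∩ V ⊆ V)
    omega
  obtain ⟨R, hZR, hRV, hR⟩ := Finset.exists_subsuperset_card_eq hZV (by omega) hcard
  refine ⟨R, by omega, hZR, fun i hi => ?_⟩
  have := hRV hi
  simpa [hV] using this

/-- A column with more than `T ≥ β` ones survives the removal of fewer than `β` rows. -/
lemma exists_one_of_heavy {R : Finset (Fin n)} (hR : R.card < β) (hT : (β : ℝ) ≤ T) {k : Fin n}
    (hk : ¬ IsLight B T k) : ∃ i ∈ Rᶜ, B i k = true := by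
  classical
  by_contra! hcon
  have : colSupp B k ⊆ R := by
    intro i hi
    simp only [colSupp, Finset.mem_filter, Finset.mem_univ, true_and] at hi
    by_contra hiR
    exact hcon i (Finset.mem_compl.2 hiR) hi
  have h1 := Finset.card_le_card this
  have h2 : (β : ℝ) < (colSupp B k).card := hT.trans_lt (not_le.1 hk)
  have h3 : β < (colSupp B k).card := by exact_mod_cast h2
  omega

lemma card_compl_add {R : Finset (Fin n)} (hβn : β ≤ n) (hR : R.card + 1 = β) :
    Rᶜ.card + β = n + 1 := by
  rw [Finset.card_compl, Fintype.card_fin]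
  omega

lemma exists_one_of_removed {R C : Finset (Fin n)} (hR : R.card + 1 = β) (hT : (β : ℝ) ≤ T)
    (hRl : ∀ i ∈ R, ∀ k, IsLight B T k → B i k = false) (hC : zeroRows (tr B) ⊆ C) :
    ∀ k ∈ Cᶜ, ∃ i ∈ Rᶜ, B i k = true := by
  intro k hk
  by_cases hl : IsLight B T k
  · obtain ⟨i, hi⟩ := exists_one_of_notMem_zeroRows
      (fun h => Finset.mem_compl.1 hk (hC h) : k ∉ zeroRows (tr B))
    refine ⟨i, Finset.mem_compl.2 fun hiR => ?_, hi⟩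
    have := hRl i hiR k hl
    rw [tr] at hi
    rw [hi] at this
    simp at this
  · exact exists_one_of_heavy (by omega) hT hl

/-- The choice of the submatrix in the sparse regime. -/
lemma exists_submatrix_small (hβn : β ≤ n) (hB : LightSparse B T) (hB' : LightSparse (tr B) T)
    (hk : ∃ k, ¬ IsLight B T k) (hk' : ∃ k, ¬ IsLight (tr B) T k) (hT : (β : ℝ) ≤ T)
    (hz : (zeroRows B).card < β) (hz' : (zeroRows (tr B)).card < β) :
    ∃ I J : Finset (Fin n), I.card + β = n + 1 ∧ J.card + β = n + 1 ∧
      (∀ k ∈ J, ∃ i ∈ I, B i k = true) ∧ (∀ i ∈ I, ∃ k ∈ J, tr B k i = true) := by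
  obtain ⟨R, hR, hRz, hRl⟩ := exists_removed_rows hB hk hT hz
  obtain ⟨C, hC, hCz, hCl⟩ := exists_removed_rows hB' hk' hT hz'
  exact ⟨Rᶜ, Cᶜ, card_compl_add hβn hR, card_compl_add hβn hC,
    exists_one_of_removed hR hT hRl hCz, exists_one_of_removed hC hT hCl (by simpa using hRz)⟩

open Classical in
/-- The set of light columns. -/
def lightSet (B : Grid n) (T : ℝ) : Finset (Fin n) := Finset.univ.filter fun k => IsLight B T k

lemma mem_lightSet {k : Fin n} : k ∈ lightSet B T ↔ IsLight B T k := by simp [lightSet]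

lemma zeroRows_tr_subset_lightSet (hT : 0 ≤ T) : zeroRows (tr B) ⊆ lightSet B T := by
  intro k hk
  rw [mem_zeroRows_tr] at hk
  rw [mem_lightSet, IsLight]
  have : colSupp B k = ∅ := by
    ext i
    simp [colSupp, hk i]
  rw [this]
  simpa using hT

/-- What the submatrix has to satisfy in the denser regime. -/
def IsGoodSubmatrix (B : Grid n) (T : ℝ) (I J : Finset (Fin n)) : Prop :=
  (∀ k ∈ J, ∃ i ∈ I, B i k = true) ∧
    ∀ k ∈ J, ∀ l ∈ J, IsLight B T k → IsLight B T l → k = l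

lemma exists_submatrix_of_no_light_rows (hβ : 1 ≤ β) (hβn : β ≤ n) (hT : (β : ℝ) ≤ T)
    (hl : (lightSet B T).card = β) (hl' : (lightSet (tr B) T).card = 0)
    (hz' : (zeroRows (tr B)).card < β) :
    ∃ I J : Finset (Fin n), I.card + β = n + 1 ∧ J.card + β = n + 1 ∧
      IsGoodSubmatrix B T I J ∧ IsGoodSubmatrix (tr B) T J I := by
  classical
  have hT0 : 0 ≤ T := le_trans (Nat.cast_nonneg _) hT
  obtain ⟨C, hZC, hCL, hC⟩ := Finset.exists_subsuperset_card_eq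
    (zeroRows_tr_subset_lightSet (B := B) hT0) (by omega : _ ≤ β - 1) (by omega)
  have hone : (lightSet B T \ C).card = 1 := by
    rw [Finset.card_sdiff_of_subset hCL]; omega
  obtain ⟨k₀, hk₀⟩ := Finset.card_eq_one.1 hone
  have hk₀C : k₀ ∉ C := by
    have : k₀ ∈ lightSet B T \ C := by rw [hk₀]; simp
    exact (Finset.mem_sdiff.1 this).2
  have huniq : ∀ k ∈ Cᶜ, IsLight B T k → k = k₀ := by
    intro k hk hkl
    have : k ∈ lightSet B T \ C := Finset.mem_sdiff.2 ⟨mem_lightSet.2 hkl, Finset.mem_compl.1 hk⟩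
    rw [hk₀] at this
    exact Finset.mem_singleton.1 this
  obtain ⟨i₀, hi₀⟩ := exists_one_of_notMem_zeroRows
    (fun h => hk₀C (hZC h) : k₀ ∉ zeroRows (tr B))
  obtain ⟨R, hRsub, hR⟩ := Finset.exists_subset_card_eq
    (s := ({i₀}ᶜ : Finset (Fin n))) (n := β - 1) (by
      rw [Finset.card_compl, Fintype.card_fin, Finset.card_singleton]; omega)
  have hi₀R : i₀ ∉ R := fun h => by simpa using hRsub h
  have hnolight : ∀ i, ¬ IsLight (tr B) T i := by
    intro i hi
    have := Finset.card_pos.2 ⟨i, mem_lightSet.2 hi⟩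
    omega
  refine ⟨Rᶜ, Cᶜ, card_compl_add hβn (by omega), card_compl_add hβn (by omega),
    ⟨fun k hk => ?_, fun k hk l hl h1 h2 => (huniq k hk h1).trans (huniq l hl h2).symm⟩,
    ⟨fun i _ => exists_one_of_heavy (by omega) hT (hnolight i),
      fun i _ l _ h1 _ => absurd h1 (hnolight i)⟩⟩
  by_cases hkl : IsLight B T k
  · rw [huniq k hk hkl]
    exact ⟨i₀, Finset.mem_compl.2 hi₀R, hi₀⟩
  · exact exists_one_of_heavy (by omega) hT hkl

/-- The choice of the submatrix in the denser regime: remove the light rows and columns. If there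
are `β` light columns, then one of them stays, and it is nonzero. -/
lemma exists_submatrix_large (hβ : 1 ≤ β) (hβn : β ≤ n) (hT : (β : ℝ) ≤ T)
    (hl : (lightSet B T).card + (lightSet (tr B) T).card ≤ β)
    (hz : (zeroRows B).card < β) (hz' : (zeroRows (tr B)).card < β) :
    ∃ I J : Finset (Fin n), I.card + β = n + 1 ∧ J.card + β = n + 1 ∧
      IsGoodSubmatrix B T I J ∧ IsGoodSubmatrix (tr B) T J I := by
  classical
  by_cases h1 : (lightSet B T).card = β
  · exact exists_submatrix_of_no_light_rows hβ hβn hT h1 (by omega) hz'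
  by_cases h2 : (lightSet (tr B) T).card = β
  · obtain ⟨J, I, hJ, hI, hg, hg'⟩ := exists_submatrix_of_no_light_rows hβ hβn hT h2
      (by rw [tr_tr]; omega) hz
    exact ⟨I, J, hI, hJ, hg', hg⟩
  have key : ∀ B' : Grid n, (lightSet B' T).card ≤ β - 1 →
      ∃ C : Finset (Fin n), C.card + 1 = β ∧ ∀ k ∈ Cᶜ, ¬ IsLight B' T k := by
    intro B' hB'
    obtain ⟨C, hLC, -, hC⟩ := Finset.exists_subsuperset_card_eq
      (Finset.subset_univ (lightSet B' T)) hB' (by rw [Finset.card_univ, Fintype.card_fin]; omega)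
    exact ⟨C, by omega, fun k hk hkl => Finset.mem_compl.1 hk (hLC (mem_lightSet.2 hkl))⟩
  obtain ⟨C, hC, hCl⟩ := key B (by omega)
  obtain ⟨R, hR, hRl⟩ := key (tr B) (by omega)
  exact ⟨Rᶜ, Cᶜ, card_compl_add hβn hR, card_compl_add hβn hC,
    ⟨fun k hk => exists_one_of_heavy (by omega) hT (hCl k hk),
      fun k hk l _ h _ => absurd h (hCl k hk)⟩,
    ⟨fun i hi => exists_one_of_heavy (by omega) hT (hRl i hi),
      fun i hi l _ h _ => absurd h (hRl i hi)⟩⟩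

/-- If there are at least `β` zero columns, then every admissible `J` contains one of them, and the
corresponding unit vector is steep. -/
lemma inOmegaRC_of_inOmegaT {θ : ℝ} (hθ : 0 < θ) {X : Set (EuclideanSpace ℝ (Fin n))}
    (hX : ∀ k, EuclideanSpace.single k (1 : ℝ) ∈ X) (h : InOmegaT β X θ (toM B)) :
    InOmegaRC β (toM B) := by
  classical
  have key : ∀ (B' : Grid n) (I J : Finset (Fin n)), J.card + β = n + 1 →
      (∀ x ∈ X, (∀ j, j ∉ J → x j = 0) →
        θ * ‖x‖ ≤ normMulVec (sub (toM B') I J) (fun j => x j)) → (zeroRows (tr B')).card < β := by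
    intro B' I J hJ hx
    by_contra! hcon
    have hinter : (zeroRows (tr B') ∩ J).Nonempty := by
      rw [← Finset.card_pos]
      have h1 := Finset.card_union_add_card_inter (zeroRows (tr B')) J
      have h2 := Finset.card_le_univ (zeroRows (tr B') ∪ J)
      rw [Fintype.card_fin] at h2
      omega
    obtain ⟨k, hk⟩ := hinter
    rw [Finset.mem_inter] at hk
    have h1 := hx _ (hX k) (by
      intro j hj
      rw [PiLp.single_apply, if_neg]
      rintro rfl
      exact hj hk.2)
    have hzero := mem_zeroRows_tr.1 hk.1
    have h2 : sub (toM B') I J *ᵥ (fun j => (EuclideanSpace.single k (1 : ℝ)) j) = 0 := by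
      ext i
      change ∑ j : J, toM B' i j * (EuclideanSpace.single k (1 : ℝ)) (j : Fin n) = 0
      refine Finset.sum_eq_zero fun j _ => ?_
      rw [PiLp.single_apply]
      split_ifs with hjk
      · simp [toM, hjk, hzero]
      · simp
    unfold normMulVec at h1
    rw [h2] at h1
    simp at h1
    linarith
  obtain ⟨I, J, hI, hJ, h1, h2⟩ := h
  rw [inOmegaRC_toM]
  exact ⟨key B I J hJ h1, by simpa using key (tr B) J I hI h2⟩

end Removal

/-! ### Overlaps and row sums: probability bounds -/

lemma choose_le_exp {n k : ℕ} (hk : 1 ≤ k) (hkn : k ≤ n) :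
    (n.choose k : ℝ) ≤ exp (k * (log (n / k) + 1)) := by
  have hk0 : (0 : ℝ) < k := by exact_mod_cast hk
  have hn0 : (0 : ℝ) < n := by exact_mod_cast (by omega : 0 < n)
  have h1 : (n.choose k : ℝ) ≤ n ^ k / k.factorial := Nat.choose_le_pow_div k n
  have h2 : (k : ℝ) ^ k / k.factorial ≤ exp k := pow_div_factorial_le_exp k hk0.le k
  have h3 : exp (k * (log (n / k) + 1)) = (n / k : ℝ) ^ k * exp k := by
    rw [mul_add, exp_add, mul_one, exp_nat_mul, exp_log (by positivity)]
  rw [h3]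
  calc (n.choose k : ℝ) ≤ n ^ k / k.factorial := h1
    _ = (n / k : ℝ) ^ k * (k ^ k / k.factorial) := by
        rw [div_pow]; field_simp
    _ ≤ _ := by gcongr

lemma exp_neg_two_mul_le {x : ℝ} (h1 : x ≤ 1 / 2) :
    exp (-(x + 2 * x ^ 2)) ≤ 1 - x := by
  rw [← le_log_iff_exp_le (by linarith)]
  have h2 := one_sub_inv_le_log_of_pos (by linarith : 0 < 1 - x)
  have h3 : (1 - x)⁻¹ ≤ 1 + x + 2 * x ^ 2 := by
    rw [inv_le_iff_one_le_mul₀ (by linarith)]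
    nlinarith [mul_nonneg (sq_nonneg x) (by linarith : 0 ≤ 1 - 2 * x)]
  linarith

section Bounds

variable {n : ℕ} {p : ℝ}

lemma gP_not_rowsBounded_le (h0 : 0 ≤ p) (h1 : p ≤ 1) (C : ℝ) :
    gP p {B : Grid n | ¬ RowsBounded p C B} ≤ n * exp (2 * (p * n) - C * (p * n)) := by
  have := gP_exists_le_card_mul (n := n) h0 h1 (Finset.univ : Finset (Fin n))
    (fun i => {B | C * (p * n) ≤ (ones B ({i} ×ˢ Finset.univ) : ℝ)})
    (q := exp (2 * (p * n) - C * (p * n))) (by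
      intro i _
      refine (gP_le_ones h0 h1 _).trans (le_of_eq ?_)
      simp)
  rw [Finset.card_univ, Fintype.card_fin] at this
  refine (gP_mono h0 h1 ?_).trans this
  intro B hB
  change ¬ RowsBounded p C B at hB
  unfold RowsBounded at hB
  push Not at hB
  obtain ⟨i, hi⟩ := hB
  refine ⟨i, Finset.mem_univ i, ?_⟩
  change C * (p * n) ≤ (ones B ({i} ×ˢ Finset.univ) : ℝ)
  have : ones B ({i} ×ˢ Finset.univ) = cnt (B i) Finset.univ := by
    unfold ones cnt
    rw [Finset.singleton_product, Finset.filter_map, Finset.card_map]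
    rfl
  rw [this]
  exact hi.le

/-- The union bound over pairs `J₁ ⊆ J₂` of given sizes. The Chernoff parameter is
`s = (m₂ p) ^ (-1/2)`. -/
lemma gP_overlap_sizes_le (h0 : 0 < p) (h1 : p ≤ 1) {K : ℝ} {m₁ m₂ : ℕ} (hm : 1 ≤ m₁)
    (hm₂ : m₂ ≤ n) (hm₁₂ : m₁ ≤ m₂) (hu : m₂ * p < 1) (hratio : (m₂ : ℝ) ≤ 2 * ratio n p * m₁)
    (hlog : 0 < log (p * n)) (hy : (2 * log (p * n) + 4) / log (p * n) ^ 3 ≤ 1) (hK : 8 ≤ K) :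
    gP p {B : Grid n | ∃ J₂ ∈ Finset.powersetCard m₂ Finset.univ, B ∈
        {B : Grid n | ∃ J₁ ∈ Finset.powersetCard m₁ J₂,
          B ∈ {B : Grid n | p * n * m₁ * overlapRate n p K m₂ ≤ (overlap B J₁ J₂ : ℝ)}}} ≤
      exp (-(p * n * (K / 2 - 4))) := by
  have hm₁0 : (1 : ℝ) ≤ m₁ := by exact_mod_cast hm
  have hm₂0 : (1 : ℝ) ≤ m₂ := by exact_mod_cast hm.trans hm₁₂
  have hn0 : (1 : ℝ) ≤ n := by exact_mod_cast (hm.trans hm₁₂).trans hm₂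
  have hm₁₂' : (m₁ : ℝ) ≤ m₂ := by exact_mod_cast hm₁₂
  set u : ℝ := m₂ * p with hudef
  have hu0 : 0 < u := by positivity
  have hy0 : 0 < p * n := by positivity
  set lu := log (1 / u) with hlu
  have hlu0 : 0 < lu := log_pos (by rw [lt_div_iff₀ hu0]; linarith)
  set s : ℝ := exp (lu / 2) with hs
  have hs1 : 1 ≤ s := one_le_exp (by positivity)
  have hs2 : s ^ 2 = 1 / u := by
    rw [hs, ← exp_nat_mul, ← exp_log (by positivity : 0 < 1 / u), ← hlu]
    congr 1
    push_cast
    ring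
  have hus : u * s ≤ 1 := by
    have h : (u * s) ^ 2 ≤ 1 := by
      rw [mul_pow, hs2]
      have : u ^ 2 * (1 / u) = u := by field_simp
      rw [this]; exact hu.le
    exact (abs_le.1 (abs_le_one_iff_mul_self_le_one.2 (by rw [← sq]; exact h))).2
  have hps : m₁ * (p * s) ≤ 1 := by
    calc m₁ * (p * s) ≤ m₂ * (p * s) := by gcongr
      _ = u * s := by rw [hudef]; ring
      _ ≤ 1 := hus
  set R := p * n * m₁ * overlapRate n p K m₂ with hR
  set q := exp (-(p * n * m₁ * (4 * lu / log (p * n) ^ 3 + K / 2 - exp 1))) with hq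
  have hsingle : ∀ J₂ ∈ Finset.powersetCard m₂ (Finset.univ : Finset (Fin n)),
      ∀ J₁ ∈ Finset.powersetCard m₁ J₂,
        gP p {B : Grid n | R ≤ (overlap B J₁ J₂ : ℝ)} ≤ q := by
    intro J₂ hJ₂ J₁ hJ₁
    rw [Finset.mem_powersetCard] at hJ₁ hJ₂
    refine (gP_le_overlap h0.le h1 hs1 J₁ J₂).trans ?_
    rw [hJ₁.2, hJ₂.2, hq, exp_le_exp]
    have e1 : R * log s = p * n * m₁ * (4 * lu / log (p * n) ^ 3 + K / 2) := by
      rw [hR, hs, log_exp, overlapRate, ← hudef, ← hlu]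
      field_simp
      ring
    have e2 : (n : ℝ) * (m₁ * m₂ * ((p * s) ^ 2 * exp (m₁ * (p * s)))) ≤ p * n * m₁ * exp 1 := by
      have : (n : ℝ) * (m₁ * m₂ * ((p * s) ^ 2 * exp (m₁ * (p * s)))) =
          p * n * m₁ * (u * s ^ 2) * exp (m₁ * (p * s)) := by rw [hudef]; ring
      rw [this, hs2, mul_one_div_cancel hu0.ne', mul_one]
      gcongr
    rw [e1]
    linarith
  -- `2 ^ m₂ ≤ exp m₂` choices of `J₁` inside `J₂`
  have hcount : (m₂.choose m₁ : ℝ) ≤ exp m₂ := by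
    have h2 : (m₂.choose m₁ : ℝ) ≤ 2 ^ m₂ := by
      exact_mod_cast Nat.choose_le_two_pow m₂ m₁
    refine h2.trans ?_
    rw [← mul_one (m₂ : ℝ), exp_nat_mul]
    have := add_one_le_exp (1 : ℝ)
    gcongr
    linarith
  have hin : ∀ J₂ ∈ Finset.powersetCard m₂ (Finset.univ : Finset (Fin n)),
      gP p {B : Grid n | ∃ J₁ ∈ Finset.powersetCard m₁ J₂,
        B ∈ {B : Grid n | R ≤ (overlap B J₁ J₂ : ℝ)}} ≤ exp m₂ * q := by
    intro J₂ hJ₂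
    refine (gP_exists_le_card_mul h0.le h1 _ _ (hsingle J₂ hJ₂)).trans ?_
    rw [Finset.card_powersetCard, (Finset.mem_powersetCard.1 hJ₂).2]
    gcongr
  refine (gP_exists_le_card_mul h0.le h1 _ _ hin).trans ?_
  rw [Finset.card_powersetCard, Finset.card_univ, Fintype.card_fin]
  have hch := choose_le_exp (hm.trans hm₁₂) hm₂
  have hnm : log ((n : ℝ) / m₂) = log (p * n) + lu := by
    rw [hlu, ← log_mul hy0.ne' (by positivity)]
    congr 1
    rw [hudef]
    field_simp
  calc (n.choose m₂ : ℝ) * (exp m₂ * q)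
      ≤ exp (m₂ * (log (n / m₂) + 1)) * (exp m₂ * q) := by gcongr
    _ = exp (m₂ * (log (p * n) + lu + 2) -
          p * n * m₁ * (4 * lu / log (p * n) ^ 3 + K / 2 - exp 1)) := by
        rw [hq, ← exp_add, ← exp_add, hnm]
        congr 1
        ring
    _ ≤ _ := by
        rw [exp_le_exp]
        have h3 : m₂ * (log (p * n) + lu + 2) ≤
            2 * ratio n p * m₁ * (log (p * n) + lu + 2) := by
          gcongr
        have h4 : 2 * ratio n p * m₁ * (log (p * n) + lu + 2) =
            p * n * m₁ * ((2 * log (p * n) + 4) / log (p * n) ^ 3 +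
              2 * lu / log (p * n) ^ 3) := by
          unfold ratio
          field_simp
          ring
        have h5 : 0 ≤ lu / log (p * n) ^ 3 := by positivity
        have h6 := exp_one_lt_d9
        have h7 : p * n * m₁ * ((2 * log (p * n) + 4) / log (p * n) ^ 3 +
            2 * lu / log (p * n) ^ 3) - p * n * m₁ * (4 * lu / log (p * n) ^ 3 + K / 2 - exp 1) ≤
              -(p * n * m₁ * (K / 2 - 4)) := by
          have : (2 * log (p * n) + 4) / log (p * n) ^ 3 + 2 * lu / log (p * n) ^ 3 -
              (4 * lu / log (p * n) ^ 3 + K / 2 - exp 1) ≤ -(K / 2 - 4) := by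
            have e1 : 2 * lu / log (p * n) ^ 3 = 2 * (lu / log (p * n) ^ 3) := by ring
            have e2 : 4 * lu / log (p * n) ^ 3 = 4 * (lu / log (p * n) ^ 3) := by ring
            rw [e1, e2]
            linarith
          have h8 := mul_le_mul_of_nonneg_left this (by positivity : 0 ≤ p * n * m₁)
          linarith
        have h9 : p * n * (K / 2 - 4) ≤ p * n * m₁ * (K / 2 - 4) := by
          have : 0 ≤ p * n * (K / 2 - 4) := mul_nonneg hy0.le (by linarith)
          nlinarith
        linarith

lemma gP_not_overlapsBounded_le (h0 : 0 < p) (h1 : p ≤ 1) {K : ℝ} {M : ℕ} (hM : M ≤ n)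
    (hMp : M * p < 1) (hlog : 0 < log (p * n))
    (hy : (2 * log (p * n) + 4) / log (p * n) ^ 3 ≤ 1) (hK : 8 ≤ K) :
    gP p {B : Grid n | ¬ OverlapsBounded p K M B} ≤
      n * (n * exp (-(p * n * (K / 2 - 4)))) := by
  classical
  let S : ℕ → ℕ → Set (Grid n) := fun m₁ m₂ =>
    {B : Grid n | ∃ J₂ ∈ Finset.powersetCard m₂ Finset.univ, B ∈
        {B : Grid n | ∃ J₁ ∈ Finset.powersetCard m₁ J₂,
          B ∈ {B : Grid n | p * n * m₁ * overlapRate n p K m₂ ≤ (overlap B J₁ J₂ : ℝ)}}}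
  let S' : ℕ → ℕ → Set (Grid n) := fun m₁ m₂ =>
    if m₁ ≤ m₂ ∧ m₂ ≤ M ∧ (m₂ : ℝ) ≤ 2 * ratio n p * m₁ then S m₁ m₂ else ∅
  have hS' : ∀ m₁ ∈ Finset.Icc 1 n, ∀ m₂ ∈ Finset.Icc 1 n,
      gP p (S' m₁ m₂) ≤ exp (-(p * n * (K / 2 - 4))) := by
    intro m₁ hm₁ m₂ hm₂
    rw [Finset.mem_Icc] at hm₁ hm₂
    simp only [S']
    split_ifs with h
    · have h2 : (m₂ : ℝ) * p < 1 := by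
        have : (m₂ : ℝ) ≤ M := by exact_mod_cast h.2.1
        nlinarith
      exact gP_overlap_sizes_le h0 h1 hm₁.1 hm₂.2 h.1 h2 h.2.2 hlog hy hK
    · simp [gP, gE, exp_nonneg]
  have hin : ∀ m₁ ∈ Finset.Icc 1 n, gP p {B : Grid n | ∃ m₂ ∈ Finset.Icc 1 n, B ∈ S' m₁ m₂} ≤
      n * exp (-(p * n * (K / 2 - 4))) := by
    intro m₁ hm₁
    refine (gP_exists_le_card_mul h0.le h1 _ _ (hS' m₁ hm₁)).trans (le_of_eq ?_)
    simp
  have hout := gP_exists_le_card_mul h0.le h1 _ _ hin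
  rw [Nat.card_Icc, Nat.add_sub_cancel] at hout
  refine (gP_mono h0.le h1 ?_).trans hout
  intro B hB
  change ¬ OverlapsBounded p K M B at hB
  unfold OverlapsBounded at hB
  push Not at hB
  obtain ⟨J₁, J₂, hsub, hc1, hc2, hr, hov⟩ := hB
  have hc := Finset.card_le_card hsub
  refine ⟨J₁.card, Finset.mem_Icc.2 ⟨hc1, by omega⟩, J₂.card,
    Finset.mem_Icc.2 ⟨by omega, by omega⟩, ?_⟩
  simp only [S', if_pos (⟨hc, hc2, hr⟩ : J₁.card ≤ J₂.card ∧ _ ∧ _)]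
  exact ⟨J₂, Finset.mem_powersetCard.2 ⟨Finset.subset_univ _, rfl⟩, J₁,
    Finset.mem_powersetCard.2 ⟨hsub, rfl⟩, hov⟩

lemma ones_product (B : Grid n) (R L : Finset (Fin n)) :
    ones B (R ×ˢ L) = ∑ l ∈ L, (R.filter fun i => B i l = true).card := by
  unfold ones
  simp only [Finset.card_filter]
  rw [Finset.sum_product_right]

lemma ones_product_le (B : Grid n) (R L : Finset (Fin n)) :
    (ones B (R ×ˢ L) : ℝ) ≤ ∑ l ∈ L, ((colSupp B l).card : ℝ) := by
  rw [ones_product]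
  push_cast
  refine Finset.sum_le_sum fun l _ => ?_
  exact_mod_cast Finset.card_le_card (Finset.filter_subset_filter _ (Finset.subset_univ _))

/-- Few ones in some `m` columns are unlikely, if the density `s` is small compared with `log m`. -/
lemma gP_few_hits_le (h0 : 0 < p) (h1 : p ≤ 1) {m : ℕ} (hm : 1 ≤ m) (hmn : m ≤ n) {s : ℝ}
    (hs : 0 < s) (hs1 : s ≤ 1) (hlogn : log n ≤ p * n)
    (hcond : 1 + p * n * (s * (log (1 / s) + 1)) ≤ log m / 2) :
    gP p {B : Grid n | ∃ J ∈ Finset.powersetCard m Finset.univ, B ∈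
        {B : Grid n | ∑ k ∈ J, ((colSupp B k).card : ℝ) ≤ s * (p * n) * m}} ≤
      exp (-(m * log m / 2)) := by
  have hm0 : (1 : ℝ) ≤ m := by exact_mod_cast hm
  have hn0 : (1 : ℝ) ≤ n := by exact_mod_cast hm.trans hmn
  have hsingle : ∀ J ∈ Finset.powersetCard m (Finset.univ : Finset (Fin n)),
      gP p {B : Grid n | ∑ k ∈ J, ((colSupp B k).card : ℝ) ≤ s * (p * n) * m} ≤
        exp (s * (p * n) * m * log (1 / s) - p * (1 - s) * (n * m)) := by
    intro J hJ
    rw [Finset.mem_powersetCard] at hJ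
    have := gP_ones_le (n := n) h0.le h1 (Finset.univ ×ˢ J) (T := s * (p * n) * m) hs hs1
    rw [Finset.card_product, Finset.card_univ, Fintype.card_fin, hJ.2] at this
    push_cast at this
    refine (gP_mono h0.le h1 ?_).trans this
    intro B hB
    exact (ones_product_le B _ J).trans hB
  refine (gP_exists_le_card_mul h0.le h1 _ _ hsingle).trans ?_
  rw [Finset.card_powersetCard, Finset.card_univ, Fintype.card_fin]
  calc _ ≤ exp (m * (log (n / m) + 1)) *
        exp (s * (p * n) * m * log (1 / s) - p * (1 - s) * (n * m)) := by
        gcongr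
        exact choose_le_exp hm hmn
    _ ≤ _ := by
        rw [← exp_add, exp_le_exp, log_div (by positivity) (by positivity)]
        have h3 := mul_le_mul_of_nonneg_left hcond (by positivity : (0 : ℝ) ≤ m)
        have h4 := mul_le_mul_of_nonneg_left hlogn (by positivity : (0 : ℝ) ≤ m)
        linarith

/-- Prescribed ones in the rows `R` together with the lightness of the columns `L`. -/
lemma gP_prescribed_and_light_le (h0 : 0 < p) (h1 : p ≤ 1) {τ : ℝ} (hτ : 0 < τ) (hτ1 : τ ≤ 1)
    (F : Finset (Fin n × Fin n)) (R L : Finset (Fin n)) (hF : ∀ e ∈ F, e.1 ∈ R) :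
    gP p {B : Grid n | (∀ e ∈ F, B e.1 e.2 = true) ∧ ∀ l ∈ L, IsLight B (τ * (p * n)) l} ≤
      p ^ F.card * exp (-(L.card * (p * n * (1 - τ * (log (1 / τ) + 1)) - R.card))) := by
  have hdisj : Disjoint F (Rᶜ ×ˢ L) := by
    rw [Finset.disjoint_left]
    intro e he he'
    exact Finset.mem_compl.1 (Finset.mem_product.1 he').1 (hF e he)
  have := gP_prescribed_and_ones_le (n := n) h0.le h1 F (Rᶜ ×ˢ L) hdisj
    (T := L.card * (τ * (p * n))) hτ hτ1
  refine (gP_mono h0.le h1 ?_).trans (this.trans ?_)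
  · rintro B ⟨hBF, hBL⟩
    refine ⟨hBF, (ones_product_le B _ L).trans ?_⟩
    rw [← nsmul_eq_mul]
    exact Finset.sum_le_card_nsmul _ _ _ hBL
  · gcongr
    rw [Finset.card_product, Finset.card_compl, Fintype.card_fin]
    have hR : R.card ≤ n := by simpa using Finset.card_le_univ R
    push_cast [Nat.cast_sub hR]
    have h2 : p * (1 - τ) * R.card ≤ R.card := by
      have : p * (1 - τ) ≤ 1 := by nlinarith
      have h3 : (0 : ℝ) ≤ R.card := Nat.cast_nonneg _
      nlinarith
    have h4 := mul_le_mul_of_nonneg_left h2 (Nat.cast_nonneg L.card : (0 : ℝ) ≤ L.card)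
    linarith

end Bounds

/-! ### Light columns and zero rows: probability bounds -/

section Bounds

variable {n : ℕ} {p : ℝ}

/-- Two light columns meet: `O(n³)` configurations with two prescribed ones. -/
lemma gP_disj_le (h0 : 0 < p) (h1 : p ≤ 1) {τ : ℝ} (hτ : 0 < τ) (hτ1 : τ ≤ 1) :
    gP p {B : Grid n | ∃ t ∈ (Finset.univ : Finset (Fin n × Fin n × Fin n)), B ∈
      {B : Grid n | t.2.1 ≠ t.2.2 ∧ IsLight B (τ * (p * n)) t.2.1 ∧
        IsLight B (τ * (p * n)) t.2.2 ∧ B t.1 t.2.1 = true ∧ B t.1 t.2.2 = true}} ≤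
      exp 4 * ((p * n) ^ 2 * n * exp (-(2 * (p * n * (1 - τ * (log (1 / τ) + 1)))))) := by
  classical
  refine (gP_exists_le_card_mul h0.le h1 _ _
    (q := p ^ 2 * exp (-(2 * (p * n * (1 - τ * (log (1 / τ) + 1)) - 1)))) ?_).trans ?_
  · rintro ⟨i, k, l⟩ _
    by_cases hkl : k = l
    · simp only [hkl, ne_eq, not_true, false_and]
      simp only [gP, gE, Set.indicator_apply]
      simp
      positivity
    · have := gP_prescribed_and_light_le (n := n) h0 h1 hτ hτ1 {(i, k), (i, l)} {i} {k, l}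
        (by simp)
      rw [Finset.card_pair (by simpa using hkl), Finset.card_pair hkl, Finset.card_singleton] at this
      refine (gP_mono h0.le h1 ?_).trans (this.trans (le_of_eq (by norm_num)))
      rintro B ⟨-, hk, hl, hBk, hBl⟩
      exact ⟨by simp [hBk, hBl], by simp [hk, hl]⟩
  · rw [Finset.card_univ, Fintype.card_prod, Fintype.card_prod, Fintype.card_fin]
    push_cast
    set g := p * n * (1 - τ * (log (1 / τ) + 1)) with hg
    have h2 : exp (-(2 * (g - 1))) = exp 2 * exp (-(2 * g)) := by rw [← exp_add]; ring_nf
    have h3 : exp (2 : ℝ) ≤ exp 4 := by rw [exp_le_exp]; norm_num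
    rw [h2]
    calc _ = exp 2 * ((p * n) ^ 2 * n * exp (-(2 * g))) := by ring
      _ ≤ _ := by gcongr

/-- A column meets another light column in two rows. -/
lemma gP_meet_one_le (h0 : 0 < p) (h1 : p ≤ 1) {τ : ℝ} (hτ : 0 < τ) (hτ1 : τ ≤ 1) :
    gP p {B : Grid n | ∃ t ∈ (Finset.univ : Finset ((Fin n × Fin n) × Fin n × Fin n)), B ∈
      {B : Grid n | t.1.1 ≠ t.1.2 ∧ t.2.2 ≠ t.2.1 ∧ IsLight B (τ * (p * n)) t.2.2 ∧
        B t.1.1 t.2.1 = true ∧ B t.1.1 t.2.2 = true ∧ B t.1.2 t.2.1 = true ∧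
        B t.1.2 t.2.2 = true}} ≤
      exp 4 * ((p * n) ^ 4 * exp (-(p * n * (1 - τ * (log (1 / τ) + 1))))) := by
  classical
  refine (gP_exists_le_card_mul h0.le h1 _ _
    (q := p ^ 4 * exp (-(p * n * (1 - τ * (log (1 / τ) + 1)) - 2))) ?_).trans ?_
  · rintro ⟨⟨i₁, i₂⟩, k, l⟩ _
    by_cases hne : i₁ = i₂ ∨ l = k
    · have : {B : Grid n | i₁ ≠ i₂ ∧ l ≠ k ∧ IsLight B (τ * (p * n)) l ∧ B i₁ k = true ∧
          B i₁ l = true ∧ B i₂ k = true ∧ B i₂ l = true} = ∅ := by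
        ext B
        simp only [Set.mem_ofPred_eq, Set.mem_empty_iff_false, iff_false]
        rintro ⟨h, h', -⟩
        exact hne.elim h h'
      simp only [this]
      simp only [gP, gE, Set.indicator_empty]
      simp
      positivity
    · push Not at hne
      have := gP_prescribed_and_light_le (n := n) h0 h1 hτ hτ1
        {(i₁, k), (i₁, l), (i₂, k), (i₂, l)} {i₁, i₂} {l} (by simp)
      rw [Finset.card_eq_of_equiv_fin (n := 4) (by
        refine Finset.equivFinOfCardEq ?_
        rw [Finset.card_insert_of_notMem, Finset.card_insert_of_notMem, Finset.card_pair] <;>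
          simp [hne.1, hne.2, hne.2.symm]), Finset.card_pair hne.1, Finset.card_singleton] at this
      refine (gP_mono h0.le h1 ?_).trans (this.trans (le_of_eq (by norm_num)))
      rintro B ⟨-, -, hl, h1, h2, h3, h4⟩
      exact ⟨by simp [h1, h2, h3, h4], by simp [hl]⟩
  · rw [Finset.card_univ, Fintype.card_prod, Fintype.card_prod, Fintype.card_fin]
    push_cast
    set g := p * n * (1 - τ * (log (1 / τ) + 1)) with hg
    have h2 : exp (-(g - 2)) = exp 2 * exp (-g) := by rw [← exp_add]; ring_nf
    have h3 : exp (2 : ℝ) ≤ exp 4 := by rw [exp_le_exp]; norm_num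
    rw [h2]
    calc _ = exp 2 * ((p * n) ^ 4 * exp (-g)) := by ring
      _ ≤ _ := by gcongr

/-- A column meets two other light columns in different rows. -/
lemma gP_meet_two_le (h0 : 0 < p) (h1 : p ≤ 1) {τ : ℝ} (hτ : 0 < τ) (hτ1 : τ ≤ 1) :
    gP p {B : Grid n | ∃ t ∈ (Finset.univ : Finset ((Fin n × Fin n) × Fin n × Fin n × Fin n)),
      B ∈ {B : Grid n | t.1.1 ≠ t.1.2 ∧ t.2.2.1 ≠ t.2.1 ∧ t.2.2.2 ≠ t.2.1 ∧ t.2.2.1 ≠ t.2.2.2 ∧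
        IsLight B (τ * (p * n)) t.2.2.1 ∧ IsLight B (τ * (p * n)) t.2.2.2 ∧
        B t.1.1 t.2.1 = true ∧ B t.1.1 t.2.2.1 = true ∧ B t.1.2 t.2.1 = true ∧
        B t.1.2 t.2.2.2 = true}} ≤
      exp 4 * ((p * n) ^ 4 * n * exp (-(2 * (p * n * (1 - τ * (log (1 / τ) + 1)))))) := by
  classical
  refine (gP_exists_le_card_mul h0.le h1 _ _
    (q := p ^ 4 * exp (-(2 * (p * n * (1 - τ * (log (1 / τ) + 1)) - 2)))) ?_).trans ?_
  · rintro ⟨⟨i₁, i₂⟩, k, l₁, l₂⟩ _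
    by_cases hne : i₁ = i₂ ∨ l₁ = k ∨ l₂ = k ∨ l₁ = l₂
    · have : {B : Grid n | i₁ ≠ i₂ ∧ l₁ ≠ k ∧ l₂ ≠ k ∧ l₁ ≠ l₂ ∧ IsLight B (τ * (p * n)) l₁ ∧
          IsLight B (τ * (p * n)) l₂ ∧ B i₁ k = true ∧
          B i₁ l₁ = true ∧ B i₂ k = true ∧ B i₂ l₂ = true} = ∅ := by
        ext B
        simp only [Set.mem_ofPred_eq, Set.mem_empty_iff_false, iff_false]
        rintro ⟨h, h', h'', h''', -⟩
        tauto
      simp only [this]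
      simp only [gP, gE, Set.indicator_empty]
      simp
      positivity
    · push Not at hne
      obtain ⟨hi, hk₁, hk₂, hl⟩ := hne
      have := gP_prescribed_and_light_le (n := n) h0 h1 hτ hτ1
        {(i₁, k), (i₁, l₁), (i₂, k), (i₂, l₂)} {i₁, i₂} {l₁, l₂} (by simp)
      rw [Finset.card_eq_of_equiv_fin (n := 4) (by
        refine Finset.equivFinOfCardEq ?_
        rw [Finset.card_insert_of_notMem, Finset.card_insert_of_notMem, Finset.card_pair] <;>
          simp [hi, hk₁.symm, hk₂.symm]), Finset.card_pair hi, Finset.card_pair hl] at this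
      refine (gP_mono h0.le h1 ?_).trans (this.trans (le_of_eq (by norm_num)))
      rintro B ⟨-, -, -, -, hl₁, hl₂, h1, h2, h3, h4⟩
      exact ⟨by simp [h1, h2, h3, h4], by simp [hl₁, hl₂]⟩
  · rw [Finset.card_univ, Fintype.card_prod, Fintype.card_prod, Fintype.card_prod,
      Fintype.card_prod, Fintype.card_fin]
    push_cast
    set g := p * n * (1 - τ * (log (1 / τ) + 1)) with hg
    have h2 : exp (-(2 * (g - 2))) = exp 4 * exp (-(2 * g)) := by rw [← exp_add]; ring_nf
    rw [h2]
    exact le_of_eq (by ring)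

lemma gP_not_lightSparse_le (h0 : 0 < p) (h1 : p ≤ 1) {τ : ℝ} (hτ : 0 < τ) (hτ1 : τ ≤ 1) :
    gP p {B : Grid n | ¬ LightSparse B (τ * (p * n))} ≤
      exp 4 * ((p * n) ^ 2 * n * exp (-(2 * (p * n * (1 - τ * (log (1 / τ) + 1)))))) +
      (exp 4 * ((p * n) ^ 4 * exp (-(p * n * (1 - τ * (log (1 / τ) + 1))))) +
      exp 4 * ((p * n) ^ 4 * n * exp (-(2 * (p * n * (1 - τ * (log (1 / τ) + 1))))))) := by
  refine le_trans (gP_mono h0.le h1 ?_) ((gP_union_le h0.le h1 _ _).trans (add_le_add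
    (gP_disj_le h0 h1 hτ hτ1) ((gP_union_le h0.le h1 _ _).trans (add_le_add
      (gP_meet_one_le h0 h1 hτ hτ1) (gP_meet_two_le h0 h1 hτ hτ1)))))
  intro B hB
  by_contra hcon
  simp only [Set.mem_union, not_or] at hcon
  obtain ⟨hd, hm₁, hm₂⟩ := hcon
  have hdisj : ∀ i k l, k ≠ l → IsLight B (τ * (p * n)) k → IsLight B (τ * (p * n)) l →
      B i k = true → B i l = false := by
    intro i k l hkl hk hl hBk
    by_contra hBl
    exact hd ⟨(i, k, l), Finset.mem_univ _, hkl, hk, hl, hBk, by simpa using hBl⟩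
  refine hB ⟨hdisj, ?_⟩
  intro i₁ i₂ k l₁ l₂ hk₁ hk₂ hl₁ hl₂ h1 h2 h3 h4
  by_contra hi
  by_cases hl : l₁ = l₂
  · subst hl
    exact hm₁ ⟨((i₁, i₂), k, l₁), Finset.mem_univ _, hi, hk₁, hl₁, h1, h2, h3, h4⟩
  · exact hm₂ ⟨((i₁, i₂), k, l₁, l₂), Finset.mem_univ _, hi, hk₁, hk₂, hl, hl₁, hl₂, h1, h2, h3, h4⟩

lemma gP_all_light_le (h0 : 0 < p) (h1 : p ≤ 1) (hn : 1 ≤ n) {τ : ℝ} (hτ : 0 < τ) (hτ1 : τ ≤ 1) :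
    gP p {B : Grid n | ∀ k, IsLight B (τ * (p * n)) k} ≤
      exp (-(p * n * (1 - τ * (log (1 / τ) + 1)))) := by
  have := gP_prescribed_and_light_le (n := n) h0 h1 hτ hτ1 ∅ ∅ {⟨0, hn⟩} (by simp)
  refine (gP_mono h0.le h1 ?_).trans (this.trans (le_of_eq (by simp)))
  intro B hB
  exact ⟨by simp, fun l _ => hB l⟩

/-- More than `β` light rows and columns. The entries common to a row and a column are counted
once, which costs the factor `exp ((β + 1) ^ 2)`. -/
lemma gP_many_light_le (h0 : 0 < p) (h1 : p ≤ 1) {τ : ℝ} (hτ : 0 < τ) (hτ1 : τ ≤ 1) (β : ℕ) :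
    gP p {B : Grid n | ¬ (lightSet B (τ * (p * n))).card +
      (lightSet (tr B) (τ * (p * n))).card ≤ β} ≤
      (β + 2) * n ^ (β + 1) *
        exp ((β + 1) ^ 2 - (β + 1) * (p * n * (1 - τ * (log (1 / τ) + 1)))) := by
  classical
  set q := exp ((β + 1) ^ 2 - (β + 1) * (p * n * (1 - τ * (log (1 / τ) + 1)))) with hq
  let P : ℕ → Finset (Finset (Fin n) × Finset (Fin n)) := fun a =>
    Finset.powersetCard a Finset.univ ×ˢ Finset.powersetCard (β + 1 - a) Finset.univ
  let S : Finset (Fin n) × Finset (Fin n) → Set (Grid n) := fun c =>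
    {B | (∀ l ∈ c.1, IsLight B (τ * (p * n)) l) ∧ ∀ l ∈ c.2, IsLight (tr B) (τ * (p * n)) l}
  have hS : ∀ a ∈ Finset.range (β + 2), ∀ c ∈ P a, gP p (S c) ≤ q := by
    rintro a ha ⟨L, L'⟩ hc
    rw [Finset.mem_range] at ha
    simp only [P, Finset.mem_product, Finset.mem_powersetCard] at hc
    obtain ⟨⟨-, hL⟩, -, hL'⟩ := hc
    set E : Finset (Fin n × Fin n) := (L'ᶜ ×ˢ L) ∪ (L' ×ˢ Finset.univ) with hE
    have hEd : Disjoint (L'ᶜ ×ˢ L) (L' ×ˢ (Finset.univ : Finset (Fin n))) := by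
      rw [Finset.disjoint_left]
      intro e he he'
      exact Finset.mem_compl.1 (Finset.mem_product.1 he).1 (Finset.mem_product.1 he').1
    have hsum : (L.card : ℝ) + L'.card = β + 1 := by
      exact_mod_cast (by omega : L.card + L'.card = β + 1)
    refine (gP_mono h0.le h1 ?_).trans ((gP_ones_le h0.le h1 E
      (T := (β + 1) * (τ * (p * n))) hτ hτ1).trans ?_)
    · rintro B ⟨hBL, hBL'⟩
      have e1 : ones B E = ones B (L'ᶜ ×ˢ L) + ones B (L' ×ˢ Finset.univ) := by
        unfold ones
        rw [hE, Finset.filter_union, Finset.card_union_of_disjoint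
          (Finset.disjoint_filter_filter hEd)]
      have e2 : (ones B (L'ᶜ ×ˢ L) : ℝ) ≤ L.card * (τ * (p * n)) := by
        refine (ones_product_le B _ L).trans ?_
        rw [← nsmul_eq_mul]
        exact Finset.sum_le_card_nsmul _ _ _ hBL
      have e3 : (ones B (L' ×ˢ Finset.univ) : ℝ) ≤ L'.card * (τ * (p * n)) := by
        have : ones B (L' ×ˢ Finset.univ) = ∑ l ∈ L', (colSupp (tr B) l).card := by
          unfold ones
          simp only [colSupp, Finset.card_filter]
          rw [Finset.sum_product]
          rfl
        rw [this]
        push_cast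
        rw [← nsmul_eq_mul]
        exact Finset.sum_le_card_nsmul _ _ _ hBL'
      change (ones B E : ℝ) ≤ _
      rw [e1, ← hsum]
      push_cast
      linarith
    · rw [hq, exp_le_exp, hE, Finset.card_union_of_disjoint hEd, Finset.card_product,
        Finset.card_product, Finset.card_compl, Finset.card_univ, Fintype.card_fin]
      have hLn : L'.card ≤ n := by simpa using Finset.card_le_univ L'
      push_cast [Nat.cast_sub hLn]
      have h2 : (L.card : ℝ) ≤ β + 1 := by
        linarith [(Nat.cast_nonneg L'.card : (0 : ℝ) ≤ L'.card)]
      have h2' : (L'.card : ℝ) ≤ β + 1 := by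
        linarith [(Nat.cast_nonneg L.card : (0 : ℝ) ≤ L.card)]
      have h3 : (L'.card : ℝ) * L.card ≤ (β + 1) ^ 2 := by
        rw [sq]; gcongr
      have h4 : p * (1 - τ) * (L'.card * L.card) ≤ (β + 1) ^ 2 := by
        have : p * (1 - τ) ≤ 1 := by nlinarith
        have : 0 ≤ p * (1 - τ) := mul_nonneg h0.le (by linarith)
        have : (0 : ℝ) ≤ L'.card * L.card := by positivity
        nlinarith
      have h5 : ((n : ℝ) - L'.card) * L.card + L'.card * n =
          n * (β + 1) - L'.card * L.card := by rw [← hsum]; ring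
      rw [h5]
      linarith
  have hin : ∀ a ∈ Finset.range (β + 2), gP p {B : Grid n | ∃ c ∈ P a, B ∈ S c} ≤
      n ^ (β + 1) * q := by
    intro a ha
    refine (gP_exists_le_card_mul h0.le h1 _ _ (hS a ha)).trans ?_
    rw [Finset.mem_range] at ha
    have : ((P a).card : ℝ) ≤ n ^ (β + 1) := by
      simp only [P, Finset.card_product, Finset.card_powersetCard, Finset.card_univ,
        Fintype.card_fin]
      have h1 := Nat.choose_le_pow n a
      have h2 := Nat.choose_le_pow n (β + 1 - a)
      have h3 : n.choose a * n.choose (β + 1 - a) ≤ n ^ (β + 1) := by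
        calc _ ≤ n ^ a * n ^ (β + 1 - a) := Nat.mul_le_mul h1 h2
          _ = _ := by rw [← pow_add]; congr 1; omega
      exact_mod_cast h3
    gcongr
  have hout := gP_exists_le_card_mul h0.le h1 _ _ hin
  rw [Finset.card_range] at hout
  refine (gP_mono h0.le h1 ?_).trans (hout.trans (le_of_eq (by push_cast; ring)))
  intro B hB
  change ¬ _ at hB
  rw [not_le] at hB
  set c := (lightSet B (τ * (p * n))).card
  set a := min c (β + 1) with ha
  obtain ⟨L, hL, hLa⟩ := Finset.exists_subset_card_eq (s := lightSet B (τ * (p * n))) (n := a)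
    (min_le_left _ _)
  obtain ⟨L', hL', hLa'⟩ := Finset.exists_subset_card_eq (s := lightSet (tr B) (τ * (p * n)))
    (n := β + 1 - a) (by omega)
  refine ⟨a, Finset.mem_range.2 (by omega), (L, L'), ?_, ?_, ?_⟩
  · simp [P, hLa, hLa']
  · exact fun l hl => mem_lightSet.1 (hL hl)
  · exact fun l hl => mem_lightSet.1 (hL' hl)

/-- The main lower bound for the probability that there are at least `β` zero rows or columns. -/
lemma le_gP_not_inOmegaRC (h0 : 0 < p) (h1 : p ≤ 1 / 2) {β : ℕ} (hβn : 2 * β ≤ n) (hn : 2 ≤ n)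
    (hlogn : log n ≤ p * n) :
    exp (-2) / (2 ^ β * β.factorial) * (n * exp (-(p * n * (1 + 2 * p)))) ^ β ≤
      gP p {B : Grid n | ¬ InOmegaRC β (toM B)} := by
  have hn0 : (2 : ℝ) ≤ n := by exact_mod_cast hn
  have hmain := le_gP_zeroRows (n := n) h0.le (by linarith) β
  refine le_trans ?_ (hmain.trans (gP_mono h0.le (by linarith) ?_))
  · set Q := (1 - p) ^ n with hQ
    have hQ1 : exp (-(p * n * (1 + 2 * p))) ≤ Q := by
      have := exp_neg_two_mul_le h1
      calc exp (-(p * n * (1 + 2 * p))) = exp (-(p + 2 * p ^ 2)) ^ n := by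
            rw [← exp_nat_mul]; ring_nf
        _ ≤ _ := pow_le_pow_left₀ (exp_pos _).le this n
    have hQ0 : 0 ≤ Q := (exp_pos _).le.trans hQ1
    have hQn : Q ≤ 1 / n := by
      have h2 : 1 - p ≤ exp (-p) := by have := add_one_le_exp (-p); linarith
      calc Q ≤ exp (-p) ^ n := pow_le_pow_left₀ (by linarith) h2 n
        _ = exp (-(p * n)) := by rw [← exp_nat_mul]; ring_nf
        _ ≤ exp (-log n) := by gcongr
        _ = 1 / n := by rw [Real.exp_neg, exp_log (by linarith)]; simp
    have hQhalf : Q ≤ 1 / 2 := hQn.trans (by gcongr)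
    have h3 : exp (-2) ≤ (1 - Q) ^ (n - β) := by
      have h4 := exp_neg_two_mul_le hQhalf
      have h5 : exp (-(2 * Q)) ≤ 1 - Q := by
        refine le_trans ?_ h4
        rw [exp_le_exp]
        nlinarith
      calc exp (-2) ≤ exp (-(2 * Q)) ^ n := by
            rw [← exp_nat_mul, exp_le_exp]
            have : n * Q ≤ 1 := by
              calc (n : ℝ) * Q ≤ n * (1 / n) := by gcongr
                _ = 1 := by field_simp
            linarith
        _ ≤ (1 - Q) ^ n := by gcongr
        _ ≤ (1 - Q) ^ (n - β) := pow_le_pow_of_le_one (by linarith) (by linarith) (by omega)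
    have h6 : (n : ℝ) ^ β / (2 ^ β * β.factorial) ≤ n.choose β := by
      have h7 := Nat.pow_le_choose (α := ℝ) β n
      refine le_trans ?_ h7
      have h8 : (n : ℝ) / 2 ≤ ((n + 1 - β : ℕ) : ℝ) := by
        rw [div_le_iff₀ (by norm_num)]
        exact_mod_cast (by omega : n ≤ (n + 1 - β) * 2)
      calc (n : ℝ) ^ β / (2 ^ β * β.factorial) = (n / 2 : ℝ) ^ β / β.factorial := by
            rw [div_pow]; field_simp
        _ ≤ _ := by gcongr
    calc _ = (n : ℝ) ^ β / (2 ^ β * β.factorial) *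
          (exp (-(p * n * (1 + 2 * p))) ^ β * exp (-2)) := by
          rw [mul_pow]; ring
      _ ≤ n.choose β * (Q ^ β * (1 - Q) ^ (n - β)) := by gcongr
  · intro B hB hRC
    rw [inOmegaRC_toM] at hRC
    change β ≤ _ at hB
    omega

end Bounds

/-! ### Inequalities for large densities -/

/-- The inequalities for `y = pn` which hold as soon as `y` is large. -/
structure IsLarge (β : ℕ) (τ γ C K κ η y : ℝ) : Prop where
  ge : 32 ≤ y
  log_ge : 3 ≤ log y
  six_mul_le : 6 * log y ^ 3 ≤ y
  div_le_one : (2 * log y + 4) / log y ^ 3 ≤ 1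
  eight_div_le : 8 / log y ^ 3 ≤ τ / 16
  beta_le : (β : ℝ) ≤ τ * y / 8
  hits : 1 + y * (20 / log y ^ 3 * (log (1 / (20 / log y ^ 3)) + 1)) ≤ y / log y ^ 2 / 2
  exp_hits : (2 * β + 3) * y ≤ exp (y / log y ^ 2) * (y / log y ^ 2) / 2
  twenty_div_le : 20 / log y ^ 3 ≤ 1
  log_sq_le : y / 8 ≤ 3 / 8 * y - log (2 * y ^ 2)
  rate_le : 8 / log y ^ 3 + (8 * K + β) / y ≤ 20 / log y ^ 3
  exp_lt : exp (y / log y ^ 2) + 1 < exp (y / 2) / (γ * y)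
  base_le : 64 * C * y ≤ (y / log y ^ 3) ^ (1 + κ)
  steps_le : (y / log y ^ 2 + 2) * log (64 * C * y) ≤ κ * y / 2
  prob_common : 4 * exp (-y) ≤ η / 2 * (exp (-2) / (2 ^ β * β.factorial))
  prob_small : 2 * (3 * exp 4 * y ^ 4 * exp (-(15 / 16 * y)) + exp (-(15 / 16 * y)) +
    exp (-y)) ≤ η / 2 * (exp (-2) / (2 ^ β * β.factorial)) * exp (-(7 / 12 * y))
  prob_large : (β + 2) * exp ((β + 1) ^ 2) * exp (-(y / (2 * (2 * β + 1)))) ≤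
    η / 2 * (exp (-2) / (2 ^ β * β.factorial))

lemma eventually_mul_log_pow_le (k : ℕ) {c : ℝ} (hc : 0 < c) :
    ∀ᶠ y : ℝ in atTop, log y ^ k ≤ c * y := by
  have h := (isLittleO_pow_log_id_atTop (n := k)).def hc
  filter_upwards [h, eventually_ge_atTop 1] with y hy hy1
  have h2 : 0 ≤ log y := log_nonneg hy1
  rw [norm_of_nonneg (by positivity), id, norm_of_nonneg (by linarith)] at hy
  exact hy

lemma eventually_log_ge (a : ℝ) : ∀ᶠ y : ℝ in atTop, a ≤ log y :=
  tendsto_log_atTop.eventually_ge_atTop a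

lemma eventually_mul_pow_mul_exp_neg_le (k : ℕ) (a : ℝ) {b ε : ℝ} (hb : 0 < b) (hε : 0 < ε) :
    ∀ᶠ y : ℝ in atTop, a * y ^ k * exp (-(b * y)) ≤ ε := by
  have h := tendsto_pow_mul_exp_neg_atTop_nhds_zero k
  have h2 : Tendsto (fun y : ℝ => b * y) atTop atTop := tendsto_id.const_mul_atTop hb
  have h3 := (h.comp h2).const_mul (a / b ^ k)
  rw [mul_zero] at h3
  filter_upwards [h3.eventually_le_const hε] with y hy
  refine le_trans (le_of_eq ?_) hy
  simp only [Function.comp]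
  rw [mul_pow]
  field_simp

set_option maxHeartbeats 1000000 in
lemma eventually_isLarge (β : ℕ) {τ γ C K κ η : ℝ} (hτ : 0 < τ) (hγ : 0 < γ) (hC : 1 ≤ C)
    (hK : 0 ≤ K) (hκ : 0 < κ) (hη : 0 < η) :
    ∀ᶠ y : ℝ in atTop, IsLarge β τ γ C K κ η y := by
  set c₀ : ℝ := exp (-2) / (2 ^ β * β.factorial) with hc₀
  have hc₀pos : 0 < c₀ := by positivity
  have e1 := eventually_log_ge (max 4 (max (128 / τ) (max (log (64 * C)) (8 / κ))))
  have e2 := eventually_mul_log_pow_le 3 (by norm_num : (0 : ℝ) < 1 / 6)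
  have e3 := eventually_mul_log_pow_le 3 (by positivity : (0 : ℝ) < 12 / (8 * K + β + 1))
  have e4 := eventually_mul_log_pow_le 2 (by positivity : (0 : ℝ) < 1 / (4 * β + 6))
  have e5 := eventually_mul_log_pow_le 1 (by norm_num : (0 : ℝ) < 1 / 16)
  have e6 := eventually_mul_log_pow_le 1 (by positivity : (0 : ℝ) < κ / 16)
  have e7 := eventually_ge_atTop (max 32 (8 * β / τ))
  have e8 : ∀ᶠ y : ℝ in atTop, log (log y) ≤ 1 / 480 * log y := by
    have := tendsto_log_atTop.eventually
      (eventually_mul_log_pow_le 1 (by norm_num : (0 : ℝ) < 1 / 480))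
    simpa using this
  have e9 := eventually_log_ge 84
  have e10 := eventually_mul_pow_mul_exp_neg_le 1 (4 * γ) (by norm_num : (0 : ℝ) < 1 / 4) one_pos
  have e11 : ∀ᶠ y : ℝ in atTop, log y ^ (3 * (1 + κ)) ≤ 1 / (64 * C) * y ^ κ := by
    have h := (isLittleO_log_rpow_rpow_atTop (3 * (1 + κ)) hκ).def
      (by positivity : (0 : ℝ) < 1 / (64 * C))
    filter_upwards [h, eventually_ge_atTop 1] with y hy hy1
    have h2 : 0 ≤ log y := log_nonneg hy1
    rwa [norm_of_nonneg (by positivity), norm_of_nonneg (by positivity)] at hy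
  have e12 := eventually_mul_pow_mul_exp_neg_le 0 4 one_pos
    (by positivity : 0 < η / 2 * c₀)
  have e13 := eventually_mul_pow_mul_exp_neg_le 4 (6 * exp 4) (by norm_num : (0 : ℝ) < 17 / 48)
    (by positivity : 0 < η / 6 * c₀)
  have e14 := eventually_mul_pow_mul_exp_neg_le 0 2 (by norm_num : (0 : ℝ) < 17 / 48)
    (by positivity : 0 < η / 6 * c₀)
  have e15 := eventually_mul_pow_mul_exp_neg_le 0 ((β + 2) * exp ((β + 1) ^ 2))
    (by positivity : (0 : ℝ) < 1 / (2 * (2 * β + 1))) (by positivity : 0 < η / 2 * c₀)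
  -- from here on, everything is elementary in `y` and `w = log y`
  filter_upwards [e1, e2, e3, e4, e5, e6, e7, e8, e9, e10, e11, e12, e13, e14, e15] with
    y e1 e2 e3 e4 e5 e6 e7 e8 e9 e10 e11 e12 e13 e14 e15
  simp only [max_le_iff] at e1 e7
  obtain ⟨h4, hτ1, hC1, hκ1⟩ := e1
  obtain ⟨h32, hβ1⟩ := e7
  set w := log y with hw
  have hy0 : 0 < y := by linarith
  have hw0 : 0 < w := by linarith
  have hw1 : 1 ≤ w := by linarith
  have hw23 : w ^ 2 ≤ w ^ 3 := pow_le_pow_right₀ hw1 (by norm_num)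
  have hw13 : w ≤ w ^ 3 := le_self_pow₀ hw1 (by norm_num)
  have hw16 : 16 * w ≤ w ^ 3 := by nlinarith
  have hwy : w ≤ y / w ^ 2 := by
    rw [le_div_iff₀ (by positivity)]
    nlinarith
  rw [pow_one] at e5 e6
  refine ⟨h32, by linarith, by linarith, ?_, ?_, ?_, ?_, ?_, ?_, ?_, ?_, ?_, ?_, ?_, ?_, ?_, ?_⟩
  · rw [div_le_one (by positivity)]
    linarith
  · rw [div_le_iff₀ (by positivity)]
    rw [div_le_iff₀ hτ] at hτ1
    have : w * τ ≤ w ^ 3 * τ := by gcongr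
    linarith
  · rw [div_le_iff₀ hτ] at hβ1
    linarith
  · have h1 : log (1 / (20 / w ^ 3)) ≤ 3 * log w := by
      rw [one_div_div, log_div (by positivity) (by norm_num), log_pow]
      have := log_nonneg (by norm_num : (1 : ℝ) ≤ 20)
      push_cast
      linarith
    have h2 : 1 + 20 * (3 * log w + 1) ≤ w / 2 := by linarith
    have h3 : 1 ≤ y / w ^ 3 := by
      rw [le_div_iff₀ (by positivity)]; linarith
    calc 1 + y * (20 / w ^ 3 * (log (1 / (20 / w ^ 3)) + 1))
        ≤ y / w ^ 3 + y * (20 / w ^ 3 * (3 * log w + 1)) := by gcongr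
      _ = y / w ^ 3 * (1 + 20 * (3 * log w + 1)) := by ring
      _ ≤ y / w ^ 3 * (w / 2) := by gcongr
      _ = y / w ^ 2 / 2 := by field_simp
  · have h1 : y ≤ exp (y / w ^ 2) := by
      calc y = exp w := by rw [hw, exp_log hy0]
        _ ≤ _ := by gcongr
    have h2 : (4 * β + 6) * w ^ 2 ≤ y := by
      rw [div_mul_eq_mul_div, one_mul, le_div_iff₀ (by positivity)] at e4
      linarith
    have h3 : (4 * β + 6 : ℝ) ≤ y / w ^ 2 := by rwa [le_div_iff₀ (by positivity)]
    have h4 : (4 * β + 6) * y ≤ y / w ^ 2 * exp (y / w ^ 2) := by gcongr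
    linarith
  · rw [div_le_one (by positivity)]
    linarith
  · rw [log_mul (by norm_num) (by positivity), log_pow]
    have := log_two_lt_d9
    push_cast
    linarith
  · have h1 : (8 * K + β) / y ≤ 12 / w ^ 3 := by
      rw [div_mul_eq_mul_div, le_div_iff₀ (by positivity)] at e3
      rw [div_le_div_iff₀ hy0 (by positivity)]
      have := pow_pos hw0 3
      linarith
    have h2 : 20 / w ^ 3 = 8 / w ^ 3 + 12 / w ^ 3 := by ring
    linarith
  · have h1 : y / w ^ 2 ≤ y / 4 := by
      gcongr
      nlinarith
    have h2 : exp (y / w ^ 2) ≤ exp (y / 4) := by gcongr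
    have h3 : 1 ≤ exp (y / w ^ 2) := one_le_exp (by positivity)
    have h4 : exp (y / 2) = exp (y / 4) * exp (y / 4) := by rw [← exp_add]; ring_nf
    have h5 : 4 * γ * y ≤ exp (y / 4) := by
      have : exp (-(1 / 4 * y)) = (exp (y / 4))⁻¹ := by rw [← Real.exp_neg]; ring_nf
      rw [this, ← div_eq_mul_inv, div_le_one (exp_pos _), pow_one] at e10
      exact e10
    rw [lt_div_iff₀ (by positivity), h4]
    have h6 : (exp (y / w ^ 2) + 1) * (γ * y) ≤ (2 * exp (y / 4)) * (γ * y) := by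
      gcongr; linarith
    have h7 := mul_le_mul_of_nonneg_left h5 (exp_pos (y / 4)).le
    have h8 := mul_pos (exp_pos (y / 4)) (mul_pos hγ hy0)
    linarith
  · rw [div_rpow hy0.le (by positivity), le_div_iff₀ (by positivity), rpow_add hy0, rpow_one,
      ← rpow_natCast w 3, ← rpow_mul hw0.le]
    push_cast
    rw [div_mul_eq_mul_div, one_mul, le_div_iff₀ (by positivity)] at e11
    have := mul_le_mul_of_nonneg_left e11 hy0.le
    linarith
  · have h1 : log (64 * C * y) ≤ 2 * w := by
      rw [log_mul (by positivity) hy0.ne']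
      linarith
    have h2 : y / w ^ 2 * (2 * w) = 2 * (y / w) := by field_simp
    have h3 : y / w ≤ κ * y / 8 := by
      rw [div_le_iff₀ hw0]
      rw [div_le_iff₀ hκ] at hκ1
      have := mul_le_mul_of_nonneg_right hκ1 hy0.le
      linarith
    calc (y / w ^ 2 + 2) * log (64 * C * y) ≤ (y / w ^ 2 + 2) * (2 * w) := by gcongr
      _ = 2 * (y / w) + 4 * w := by rw [add_mul, h2]; ring
      _ ≤ _ := by linarith
  · simpa using e12
  · have h1 : exp (-(15 / 16 * y)) = exp (-(17 / 48 * y)) * exp (-(7 / 12 * y)) := by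
      rw [← exp_add]; ring_nf
    have h2 : exp (-y) ≤ exp (-(15 / 16 * y)) := by gcongr; linarith
    have h3 : exp (-y) ≤ exp (-(17 / 48 * y)) * exp (-(7 / 12 * y)) := by rw [← h1]; exact h2
    rw [h1]
    rw [pow_zero, mul_one] at e14
    have h5 := exp_pos (-(7 / 12 * y))
    have h6 := mul_le_mul_of_nonneg_right e13 h5.le
    have h7 := mul_le_mul_of_nonneg_right e14 h5.le
    linarith
  · rw [pow_zero, mul_one] at e15
    convert e15 using 3
    ring

/-! ### Constants and norm conditions -/

/-- A statement which eventually holds for every fixed `η > 0` holds along some `η n → 0`. -/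
lemma exists_tendsto_zero_of_forall_eventually {P : ℕ → ℝ → Prop}
    (h : ∀ η > 0, ∀ᶠ n in atTop, P n η) :
    ∃ η : ℕ → ℝ, Tendsto η atTop (𝓝 0) ∧ ∀ᶠ n in atTop, P n (η n) := by
  classical
  have h' : ∀ k : ℕ, ∀ᶠ n in atTop, ∀ m ≥ n, P m (1 / ((k : ℝ) + 1)) := by
    intro k
    obtain ⟨N, hN⟩ := eventually_atTop.1 (h (1 / ((k : ℝ) + 1)) (by positivity))
    exact eventually_atTop.2 ⟨N, fun n hn m hm => hN m (hn.trans hm)⟩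
  let κ : ℕ → ℕ := fun n => Nat.findGreatest (fun k => ∀ m ≥ n, P m (1 / ((k : ℝ) + 1))) n
  have hκ : Tendsto κ atTop atTop := by
    rw [tendsto_atTop]
    intro k
    filter_upwards [h' k, eventually_ge_atTop k] with n hn hkn
    exact Nat.le_findGreatest hkn hn
  refine ⟨fun n => 1 / ((κ n : ℝ) + 1), tendsto_one_div_add_atTop_nhds_zero_nat.comp hκ, ?_⟩
  filter_upwards [h' 0] with n hn
  have := Nat.findGreatest_spec (P := fun k : ℕ => ∀ m ≥ n, P m (1 / ((k : ℝ) + 1)))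
    (Nat.zero_le n) hn
  exact this n le_rfl

/-- The entropy term `τ (log (1 / τ) + 1)` of the lower tail can be made small. -/
lemma exists_small_entropy {ε : ℝ} (hε : 0 < ε) :
    ∃ τ : ℝ, 0 < τ ∧ τ ≤ 1 ∧ τ * (log (1 / τ) + 1) ≤ ε := by
  set e := min (ε / 3) 1 with he
  have he0 : 0 < e := lt_min (by positivity) one_pos
  have he1 : e ≤ 1 := min_le_right _ _
  have he3 : e ≤ ε / 3 := min_le_left _ _
  refine ⟨e ^ 2, by positivity, pow_le_one₀ he0.le he1, ?_⟩
  have h1 : log (1 / e ^ 2) ≤ 2 * (1 / e) := by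
    rw [← _root_.one_div_pow, log_pow]
    have := log_le_sub_one_of_pos (by positivity : 0 < 1 / e)
    push_cast
    linarith
  calc e ^ 2 * (log (1 / e ^ 2) + 1) ≤ e ^ 2 * (2 * (1 / e) + 1) := by gcongr
    _ = 2 * e + e ^ 2 := by field_simp
    _ ≤ ε := by nlinarith

/-- The density of ones which is guaranteed in any `m` columns in the sparse regime. -/
def hitRate (n : ℕ) (p τ : ℝ) (m : ℕ) : ℝ := if m ^ 4 < n then 20 / log (p * n) ^ 3 else τ

/-- Every set of at least `N` columns has many ones. -/
def ManyHits {n : ℕ} (p τ : ℝ) (N : ℕ) (B : Grid n) : Prop :=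
  ∀ J : Finset (Fin n), N ≤ J.card →
    hitRate n p τ J.card * (p * n) * J.card ≤ ∑ k ∈ J, ((colSupp B k).card : ℝ)

/-- The relations between the constants: `τ` is the density below which a column is light, `C` bounds
the row sums, `K` is the constant of `overlapRate`, and `γ` is so large that
`K / log (1 / (m * p)) ≤ τ / 16` for `m` up to the top level. -/
structure IsConstants (β : ℕ) (τ γ C K c : ℝ) : Prop where
  one_le : 1 ≤ β
  τ_pos : 0 < τ
  τ_le : τ ≤ 1
  entropy_le : τ * (log (1 / τ) + 1) ≤ 1 / 32
  entropy_mul_le : (β + 1) * (τ * (log (1 / τ) + 1)) ≤ 1 / (4 * (2 * β + 1))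
  C_eq : C = 2 * β + 4
  K_eq : K = 4 * β + 14
  γ_eq : γ = 2 * exp (16 * K / τ)
  c_le : c ≤ 1 / (2 * γ)
  c_le' : c ≤ 1 / (8 * β * (2 * β + 1))

section Regime

variable {β n : ℕ} {τ γ C K c κ η p : ℝ}

lemma IsConstants.K_pos (h : IsConstants β τ γ C K c) : 0 < K := by rw [h.K_eq]; positivity

lemma IsConstants.one_le_C (h : IsConstants β τ γ C K c) : 1 ≤ C := by
  rw [h.C_eq]
  have : (0 : ℝ) ≤ β := Nat.cast_nonneg _
  linarith

lemma IsConstants.two_lt_γ (h : IsConstants β τ γ C K c) : 2 < γ := by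
  rw [h.γ_eq]
  have := h.K_pos
  have := h.τ_pos
  have : 1 < exp (16 * K / τ) := one_lt_exp_iff.2 (by positivity)
  linarith

lemma IsConstants.γ_mul_le (h : IsConstants β τ γ C K c) (hp : p ≤ c) : γ * p ≤ 1 / 2 := by
  have h2 := h.two_lt_γ
  have h3 := hp.trans h.c_le
  rw [le_div_iff₀ (by linarith)] at h3
  linarith

lemma IsConstants.p_le (h : IsConstants β τ γ C K c) (hp : p ≤ c) : p ≤ 1 / 24 := by
  refine (hp.trans h.c_le').trans ?_
  have : (1 : ℝ) ≤ β := by exact_mod_cast h.one_le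
  apply one_div_le_one_div_of_le (by norm_num)
  nlinarith

lemma IsConstants.topLevel_mul_le (h : IsConstants β τ γ C K c) (hp0 : 0 < p) (hp : p ≤ c) :
    topLevel γ p * p ≤ exp (-(16 * K / τ)) := by
  have h2 := h.two_lt_γ
  have h3 := topLevel_le (by positivity : 0 < γ * p) (h.γ_mul_le hp)
  calc topLevel γ p * p ≤ 2 / (γ * p) * p := by gcongr
    _ = 2 / γ := by field_simp
    _ = _ := by rw [h.γ_eq, Real.exp_neg]; field_simp

lemma IsConstants.topLevel_mul_lt (h : IsConstants β τ γ C K c) (hp0 : 0 < p) (hp : p ≤ c) :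
    topLevel γ p * p < 1 := by
  refine (h.topLevel_mul_le hp0 hp).trans_lt ?_
  have := h.K_pos
  have := h.τ_pos
  exact exp_lt_one_iff.2 (by rw [neg_lt_zero]; positivity)

lemma IsConstants.overlapRate_le (h : IsConstants β τ γ C K c) (hp0 : 0 < p) (hp : p ≤ c)
    (hy : IsLarge β τ γ C K κ η (p * n)) {m : ℕ} (hm : 1 ≤ m) (hmM : m ≤ topLevel γ p) :
    overlapRate n p K m ≤ τ / 8 := by
  have hK := h.K_pos
  have hτ := h.τ_pos
  have hm0 : (0 : ℝ) < m := by exact_mod_cast hm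
  have h1 : m * p ≤ exp (-(16 * K / τ)) := by
    refine le_trans ?_ (h.topLevel_mul_le hp0 hp)
    gcongr
  have h2 : 16 * K / τ ≤ log (1 / (m * p)) := by
    rw [one_div, log_inv, le_neg, ← log_exp (-(16 * K / τ))]
    exact log_le_log (by positivity) h1
  have h3 : K / log (1 / (m * p)) ≤ τ / 16 := by
    have : 0 < 16 * K / τ := by positivity
    calc K / log (1 / (m * p)) ≤ K / (16 * K / τ) := by gcongr
      _ = τ / 16 := by field_simp
  have := hy.eight_div_le
  unfold overlapRate
  linarith

lemma IsLarge.ratio_ge (hy : IsLarge β τ γ C K κ η (p * n)) : 6 ≤ ratio n p := by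
  have := hy.log_ge
  unfold ratio
  rw [le_div_iff₀ (by positivity)]
  exact hy.six_mul_le

lemma IsLarge.ratio_le (hy : IsLarge β τ γ C K κ η (p * n)) (hC : 1 ≤ C) :
    ratio n p ≤ 32 * C * (p * n) := by
  have h1 := hy.log_ge
  have h2 := hy.ge
  unfold ratio
  have h3 : 1 ≤ log (p * n) ^ 3 := one_le_pow₀ (by linarith)
  calc p * n / log (p * n) ^ 3 ≤ p * n := div_le_self (by linarith) h3
    _ ≤ _ := by nlinarith

lemma topLevel_le_card (h : IsConstants β τ γ C K c) (hp0 : 0 < p) (hp : p ≤ c)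
    (hy : IsLarge β τ γ C K κ η (p * n)) : topLevel γ p ≤ n := by
  have h2 := h.two_lt_γ
  have h3 := topLevel_le (by positivity : 0 < γ * p) (h.γ_mul_le hp)
  have h4 : 2 / (γ * p) ≤ n := by
    rw [div_le_iff₀ (by positivity)]
    have := hy.ge
    nlinarith
  exact_mod_cast h3.trans h4

lemma two_le_expLevel (hy : IsLarge β τ γ C K κ η (p * n)) : 2 ≤ expLevel n p := by
  have h1 := hy.ge
  have h2 := hy.log_ge
  have : 1 < exp (p * n / log (p * n) ^ 2) := one_lt_exp_iff.2 (by positivity)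
  exact Nat.lt_ceil.2 (by simpa using this)

lemma expLevel_le :
    (expLevel n p : ℝ) ≤ exp (p * n / log (p * n) ^ 2) + 1 :=
  (Nat.ceil_lt_add_one (exp_pos _).le).le

lemma expLevel_lt_topLevel (hγ : 0 < γ) (hp0 : 0 < p) (hn : 0 < n)
    (hy : IsLarge β τ γ C K κ η (p * n)) (hlog : p * n ≤ 2 * log n) :
    expLevel n p < topLevel γ p := by
  have hn0 : (0 : ℝ) < n := by exact_mod_cast hn
  have h1 := expLevel_le (n := n) (p := p)
  have h2 : exp (p * n / 2) ≤ n := by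
    rw [← le_log_iff_exp_le hn0]; linarith
  have h3 : exp (p * n / 2) / (γ * (p * n)) ≤ 1 / (γ * p) := by
    rw [div_le_div_iff₀ (by positivity) (by positivity)]
    have : 0 < γ * p := by positivity
    nlinarith
  have h4 : 1 / (γ * p) ≤ topLevel γ p := Nat.le_ceil _
  have h5 : (expLevel n p : ℝ) < topLevel γ p := by
    have := hy.exp_lt
    linarith
  exact_mod_cast h5

/-- The hypothesis on `θ` in `norm_bound_of_rows`, for `θ = n ^ (-1 - η)`. The factor `s` is absorbed
in the powers of `2`. -/
lemma theta_condition {s : ℕ} {D : ℝ} (hD : 1 ≤ D) (hs : 1 ≤ s) (hn : 1 ≤ n)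
    (hη : 0 < η) (hnη : 4096 ≤ (n : ℝ) ^ η) (hDs : (2 * D) ^ (s - 1) ≤ (n : ℝ) ^ (1 + η / 2)) :
    (32 * (n : ℝ) ^ (-1 + -η)) ^ 2 * (3 * s * D ^ (2 * (s - 1)) + n) ≤ 1 := by
  have hn1 : (1 : ℝ) ≤ n := by exact_mod_cast hn
  have hn0 : (0 : ℝ) < n := by linarith
  have h1 : (s : ℝ) ≤ 2 ^ (2 * (s - 1)) := by
    have h2 : s - 1 < 4 ^ (s - 1) := Nat.lt_pow_self (by norm_num)
    have h3 : s ≤ 2 ^ (2 * (s - 1)) := by rw [pow_mul]; norm_num; omega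
    exact_mod_cast h3
  have h2 : 3 * s * D ^ (2 * (s - 1)) ≤ 3 * (n : ℝ) ^ (2 + η) := by
    calc 3 * s * D ^ (2 * (s - 1)) ≤ 3 * 2 ^ (2 * (s - 1)) * D ^ (2 * (s - 1)) := by gcongr
      _ = 3 * ((2 * D) ^ (s - 1)) ^ 2 := by rw [mul_assoc, ← mul_pow, ← pow_mul, mul_comm 2 (s - 1)]
      _ ≤ 3 * ((n : ℝ) ^ (1 + η / 2)) ^ 2 := by gcongr
      _ = _ := by
        rw [← rpow_natCast, ← rpow_mul hn0.le]
        congr 2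
        push_cast
        ring
  have h3 : (n : ℝ) ≤ (n : ℝ) ^ (2 + η) := by
    conv_lhs => rw [← rpow_one (n : ℝ)]
    exact rpow_le_rpow_of_exponent_le hn1 (by linarith)
  have h4 : (32 * (n : ℝ) ^ (-1 + -η)) ^ 2 = 1024 * (n : ℝ) ^ (-2 - 2 * η) := by
    rw [mul_pow, ← rpow_natCast ((n : ℝ) ^ (-1 + -η)), ← rpow_mul hn0.le]
    norm_num
    congr 1
    ring
  rw [h4]
  calc 1024 * (n : ℝ) ^ (-2 - 2 * η) * (3 * s * D ^ (2 * (s - 1)) + n)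
      ≤ 1024 * (n : ℝ) ^ (-2 - 2 * η) * (4 * (n : ℝ) ^ (2 + η)) := by
        gcongr; linarith
    _ = 4096 * ((n : ℝ) ^ (-2 - 2 * η) * (n : ℝ) ^ (2 + η)) := by ring
    _ = 4096 * ((n : ℝ) ^ η)⁻¹ := by
        rw [← rpow_add hn0, ← rpow_neg hn0.le]
        congr 2
        ring
    _ ≤ 1 := by
        rw [← div_eq_mul_inv, div_le_one (by positivity)]
        exact hnη

/-- The powers of `2D` are comparable with those of the ratio of the levels. -/
lemma base_pow_le (hC : 1 ≤ C) (hy : IsLarge β τ γ C K κ η (p * n)) (t : ℕ) :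
    (2 * (32 * C * (p * n))) ^ t ≤ (ratio n p ^ t) ^ (1 + κ) := by
  have h1 := hy.base_le
  have h2 := hy.ratio_ge
  have h3 := hy.ge
  rw [← rpow_natCast (ratio n p) t, ← rpow_mul (by linarith), mul_comm (t : ℝ),
    rpow_mul (by linarith), rpow_natCast]
  have h4 : 0 ≤ 2 * (32 * C * (p * n)) := by positivity
  refine pow_le_pow_left₀ h4 ?_ t
  unfold ratio
  linarith

/-- The last step costs a factor `O(y)`, which is compensated by `1 / p = n / y`. -/
lemma base_pow_sLarge_le (h : IsConstants β τ γ C K c) (hp0 : 0 < p) (hp : p ≤ c) (hn : 1 ≤ n)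
    (hκ : 0 < κ) (hy : IsLarge β τ γ C K κ η (p * n)) (hnκ : 64 * C ≤ (n : ℝ) ^ κ) :
    (2 * (32 * C * (p * n))) ^ (sLarge γ n p - 1) ≤ (n : ℝ) ^ (1 + 2 * κ) := by
  have hn1 : (1 : ℝ) ≤ n := by exact_mod_cast hn
  have hC := h.one_le_C
  have hγ := h.two_lt_γ
  have hρ := hy.ratio_ge
  have h32 := hy.ge
  rcases Nat.lt_or_ge (sLarge γ n p) 2 with hs | hs
  · rw [show sLarge γ n p - 1 = 0 by omega, pow_zero]
    exact one_le_rpow hn1 (by linarith)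
  · obtain ⟨t, ht⟩ : ∃ t, sLarge γ n p = t + 2 := ⟨sLarge γ n p - 2, by omega⟩
    have h1 := lt_topLevel_of_lt_sLarge (γ := γ) (n := n) (p := p) (j := t) (by omega)
    have h2 := topLevel_le (by positivity : 0 < γ * p) (h.γ_mul_le hp)
    have h3 : ratio n p ^ t ≤ 1 / p := by
      have : 2 / (γ * p) ≤ 2 / p := by
        gcongr
        nlinarith
      have h5 : 2 / p = 2 * (1 / p) := by ring
      linarith
    have h4 := base_pow_le hC hy t
    have h5 : (ratio n p ^ t) ^ (1 + κ) ≤ (1 / p) ^ (1 + κ) :=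
      rpow_le_rpow (by positivity) h3 (by linarith)
    have h6 : (1 / p : ℝ) ^ (1 + κ) ≤ 1 / p * (n : ℝ) ^ κ := by
      rw [rpow_add (by positivity), rpow_one]
      gcongr
      rw [div_le_iff₀ hp0]
      linarith
    rw [ht, show t + 2 - 1 = t + 1 by omega, pow_succ]
    calc (2 * (32 * C * (p * n))) ^ t * (2 * (32 * C * (p * n)))
        ≤ (1 / p * (n : ℝ) ^ κ) * (2 * (32 * C * (p * n))) := by
          gcongr
          exact h4.trans (h5.trans h6)
      _ = 64 * C * n * (n : ℝ) ^ κ := by field_simp; ring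
      _ ≤ (n : ℝ) ^ κ * n * (n : ℝ) ^ κ := by gcongr
      _ = _ := by
          rw [rpow_add (by linarith), rpow_one, two_mul, rpow_add (by linarith)]
          ring

/-- The `t₀` first steps cost only `n ^ o(1)`, as `t₀ = O(y / log² y)`. -/
lemma base_pow_sSmall_le (h : IsConstants β τ γ C K c) (hp0 : 0 < p) (hp : p ≤ c) (hn : 1 ≤ n)
    (hκ : 0 < κ) (hy : IsLarge β τ γ C K κ η (p * n)) (hlog : p * n ≤ 2 * log n) :
    (2 * (32 * C * (p * n))) ^ (sSmall γ n p - 1) ≤ (n : ℝ) ^ (1 + 2 * κ) := by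
  have hn1 : (1 : ℝ) ≤ n := by exact_mod_cast hn
  have hn0 : (0 : ℝ) < n := by linarith
  have hC := h.one_le_C
  have hγ := h.two_lt_γ
  have hρ := hy.ratio_ge
  have h32 := hy.ge
  have hN := two_le_expLevel hy
  have hNM := expLevel_lt_topLevel (γ := γ) (by linarith) hp0 hn hy hlog
  have ht₁ := one_le_t₁ (γ := γ) (by linarith) hN hNM
  obtain ⟨t, ht⟩ : ∃ t, t₁ γ n p = t + 1 := ⟨t₁ γ n p - 1, by omega⟩
  have hN2 : (2 : ℝ) ≤ expLevel n p := by exact_mod_cast hN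
  have h1 := lt_topLevel_of_lt_t₁ (γ := γ) (n := n) (p := p) (j := t) (by omega)
  have h2 := topLevel_le (by positivity : 0 < γ * p) (h.γ_mul_le hp)
  have h3 : ratio n p ^ t ≤ n := by
    have h4 : 2 / (γ * p) ≤ n := by
      rw [div_le_iff₀ (by positivity)]
      nlinarith
    have : 0 ≤ ratio n p ^ t := by positivity
    nlinarith
  have h4 := base_pow_le hC hy t
  have h5 : (ratio n p ^ t) ^ (1 + κ) ≤ (n : ℝ) ^ (1 + κ) :=
    rpow_le_rpow (by positivity) h3 (by linarith)
  set v := p * n / log (p * n) ^ 2 with hv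
  have hv0 : 0 ≤ v := by positivity
  have ht₀ : (t₀ n p : ℝ) ≤ v + 2 := by
    have h0 := one_le_t₀ hN
    obtain ⟨r, hr⟩ : ∃ r, t₀ n p = r + 1 := ⟨t₀ n p - 1, by omega⟩
    have h6 := lt_expLevel_of_lt_t₀ (n := n) (p := p) (j := r) (by omega)
    have h7 : (3 : ℝ) ^ r < expLevel n p := by exact_mod_cast h6
    have h8 := expLevel_le (n := n) (p := p)
    have h9 : exp (r : ℝ) ≤ exp (v + 1) := by
      have e1 := exp_one_lt_d9
      have e2 := add_one_le_exp (1 : ℝ)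
      have e3 : 1 ≤ exp v := one_le_exp hv0
      calc exp (r : ℝ) = exp 1 ^ r := by rw [← exp_nat_mul, mul_one]
        _ ≤ 3 ^ r := by gcongr; linarith
        _ ≤ exp v + 1 := by linarith
        _ ≤ exp v * exp 1 := by nlinarith
        _ = _ := by rw [exp_add]
    rw [exp_le_exp] at h9
    rw [hr]
    push_cast
    linarith
  have h6 : (2 * (32 * C * (p * n))) ^ t₀ n p ≤ (n : ℝ) ^ κ := by
    have e1 : 2 * (32 * C * (p * n)) = 64 * C * (p * n) := by ring
    have e2 : 1 ≤ 64 * C * (p * n) := by nlinarith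
    rw [e1, rpow_def_of_pos hn0, ← exp_log (by linarith : 0 < 64 * C * (p * n)), ← exp_nat_mul,
      exp_le_exp]
    calc (t₀ n p : ℝ) * log (64 * C * (p * n)) ≤ (v + 2) * log (64 * C * (p * n)) := by
          have := log_nonneg e2
          gcongr
      _ ≤ κ * (p * n) / 2 := hy.steps_le
      _ ≤ _ := by nlinarith
  have hs : sSmall γ n p - 1 = t + t₀ n p := by unfold sSmall; omega
  rw [hs, pow_add]
  calc _ ≤ (n : ℝ) ^ (1 + κ) * (n : ℝ) ^ κ := by
        gcongr
        exact h4.trans h5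
    _ = _ := by rw [← rpow_add hn0]; ring_nf

end Regime

/-! ### The two regimes -/

section Conclusion

variable {β n : ℕ} {τ γ C K c κ η θ p : ℝ} {B : Grid n}

lemma mem_T1_large (hreg : ¬ p ≤ (1 + 1 / (2 * (β : ℝ))) * (log n / n))
    {x : EuclideanSpace ℝ (Fin n)} :
    x ∈ T1 β γ (32 * C) n p ↔ ∃ j, 1 ≤ j ∧ j ≤ sLarge γ n p ∧
      32 * C * (p * n) * rearr x (levelLarge γ n p j) < rearr x (levelLarge γ n p (j - 1)) := by
  simp only [T1, numLevels, level, if_neg hreg, Set.mem_ofPred_eq]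

lemma mem_T1_small (hreg : p ≤ (1 + 1 / (2 * (β : ℝ))) * (log n / n))
    {x : EuclideanSpace ℝ (Fin n)} :
    x ∈ T1 β γ (32 * C) n p ↔ ∃ j, 1 ≤ j ∧ j ≤ sSmall γ n p ∧
      32 * C * (p * n) * rearr x (levelSmall γ n p j) < rearr x (levelSmall γ n p (j - 1)) := by
  simp only [T1, numLevels, level, if_pos hreg, Set.mem_ofPred_eq]

lemma inOmegaT_large (h : IsConstants β τ γ C K c) (hp0 : 0 < p) (hp : p ≤ c)
    (hy : IsLarge β τ γ C K κ η (p * n)) (hβn : β ≤ n)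
    (hreg : ¬ p ≤ (1 + 1 / (2 * (β : ℝ))) * (log n / n))
    (hθ : (32 * θ) ^ 2 * (3 * sLarge γ n p * (32 * C * (p * n)) ^ (2 * (sLarge γ n p - 1)) + n) ≤ 1)
    (hRC : InOmegaRC β (toM B))
    (hr : RowsBounded p C B) (hr' : RowsBounded p C (tr B))
    (ho : OverlapsBounded p K (topLevel γ p) B) (ho' : OverlapsBounded p K (topLevel γ p) (tr B))
    (hl : (lightSet B (τ * (p * n))).card + (lightSet (tr B) (τ * (p * n))).card ≤ β) :
    InOmegaT β (T1 β γ (32 * C) n p) θ (toM B) := by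
  rw [inOmegaRC_toM] at hRC
  have hC := h.one_le_C
  have hγ := h.two_lt_γ
  have h32 := hy.ge
  have hρ := hy.ratio_ge
  have hM := topLevel_le_card h hp0 hp hy
  have hlev := isLevelSeq_large (γ := γ) (by positivity : 0 < γ * p) (h.γ_mul_le hp)
    (by linarith) (hy.ratio_le hC)
  have hβτ := hy.beta_le
  have hτ := h.τ_pos
  have hτy : 0 ≤ τ * (p * n) := by positivity
  obtain ⟨I, J, hI, hJ, hg, hg'⟩ := exists_submatrix_large h.one_le hβn
    (by linarith : (β : ℝ) ≤ τ * (p * n)) hl hRC.2 hRC.1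
  have hcompl : ∀ S : Finset (Fin n), S.card + β = n + 1 → Sᶜ.card ≤ β := by
    intro S hS
    rw [Finset.card_compl, Fintype.card_fin]
    omega
  have key : ∀ (B' : Grid n) (I J : Finset (Fin n)), Iᶜ.card ≤ β →
      IsGoodSubmatrix B' (τ * (p * n)) I J → RowsBounded p C B' →
      OverlapsBounded p K (topLevel γ p) B' → ∀ x ∈ T1 β γ (32 * C) n p,
      (∀ j, j ∉ J → x j = 0) → θ * ‖x‖ ≤ normMulVec (sub (toM B') I J) (fun j => x j) := by
    intro B' I J hI hg hr ho x hx hxJ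
    exact norm_bound_of_rows (by nlinarith) hM hlev hθ hxJ ((mem_T1_large hreg).1 hx)
      fun j hj hjs hxj => exists_row_large (by linarith) (by linarith) hI hlev (by linarith) hM hr
        ho hg.1 hg.2 (fun m hm hmM => h.overlapRate_le hp0 hp hy hm hmM) hτ hβτ hxJ hj hjs hxj
  exact ⟨I, J, hI, hJ, key B I J (hcompl I hI) hg hr ho, key (tr B) J I (hcompl J hJ) hg' hr' ho'⟩

/-- In the sparse regime, the tolerated number of shared ones stays below the guaranteed number of
ones. -/
lemma overlapRate_le_hitRate (h : IsConstants β τ γ C K c) (hp0 : 0 < p) (hp : p ≤ c)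
    (hy : IsLarge β τ γ C K κ η (p * n)) (hlog : p * n ≤ 2 * log n)
    {m m' : ℕ} (hm' : 1 ≤ m') (hm'M : m' ≤ topLevel γ p)
    (hratio : (m' : ℝ) ≤ 2 * ratio n p * m) :
    overlapRate n p K m' + β / (p * n) ≤ hitRate n p τ m := by
  have hy0 := hy.ge
  have hy0' : 0 < p * n := by linarith
  have hn0 : (0 : ℝ) < n := (pos_iff_pos_of_mul_pos hy0').1 hp0
  unfold hitRate
  split_ifs with hmn
  · have hm'0 : (0 : ℝ) < m' := by exact_mod_cast hm'
    have hlog1 := hy.log_ge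
    have hm0 : (0 : ℝ) < m := by
      by_contra hcon
      have : (m : ℝ) = 0 := le_antisymm (not_lt.1 hcon) (Nat.cast_nonneg _)
      rw [this, mul_zero] at hratio
      linarith
    have hu : m' * p ≤ 2 * (p * n) ^ 2 * m / n := by
      have h1 : ratio n p ≤ p * n := by
        unfold ratio
        exact div_le_self hy0'.le (one_le_pow₀ (by linarith))
      calc m' * p ≤ 2 * (p * n) * m * p := by
            gcongr
            exact hratio.trans (by gcongr)
        _ = _ := by field_simp
    have hlogu : p * n / 8 ≤ log (1 / (m' * p)) := by
      have h1 : log (m' * p) ≤ log (2 * (p * n) ^ 2 * m / n) := log_le_log (by positivity) hu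
      have h2 : log (2 * (p * n) ^ 2 * m / n) = log (2 * (p * n) ^ 2) + log m - log n := by
        rw [log_div (by positivity) hn0.ne', log_mul (by positivity) hm0.ne']
      have h3 : 4 * log m ≤ log n := by
        have : log ((m : ℝ) ^ 4) ≤ log n :=
          log_le_log (by positivity) (by exact_mod_cast hmn.le)
        rw [log_pow] at this
        exact_mod_cast this
      have h4 := hy.log_sq_le
      rw [one_div, log_inv]
      linarith
    have hK := h.K_pos
    have h5 : K / log (1 / (m' * p)) ≤ 8 * K / (p * n) := by
      calc K / log (1 / (m' * p)) ≤ K / (p * n / 8) := by gcongr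
        _ = _ := by field_simp
    have h6 := hy.rate_le
    rw [add_div] at h6
    unfold overlapRate
    linarith
  · have h1 := h.overlapRate_le hp0 hp hy hm' hm'M
    have h2 : (β : ℝ) / (p * n) ≤ τ / 8 := by
      rw [div_le_iff₀ hy0']
      have := hy.beta_le
      linarith
    have := h.τ_pos
    linarith

lemma inOmegaT_small (h : IsConstants β τ γ C K c) (hp0 : 0 < p) (hp : p ≤ c)
    (hy : IsLarge β τ γ C K κ η (p * n)) (hβn : β ≤ n) (hlog : p * n ≤ 2 * log n)
    (hreg : p ≤ (1 + 1 / (2 * (β : ℝ))) * (log n / n))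
    (hθ : (32 * θ) ^ 2 * (3 * sSmall γ n p * (32 * C * (p * n)) ^ (2 * (sSmall γ n p - 1)) + n) ≤ 1)
    (hRC : InOmegaRC β (toM B))
    (hr : RowsBounded p C B) (hr' : RowsBounded p C (tr B))
    (ho : OverlapsBounded p K (topLevel γ p) B) (ho' : OverlapsBounded p K (topLevel γ p) (tr B))
    (hs : LightSparse B (τ * (p * n))) (hs' : LightSparse (tr B) (τ * (p * n)))
    (hk : ∃ k, ¬ IsLight B (τ * (p * n)) k) (hk' : ∃ k, ¬ IsLight (tr B) (τ * (p * n)) k)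
    (hm : ManyHits p τ (expLevel n p) B) (hm' : ManyHits p τ (expLevel n p) (tr B)) :
    InOmegaT β (T1 β γ (32 * C) n p) θ (toM B) := by
  rw [inOmegaRC_toM] at hRC
  have hC := h.one_le_C
  have hγ := h.two_lt_γ
  have h32 := hy.ge
  have hρ := hy.ratio_ge
  have hn : 0 < n := by
    rcases Nat.eq_zero_or_pos n with rfl | hn
    · norm_num at h32
    · exact hn
  have hM := topLevel_le_card h hp0 hp hy
  have hN := two_le_expLevel hy
  have hNM := expLevel_lt_topLevel (γ := γ) (by linarith) hp0 hn hy hlog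
  have hlev := isLevelSeq_small (by linarith) hN hNM (hy.ratio_le hC) (by nlinarith)
  have hβτ := hy.beta_le
  have hτ := h.τ_pos
  have hτy : 0 ≤ τ * (p * n) := by positivity
  obtain ⟨I, J, hI, hJ, hg, hg'⟩ := exists_submatrix_small hβn hs hs' hk hk'
    (by linarith : (β : ℝ) ≤ τ * (p * n)) hRC.2 hRC.1
  have hcompl : ∀ S : Finset (Fin n), S.card + β = n + 1 → Sᶜ.card ≤ β := by
    intro S hS
    rw [Finset.card_compl, Fintype.card_fin]
    omega
  have key : ∀ (B' : Grid n) (I J : Finset (Fin n)), Iᶜ.card ≤ β →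
      (∀ k ∈ J, ∃ i ∈ I, B' i k = true) → RowsBounded p C B' →
      OverlapsBounded p K (topLevel γ p) B' → LightSparse B' (τ * (p * n)) →
      ManyHits p τ (expLevel n p) B' → ∀ x ∈ T1 β γ (32 * C) n p,
      (∀ j, j ∉ J → x j = 0) → θ * ‖x‖ ≤ normMulVec (sub (toM B') I J) (fun j => x j) := by
    intro B' I J hI hg hr ho hs hm x hx hxJ
    refine norm_bound_of_rows (by nlinarith) hM hlev hθ hxJ ((mem_T1_small hreg).1 hx)
      fun j hj hjs hxj => exists_row_small (by linarith) (by linarith) hI hρ hN hNM hlev hM hr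
        ho hs ?_ hg (fun m hm hmM => h.overlapRate_le hp0 hp hy hm hmM) hτ hβτ hxJ hj hjs hxj
    intro J₁ J₂ hJ₁ hJ₂ hJ₂M hratio
    refine le_trans ?_ (hm J₁ hJ₁)
    have h1 := overlapRate_le_hitRate h hp0 hp hy hlog hJ₂ hJ₂M hratio
    have h2 := mul_le_mul_of_nonneg_right h1
      (by positivity : (0 : ℝ) ≤ p * n * J₁.card)
    have h3 : (β : ℝ) / (p * n) * (p * n * J₁.card) = β * J₁.card := by
      have : p * n ≠ 0 := by linarith
      field_simp
    linarith
  exact ⟨I, J, hI, hJ, key B I J (hcompl I hI) hg hr ho hs hm,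
    key (tr B) J I (hcompl J hJ) hg' hr' ho' hs' hm'⟩

/-- Unit vectors are steep. -/
lemma single_mem_T1 (h : IsConstants β τ γ C K c) (hp0 : 0 < p) (hp : p ≤ c)
    (hy : IsLarge β τ γ C K κ η (p * n)) (hlog : p ≤ (1 + 1 / (2 * (β : ℝ))) * (log n / n) →
      p * n ≤ 2 * log n) (k : Fin n) :
    EuclideanSpace.single k (1 : ℝ) ∈ T1 β γ (32 * C) n p := by
  have hC := h.one_le_C
  have hγ := h.two_lt_γ
  have h32 := hy.ge
  have hρ := hy.ratio_ge
  have hn : 0 < n := by have := k.2; omega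
  by_cases hreg : p ≤ (1 + 1 / (2 * (β : ℝ))) * (log n / n)
  · have hNM := expLevel_lt_topLevel (γ := γ) (by linarith) hp0 hn hy (hlog hreg)
    have hlev := isLevelSeq_small (by linarith) (two_le_expLevel hy) hNM (hy.ratio_le hC)
      (by nlinarith)
    refine (mem_T1_small hreg).2 ⟨1, le_rfl, hlev.pos, ?_⟩
    rw [rearr_single_of_two_le k hlev.two_le, Nat.sub_self, hlev.zero, rearr_single_one]
    simp
  · have hlev := isLevelSeq_large (γ := γ) (by positivity : 0 < γ * p) (h.γ_mul_le hp)
      (by linarith) (hy.ratio_le hC)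
    refine (mem_T1_large hreg).2 ⟨1, le_rfl, hlev.pos, ?_⟩
    rw [rearr_single_of_two_le k hlev.two_le, Nat.sub_self, hlev.zero, rearr_single_one]
    simp

lemma gP_not_manyHits_le (h : IsConstants β τ γ C K c) (hp0 : 0 < p) (hp1 : p ≤ 1)
    (hy : IsLarge β τ γ C K κ η (p * n)) (hn : 1 ≤ n) (hlogn : log n ≤ p * n)
    (hlog : p * n ≤ 2 * log n) :
    gP p {B : Grid n | ¬ ManyHits p τ (expLevel n p) B} ≤ exp (-(p * n)) := by
  classical
  have hy0 := hy.ge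
  have hlog1 := hy.log_ge
  have hn0 : (0 : ℝ) < n := by exact_mod_cast hn
  set v := p * n / log (p * n) ^ 2 with hv
  have hv0 : 0 ≤ v := by positivity
  have hN : exp v ≤ expLevel n p := Nat.le_ceil _
  have hNlow := two_le_expLevel hy
  have hsingle : ∀ m ∈ Finset.Icc (expLevel n p) n,
      gP p {B : Grid n | ∃ J ∈ Finset.powersetCard m Finset.univ, B ∈
        {B : Grid n | ∑ k ∈ J, ((colSupp B k).card : ℝ) ≤ hitRate n p τ m * (p * n) * m}} ≤
      exp (-((2 * β + 3) * (p * n))) := by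
    intro m hm
    rw [Finset.mem_Icc] at hm
    have hNm : exp v ≤ m := hN.trans (by exact_mod_cast hm.1)
    have hm0 : (0 : ℝ) < m := (exp_pos v).trans_le hNm
    have hvm : v ≤ log m := by rwa [le_log_iff_exp_le hm0]
    have hrate : 0 < hitRate n p τ m ∧ hitRate n p τ m ≤ 1 ∧
        1 + p * n * (hitRate n p τ m * (log (1 / hitRate n p τ m) + 1)) ≤ log m / 2 := by
      unfold hitRate
      split_ifs with hmn
      · refine ⟨by positivity, hy.twenty_div_le, ?_⟩
        have := hy.hits
        linarith
      · refine ⟨h.τ_pos, h.τ_le, ?_⟩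
        have h1 : log n ≤ 4 * log m := by
          have : log n ≤ log ((m : ℝ) ^ 4) :=
            log_le_log hn0 (by exact_mod_cast not_lt.1 hmn)
          rw [log_pow] at this
          exact_mod_cast this
        have h2 := mul_le_mul_of_nonneg_left h.entropy_le (by linarith : 0 ≤ p * n)
        linarith
    refine (gP_few_hits_le hp0 hp1 (by omega) hm.2 hrate.1 hrate.2.1 hlogn hrate.2.2).trans ?_
    rw [exp_le_exp, neg_le_neg_iff]
    refine hy.exp_hits.trans ?_
    gcongr
  have hall := gP_exists_le_card_mul hp0.le hp1 _ _ hsingle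
  refine (gP_mono hp0.le hp1 ?_).trans (hall.trans ?_)
  · intro B hB
    change ¬ ManyHits p τ (expLevel n p) B at hB
    unfold ManyHits at hB
    push Not at hB
    obtain ⟨J, hJ, hlt⟩ := hB
    refine ⟨J.card, Finset.mem_Icc.2 ⟨hJ, by simpa using Finset.card_le_univ J⟩, J,
      Finset.mem_powersetCard.2 ⟨Finset.subset_univ _, rfl⟩, hlt.le⟩
  · have hcard : ((Finset.Icc (expLevel n p) n).card : ℝ) ≤ n := by
      rw [Nat.card_Icc]
      exact_mod_cast (by omega : n + 1 - expLevel n p ≤ n)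
    have hnexp : (n : ℝ) ≤ exp (p * n) := by
      rwa [← log_le_iff_le_exp hn0]
    calc _ ≤ exp (p * n) * exp (-((2 * β + 3) * (p * n))) := by
          gcongr
          exact hcard.trans hnexp
      _ ≤ _ := by
          rw [← exp_add, exp_le_exp]
          have : (0 : ℝ) ≤ β * (p * n) := by positivity
          linarith

end Conclusion

/-! ### Comparison of the probabilities -/

section Comparison

variable {β n : ℕ} {τ γ C K c κ η θ p : ℝ}

/-- The exceptional event which is common to both regimes. -/
def badCommon (n : ℕ) (p γ C K : ℝ) : Set (Grid n) :=
  ({B | ¬ RowsBounded p C B} ∪ {B | ¬ RowsBounded p C (tr B)}) ∪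
    ({B | ¬ OverlapsBounded p K (topLevel γ p) B} ∪
      {B | ¬ OverlapsBounded p K (topLevel γ p) (tr B)})

/-- The exceptional event of the sparse regime. -/
def badSmall (n : ℕ) (p τ : ℝ) : Set (Grid n) :=
  ({B | ¬ LightSparse B (τ * (p * n))} ∪ {B | ¬ LightSparse (tr B) (τ * (p * n))}) ∪
    (({B | ∀ k, IsLight B (τ * (p * n)) k} ∪ {B | ∀ k, IsLight (tr B) (τ * (p * n)) k}) ∪
      ({B | ¬ ManyHits p τ (expLevel n p) B} ∪ {B | ¬ ManyHits p τ (expLevel n p) (tr B)}))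

lemma gP_union_tr_le (h0 : 0 ≤ p) (h1 : p ≤ 1) {S : Set (Grid n)} {q : ℝ} (h : gP p S ≤ q) :
    gP p (S ∪ {B | tr B ∈ S}) ≤ 2 * q := by
  refine (gP_union_le h0 h1 _ _).trans ?_
  rw [gP_tr]
  linarith

lemma gP_badCommon_le (h : IsConstants β τ γ C K c) (hp0 : 0 < p) (hp : p ≤ c) (hn : 1 ≤ n)
    (hy : IsLarge β τ γ C K κ η (p * n)) (hlogn : log n ≤ p * n) :
    gP p (badCommon n p γ C K) ≤ 4 * exp (-(p * n)) * exp (-(2 * β * (p * n))) := by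
  have hp1 : p ≤ 1 := by have := h.p_le hp; linarith
  have hn0 : (0 : ℝ) < n := by exact_mod_cast hn
  have hnexp : (n : ℝ) ≤ exp (p * n) := by rwa [← log_le_iff_le_exp hn0]
  have hlog1 := hy.log_ge
  have hβ0 : (0 : ℝ) ≤ β := Nat.cast_nonneg _
  have hrows : gP p {B : Grid n | ¬ RowsBounded p C B} ≤ exp (-((2 * β + 1) * (p * n))) := by
    refine (gP_not_rowsBounded_le hp0.le hp1 C).trans ?_
    calc _ ≤ exp (p * n) * exp (2 * (p * n) - C * (p * n)) := by gcongr
      _ = _ := by rw [← exp_add, h.C_eq]; ring_nf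
  have hov : gP p {B : Grid n | ¬ OverlapsBounded p K (topLevel γ p) B} ≤
      exp (-((2 * β + 1) * (p * n))) := by
    refine (gP_not_overlapsBounded_le hp0 hp1 (topLevel_le_card h hp0 hp hy)
      (h.topLevel_mul_lt hp0 hp) (by linarith) hy.div_le_one (by rw [h.K_eq]; linarith)).trans ?_
    calc _ ≤ exp (p * n) * (exp (p * n) * exp (-(p * n * (K / 2 - 4)))) := by gcongr
      _ = _ := by rw [← exp_add, ← exp_add, h.K_eq]; ring_nf
  have h1 := gP_union_tr_le hp0.le hp1 hrows
  have h2 := gP_union_tr_le hp0.le hp1 hov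
  refine (gP_union_le hp0.le hp1 _ _).trans ((add_le_add h1 h2).trans (le_of_eq ?_))
  rw [mul_assoc, ← exp_add]
  ring_nf

/-- A crude form of `le_gP_not_inOmegaRC`, valid for all `p`. -/
lemma mul_exp_le_gP (h : IsConstants β τ γ C K c) (hp0 : 0 < p) (hp : p ≤ c) (hn : 2 ≤ n)
    (hβn : 2 * β ≤ n) (hlogn : log n ≤ p * n) :
    exp (-2) / (2 ^ β * β.factorial) * exp (-(2 * β * (p * n))) ≤
      gP p {B : Grid n | ¬ InOmegaRC β (toM B)} := by
  have hp2 : p ≤ 1 / 2 := by have := h.p_le hp; linarith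
  refine le_trans ?_ (le_gP_not_inOmegaRC hp0 hp2 hβn hn hlogn)
  gcongr
  have hn1 : (1 : ℝ) ≤ n := by exact_mod_cast (by omega : 1 ≤ n)
  calc exp (-(2 * β * (p * n))) = exp (-(2 * (p * n))) ^ β := by rw [← exp_nat_mul]; ring_nf
    _ ≤ (n * exp (-(p * n * (1 + 2 * p)))) ^ β := by
        gcongr
        calc exp (-(2 * (p * n))) ≤ exp (-(p * n * (1 + 2 * p))) := by
              rw [exp_le_exp]
              have : 0 ≤ p * n := by positivity
              nlinarith
          _ ≤ _ := le_mul_of_one_le_left (exp_pos _).le hn1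

/-- In the sparse regime `n * exp (-y)` is not much smaller than `exp (-y / (2β))`. -/
lemma mul_exp_le_gP_small (h : IsConstants β τ γ C K c) (hp0 : 0 < p) (hp : p ≤ c) (hn : 2 ≤ n)
    (hβn : 2 * β ≤ n) (hlogn : log n ≤ p * n)
    (hreg : p * n ≤ (1 + 1 / (2 * (β : ℝ))) * log n) :
    exp (-2) / (2 ^ β * β.factorial) * exp (-(7 / 12 * (p * n))) ≤
      gP p {B : Grid n | ¬ InOmegaRC β (toM B)} := by
  have hp2 : p ≤ 1 / 2 := by have := h.p_le hp; linarith
  refine le_trans ?_ (le_gP_not_inOmegaRC hp0 hp2 hβn hn hlogn)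
  gcongr
  have hβ : (1 : ℝ) ≤ β := by exact_mod_cast h.one_le
  have hn0 : (0 : ℝ) < n := by exact_mod_cast (by omega : 0 < n)
  have hy0 : 0 ≤ p * n := by positivity
  have hpβ : p * β ≤ 1 / 24 := by
    have h1 := hp.trans h.c_le'
    rw [le_div_iff₀ (by positivity)] at h1
    nlinarith
  have e1 : n * exp (-(p * n * (1 + 2 * p))) = exp (log n - p * n * (1 + 2 * p)) := by
    rw [sub_eq_add_neg, exp_add, exp_log hn0]
  rw [e1, ← exp_nat_mul, exp_le_exp]
  have h2 : β * (p * n) ≤ β * log n + 1 / 2 * log n := by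
    have := mul_le_mul_of_nonneg_left hreg (by linarith : (0 : ℝ) ≤ β)
    have e : (β : ℝ) * ((1 + 1 / (2 * β)) * log n) = β * log n + 1 / 2 * log n := by field_simp
    linarith
  have h3 : p * β * (p * n) ≤ 1 / 24 * (p * n) := by gcongr
  nlinarith

lemma gP_badSmall_le (h : IsConstants β τ γ C K c) (hp0 : 0 < p) (hp : p ≤ c) (hn : 1 ≤ n)
    (hy : IsLarge β τ γ C K κ η (p * n)) (hlogn : log n ≤ p * n) (hlog : p * n ≤ 2 * log n) :
    gP p (badSmall n p τ) ≤ 2 * (3 * exp 4 * (p * n) ^ 4 * exp (-(15 / 16 * (p * n))) +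
      exp (-(15 / 16 * (p * n))) + exp (-(p * n))) := by
  have hp1 : p ≤ 1 := by have := h.p_le hp; linarith
  have hn0 : (0 : ℝ) < n := by exact_mod_cast hn
  have hnexp : (n : ℝ) ≤ exp (p * n) := by rwa [← log_le_iff_le_exp hn0]
  have h32 := hy.ge
  set y := p * n with hydef
  set g := y * (1 - τ * (log (1 / τ) + 1)) with hg
  have hgy : 31 / 32 * y ≤ g := by
    have := mul_le_mul_of_nonneg_left h.entropy_le (by linarith : 0 ≤ y)
    rw [hg]
    linarith
  have e1 : exp (-g) ≤ exp (-(15 / 16 * y)) := by rw [exp_le_exp]; linarith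
  have e2 : (n : ℝ) * exp (-(2 * g)) ≤ exp (-(15 / 16 * y)) := by
    calc (n : ℝ) * exp (-(2 * g)) ≤ exp y * exp (-(2 * g)) := by gcongr
      _ = exp (y - 2 * g) := by rw [← exp_add]; ring_nf
      _ ≤ _ := by rw [exp_le_exp]; linarith
  have hsp : gP p {B : Grid n | ¬ LightSparse B (τ * y)} ≤
      3 * exp 4 * y ^ 4 * exp (-(15 / 16 * y)) := by
    refine (gP_not_lightSparse_le hp0 hp1 h.τ_pos h.τ_le).trans ?_
    rw [← hydef, ← hg]
    have hy24 : y ^ 2 ≤ y ^ 4 := pow_le_pow_right₀ (by linarith) (by norm_num)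
    have t1 : y ^ 2 * n * exp (-(2 * g)) ≤ y ^ 4 * exp (-(15 / 16 * y)) := by
      rw [mul_assoc]
      exact mul_le_mul hy24 e2 (by positivity) (by positivity)
    have t2 : y ^ 4 * exp (-g) ≤ y ^ 4 * exp (-(15 / 16 * y)) := by gcongr
    have t3 : y ^ 4 * n * exp (-(2 * g)) ≤ y ^ 4 * exp (-(15 / 16 * y)) := by
      rw [mul_assoc]
      gcongr
    have h4 := exp_pos (4 : ℝ)
    have t1' := mul_le_mul_of_nonneg_left t1 h4.le
    have t2' := mul_le_mul_of_nonneg_left t2 h4.le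
    have t3' := mul_le_mul_of_nonneg_left t3 h4.le
    linarith
  have hall : gP p {B : Grid n | ∀ k, IsLight B (τ * y) k} ≤ exp (-(15 / 16 * y)) :=
    (gP_all_light_le hp0 hp1 hn h.τ_pos h.τ_le).trans e1
  have hmany := gP_not_manyHits_le h hp0 hp1 hy hn hlogn hlog
  have h1 := gP_union_tr_le hp0.le hp1 hsp
  have h2 := gP_union_tr_le hp0.le hp1 hall
  have h3 := gP_union_tr_le hp0.le hp1 hmany
  refine (gP_union_le hp0.le hp1 _ _).trans ((add_le_add h1
    ((gP_union_le hp0.le hp1 _ _).trans (add_le_add h2 h3))).trans (le_of_eq ?_))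
  ring

/-- In the denser regime, `β + 1` light rows and columns are less likely than `β` zero ones by a factor
`n * exp (-(1 - o(1)) y)`, which tends to `0` as `y` exceeds `log n` by a constant factor. -/
lemma gP_many_light_le_mul (h : IsConstants β τ γ C K c) (hp0 : 0 < p) (hp : p ≤ c) (hn : 2 ≤ n)
    (hβn : 2 * β ≤ n) (hη : 0 < η) (hy : IsLarge β τ γ C K κ η (p * n)) (hlogn : log n ≤ p * n)
    (hreg : (1 + 1 / (2 * (β : ℝ))) * log n ≤ p * n) :
    gP p {B : Grid n | ¬ (lightSet B (τ * (p * n))).card +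
      (lightSet (tr B) (τ * (p * n))).card ≤ β} ≤
      η / 2 * gP p {B : Grid n | ¬ InOmegaRC β (toM B)} := by
  have hp2 : p ≤ 1 / 2 := by have := h.p_le hp; linarith
  have hp1 : p ≤ 1 := by linarith
  have hβ : (1 : ℝ) ≤ β := by exact_mod_cast h.one_le
  have hn0 : (0 : ℝ) < n := by exact_mod_cast (by omega : 0 < n)
  set y := p * n with hydef
  have hy0 : 0 < y := by positivity
  set g := y * (1 - τ * (log (1 / τ) + 1)) with hg
  set c₀ : ℝ := exp (-2) / (2 ^ β * β.factorial) with hc₀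
  have hlow := le_gP_not_inOmegaRC hp0 hp2 hβn hn hlogn
  rw [← hydef, ← hc₀] at hlow
  have hup := gP_many_light_le (n := n) hp0 hp1 h.τ_pos h.τ_le β
  rw [← hydef, ← hg] at hup
  refine hup.trans ?_
  have hexp : (n : ℝ) * exp (-((β + 1) * g)) ≤
      exp (-(y / (2 * (2 * β + 1)))) * exp (-(y * (1 + 2 * p))) ^ β := by
    have hlogn2 : log n ≤ y - y / (2 * β + 1) := by
      have e : y - y / (2 * β + 1) = 2 * β * y / (2 * β + 1) := by field_simp; ring
      rw [e, le_div_iff₀ (by positivity)]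
      have e2 : (1 + 1 / (2 * (β : ℝ))) * log n * (2 * β) = log n * (2 * β + 1) := by
        field_simp
      have := mul_le_mul_of_nonneg_right hreg (by positivity : (0 : ℝ) ≤ 2 * β)
      linarith
    have h1 := mul_le_mul_of_nonneg_left h.entropy_mul_le hy0.le
    have h2 : p * β ≤ 1 / (8 * (2 * β + 1)) := by
      have h1 := hp.trans h.c_le'
      rw [le_div_iff₀ (by positivity)] at h1 ⊢
      linarith
    have h3 := mul_le_mul_of_nonneg_left h2 hy0.le
    have e3 : y * (1 / (4 * (2 * β + 1))) = y / (2 * β + 1) / 4 := by field_simp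
    have e4 : y * (1 / (8 * (2 * β + 1))) = y / (2 * β + 1) / 8 := by field_simp
    have e5 : y / (2 * (2 * β + 1)) = y / (2 * β + 1) / 2 := by field_simp
    rw [e3] at h1
    rw [e4] at h3
    have e6 : (n : ℝ) * exp (-((β + 1) * g)) = exp (log n - (β + 1) * g) := by
      rw [sub_eq_add_neg, exp_add, exp_log hn0]
    rw [e6, ← exp_nat_mul, ← exp_add, exp_le_exp, e5, hg]
    nlinarith
  have hprob := hy.prob_large
  rw [← hc₀] at hprob
  calc (β + 2) * (n : ℝ) ^ (β + 1) * exp ((β + 1) ^ 2 - (β + 1) * g)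
      = (β + 2) * exp ((β + 1) ^ 2) * n ^ β * (n * exp (-((β + 1) * g))) := by
        rw [sub_eq_add_neg, exp_add]; ring
    _ ≤ (β + 2) * exp ((β + 1) ^ 2) * n ^ β *
          (exp (-(y / (2 * (2 * β + 1)))) * exp (-(y * (1 + 2 * p))) ^ β) := by gcongr
    _ = (β + 2) * exp ((β + 1) ^ 2) * exp (-(y / (2 * (2 * β + 1)))) *
          (n * exp (-(y * (1 + 2 * p)))) ^ β := by rw [mul_pow]; ring
    _ ≤ η / 2 * c₀ * (n * exp (-(y * (1 + 2 * p)))) ^ β := by gcongr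
    _ = η / 2 * (c₀ * (n * exp (-(y * (1 + 2 * p)))) ^ β) := by ring
    _ ≤ _ := by gcongr

/-- The comparison of the two probabilities for given `n`, `p` and accuracy `η`. -/
lemma abs_gP_sub_gP_le (h : IsConstants β τ γ C K c) (hp0 : 0 < p) (hp : p ≤ c) (hn : 2 ≤ n)
    (hβn : 2 * β ≤ n) (hη : 0 < η) (hy : IsLarge β τ γ C K (η / 4) η (p * n))
    (hlogn : log n ≤ p * n) (hnη : 4096 ≤ (n : ℝ) ^ η) (hnκ : 64 * C ≤ (n : ℝ) ^ (η / 4)) :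
    |gP p {B : Grid n | ¬ InOmegaT β (T1 β γ (32 * C) n p) ((n : ℝ) ^ (-1 + -η)) (toM B)} -
      gP p {B : Grid n | ¬ InOmegaRC β (toM B)}| ≤
      η * gP p {B : Grid n | ¬ InOmegaRC β (toM B)} := by
  have hp1 : p ≤ 1 := by have := h.p_le hp; linarith
  have hn0 : (0 : ℝ) < n := by exact_mod_cast (by omega : 0 < n)
  have hβ : (1 : ℝ) ≤ β := by exact_mod_cast h.one_le
  have hC := h.one_le_C
  have hγ := h.two_lt_γ
  have h32 := hy.ge
  have hρ := hy.ratio_ge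
  have hD : 1 ≤ 32 * C * (p * n) := by nlinarith
  have hθ0 : 0 < (n : ℝ) ^ (-1 + -η) := by positivity
  have hreg_iff : p ≤ (1 + 1 / (2 * (β : ℝ))) * (log n / n) ↔
      p * n ≤ (1 + 1 / (2 * (β : ℝ))) * log n := by
    rw [← mul_div_assoc, le_div_iff₀ hn0]
  have hlog2 : p ≤ (1 + 1 / (2 * (β : ℝ))) * (log n / n) → p * n ≤ 2 * log n := by
    intro hreg
    refine (hreg_iff.1 hreg).trans ?_
    have h1 : 1 / (2 * (β : ℝ)) ≤ 1 := by
      rw [div_le_one (by positivity)]; linarith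
    have h2 : 0 ≤ log n := log_nonneg (by exact_mod_cast (by omega : 1 ≤ n))
    nlinarith
  set q := gP p {B : Grid n | ¬ InOmegaRC β (toM B)} with hq
  -- zero rows or columns make the bound fail
  have hlow : q ≤
      gP p {B : Grid n | ¬ InOmegaT β (T1 β γ (32 * C) n p) ((n : ℝ) ^ (-1 + -η)) (toM B)} :=
    gP_mono hp0.le hp1 fun B hB hT =>
      hB (inOmegaRC_of_inOmegaT hθ0 (single_mem_T1 h hp0 hp hy hlog2) hT)
  have hcommon : gP p (badCommon n p γ C K) ≤ η / 2 * q := by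
    refine (gP_badCommon_le h hp0 hp (by omega) hy hlogn).trans ?_
    calc _ ≤ η / 2 * (exp (-2) / (2 ^ β * β.factorial)) * exp (-(2 * β * (p * n))) := by
          exact mul_le_mul_of_nonneg_right hy.prob_common (exp_pos _).le
      _ = η / 2 * (exp (-2) / (2 ^ β * β.factorial) * exp (-(2 * β * (p * n)))) := by ring
      _ ≤ _ := by
          gcongr
          exact mul_exp_le_gP h hp0 hp hn hβn hlogn
  -- outside of an event of small relative probability, the converse holds
  have hup : ∃ S : Set (Grid n), gP p S ≤ η / 2 * q ∧
      {B : Grid n | ¬ InOmegaT β (T1 β γ (32 * C) n p) ((n : ℝ) ^ (-1 + -η)) (toM B)} ⊆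
        {B : Grid n | ¬ InOmegaRC β (toM B)} ∪ (badCommon n p γ C K ∪ S) := by
    by_cases hreg : p ≤ (1 + 1 / (2 * (β : ℝ))) * (log n / n)
    · have hlog := hlog2 hreg
      refine ⟨badSmall n p τ, ?_, ?_⟩
      · refine (gP_badSmall_le h hp0 hp (by omega) hy hlogn hlog).trans ?_
        refine hy.prob_small.trans ?_
        rw [mul_assoc]
        gcongr
        exact mul_exp_le_gP_small h hp0 hp hn hβn hlogn (hreg_iff.1 hreg)
      · intro B hB
        by_contra hcon
        simp only [badCommon, badSmall, Set.mem_union, Set.mem_ofPred_eq, not_or, not_not,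
          not_forall] at hcon
        obtain ⟨hRC, ⟨⟨hr, hr'⟩, ho, ho'⟩, ⟨hs, hs'⟩, ⟨hk, hk'⟩, hm, hm'⟩ := hcon
        refine hB (inOmegaT_small h hp0 hp hy (by omega) hlog hreg ?_ hRC hr hr' ho ho' hs hs'
          hk hk' hm hm')
        have hs1 : 1 ≤ sSmall γ n p := by
          have := one_le_t₀ (two_le_expLevel hy)
          unfold sSmall
          omega
        refine theta_condition hD hs1 (by omega) hη hnη ?_
        have := base_pow_sSmall_le h hp0 hp (by omega) (by positivity) hy hlog
        rwa [show 1 + 2 * (η / 4) = 1 + η / 2 by ring] at this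
    · refine ⟨{B | ¬ (lightSet B (τ * (p * n))).card +
        (lightSet (tr B) (τ * (p * n))).card ≤ β}, ?_, ?_⟩
      · refine gP_many_light_le_mul h hp0 hp hn hβn hη hy hlogn ?_
        rw [hreg_iff] at hreg
        exact (not_le.1 hreg).le
      · intro B hB
        by_contra hcon
        simp only [badCommon, Set.mem_union, Set.mem_ofPred_eq, not_or, not_not] at hcon
        obtain ⟨hRC, ⟨⟨hr, hr'⟩, ho, ho'⟩, hl⟩ := hcon
        refine hB (inOmegaT_large h hp0 hp hy (by omega) hreg ?_ hRC hr hr' ho ho' hl)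
        refine theta_condition hD (by simp [sLarge]) (by omega) hη hnη ?_
        have := base_pow_sLarge_le h hp0 hp (by omega) (by positivity) hy hnκ
        rwa [show 1 + 2 * (η / 4) = 1 + η / 2 by ring] at this
  obtain ⟨S, hS, hsub⟩ := hup
  have h1 := (gP_mono hp0.le hp1 hsub).trans ((gP_union_le hp0.le hp1 _ _).trans
    (add_le_add_right (gP_union_le hp0.le hp1 _ _) _))
  rw [abs_of_nonneg (by linarith)]
  linarith

lemma exists_isConstants (hβ : 1 ≤ β) :
    ∃ τ γ C K c : ℝ, 0 < c ∧ IsConstants β τ γ C K c := by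
  have hβ' : (1 : ℝ) ≤ β := by exact_mod_cast hβ
  obtain ⟨τ, h0, h1, h2⟩ := exists_small_entropy
    (ε := min (1 / 32 : ℝ) (1 / (4 * (2 * (β : ℝ) + 1)) / ((β : ℝ) + 1))) (by positivity)
  refine ⟨τ, 2 * exp (16 * (4 * β + 14) / τ), 2 * β + 4, 4 * β + 14,
    min (1 / (2 * (2 * exp (16 * (4 * β + 14) / τ)))) (1 / (8 * β * (2 * β + 1))),
    by positivity, hβ, h0, h1, h2.trans (min_le_left _ _), ?_, rfl, rfl, rfl, min_le_left _ _,
    min_le_right _ _⟩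
  have := h2.trans (min_le_right _ _)
  rw [le_div_iff₀ (by positivity)] at this
  linarith

end Comparison

end SteepVectors

end

theorem mainTheorem3 (β : ℕ) (hβ : 1 ≤ β) :
    ∃ c C γ : ℝ, 0 < c ∧ c < 1 / 2 ∧ 1 < C ∧ 1 < γ ∧ c ≤ 1 / (2 * γ) ∧
      ∃ ε δ : ℕ → ℝ, Tendsto ε atTop (𝓝 0) ∧ Tendsto δ atTop (𝓝 0) ∧
        ∀ᶠ n : ℕ in atTop, ∀ p : ℝ, log n / n ≤ p → p ≤ c →
          ∀ (Ω : Type*) [MeasurableSpace Ω] (μ : Measure Ω) [IsProbabilityMeasure μ]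
            (A : Ω → Matrix (Fin n) (Fin n) ℝ), SteepVectors.IsBernoulliMatrix μ p A →
            |μ.real {ω | ¬ SteepVectors.InOmegaT β (SteepVectors.T1 β γ C n p)
                  ((n : ℝ) ^ (-1 + ε n)) (A ω)} -
                μ.real {ω | ¬ SteepVectors.InOmegaRC β (A ω)}| ≤
              δ n * μ.real {ω | ¬ SteepVectors.InOmegaRC β (A ω)} := by
  obtain ⟨τ, γ, C, K, c, hc, h⟩ := SteepVectors.exists_isConstants hβ
  have hC := h.one_le_C
  have hγ := h.two_lt_γ
  have hc2 := h.p_le le_rfl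
  refine ⟨c, 32 * C, γ, hc, by linarith, by linarith, by linarith, h.c_le, ?_⟩
  obtain ⟨η, hη, hP⟩ := SteepVectors.exists_tendsto_zero_of_forall_eventually
    (P := fun n η => ∀ p : ℝ, log n / n ≤ p → p ≤ c → 0 < p ∧
      |SteepVectors.gP p {B : SteepVectors.Grid n | ¬ SteepVectors.InOmegaT β
          (SteepVectors.T1 β γ (32 * C) n p) ((n : ℝ) ^ (-1 + -η)) (SteepVectors.toM B)} -
        SteepVectors.gP p {B : SteepVectors.Grid n |
          ¬ SteepVectors.InOmegaRC β (SteepVectors.toM B)}| ≤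
        η * SteepVectors.gP p {B : SteepVectors.Grid n |
          ¬ SteepVectors.InOmegaRC β (SteepVectors.toM B)}) (by
      intro η hη
      obtain ⟨Y, hY⟩ := eventually_atTop.1 (SteepVectors.eventually_isLarge β h.τ_pos
        (by linarith : 0 < γ) hC h.K_pos.le (by positivity : 0 < η / 4) hη)
      have hlog : Tendsto (fun n : ℕ => log (n : ℝ)) atTop atTop :=
        tendsto_log_atTop.comp tendsto_natCast_atTop_atTop
      filter_upwards [hlog.eventually_ge_atTop Y, eventually_ge_atTop (2 * β + 2),
        ((tendsto_rpow_atTop hη).comp tendsto_natCast_atTop_atTop).eventually_ge_atTop 4096,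
        ((tendsto_rpow_atTop (by positivity : 0 < η / 4)).comp
          tendsto_natCast_atTop_atTop).eventually_ge_atTop (64 * C)] with n hn1 hn2 hn3 hn4
      intro p hp1 hp2
      have hn0 : (1 : ℝ) < n := by exact_mod_cast (by omega : 1 < n)
      have hp0 : 0 < p := lt_of_lt_of_le (div_pos (log_pos hn0) (by linarith)) hp1
      have hlogn : log n ≤ p * n := by rwa [div_le_iff₀ (by linarith)] at hp1
      exact ⟨hp0, SteepVectors.abs_gP_sub_gP_le h hp0 hp2 (by omega) (by omega) hη
        (hY _ (hn1.trans hlogn)) hlogn hn3 hn4⟩)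
  refine ⟨fun n => -η n, η, by simpa using hη.neg, hη, ?_⟩
  filter_upwards [hP] with n hn p hp1 hp2 Ω _ μ _ A hA
  obtain ⟨hp0, hmain⟩ := hn p hp1 hp2
  have hp3 : p ≤ 1 := by linarith
  rw [hA.measureReal_eq hp0.le hp3 (fun M => ¬ SteepVectors.InOmegaT β
      (SteepVectors.T1 β γ (32 * C) n p) ((n : ℝ) ^ (-1 + -η n)) M),
    hA.measureReal_eq hp0.le hp3 (fun M => ¬ SteepVectors.InOmegaRC β M)]
  exact hmain
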